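/- **Setting.** $N$ agents share a state space $\mathcal S$ and an action space $\mathcal A$ (measurable spaces). Agent $i$ has a reward $\mathcal R^{(i)}:\mathcal S\times\mathcal A\to[0,R_{\max}]$, a transition kernel $\mathcal P^{(i)}$ and an initial distribution $\rho^{(i)}$; no similarity of the environments is assumed. The horizon is $H$ and the discount factor is $\gamma\in(0,1)$. The agents use a common policy with positive density $\pi_\theta(a\mid s)$, $\theta\in\mathbb R^d$, with respect to a $\sigma$-finite measure on $\mathcal A$. A trajectory $\tau=(s_0,a_0,\dots,s_{H-1},a_{H-1},s_H)$ of agent $i$ has law $p^{(i)}(\tau\mid\theta)=\rho^{(i)}(s_0)\prod_{h=0}^{H-1}\pi_\theta(a_h\mid s_h)\mathcal P^{(i)}(s_{h+1}\mid s_h,a_h)$. Put $J_i(\theta)=\mathbb E_{\tau\sim p^{(i)}(\cdot\mid\theta)}\big[\sum_{h<H}\gamma^h\mathcal R^{(i)}(s_h,a_h)\big]$, $J=\frac1N\sum_i J_i$, $g_i(\tau\mid\theta)=\sum_{t<H}\big(\sum_{h=t}^{H-1}\gamma^h\mathcal R^{(i)}(s_h,a_h)\big)\nabla\log\pi_\theta(a_t\mid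 s_t)$ and $w^{(i)}(\tau\mid\theta',\theta)=p^{(i)}(\tau\mid\theta')/p^{(i)}(\tau\mid\theta)=\prod_{h<H}\pi_{\theta'}(a_h\mid s_h)/\pi_\theta(a_h\mid s_h)$. **Assumptions** (constants $G,M,\sigma,W>0$). (1) For all $s,a$, $\theta\mapsto\log\pi_\theta(a\mid s)$ is twice differentiable with $\|\nabla_\theta\log\pi_\theta(a\mid s)\|\le G$ and $\|\nabla^2_\theta\log\pi_\theta(a\mid s)\|_2\le M$. (2) $\mathbb E_{\tau\sim p^{(i)}(\cdot\mid\theta)}\|g_i(\tau\mid\theta)-\nabla J_i(\theta)\|^2\le\sigma^2$ for all $i,\theta$. (3) $\operatorname{Var}_{\tau\sim p^{(i)}(\cdot\mid\theta_2)}\big(w^{(i)}(\tau\mid\theta_1,\theta_2)\big)\le W$ for all $i,\theta_1,\theta_2$. **Algorithms.** Inputs: $\theta_{-1}=\theta_0$, numbers $R$ of rounds and $K$ of local steps, local and global step-sizes $\eta,\lambda>0$, momentum $\beta\in(0,1]$, and $u_0=\frac1{NB}\sum_{i=1}^N\sum_{b=1}^B g_i(\tau^{(i)}_b\mid\theta_0)$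 with $B=\lceil K/(R\beta^2)\rceil$ independent trajectories $\tau_b^{(i)}\sim p^{(i)}(\cdot\mid\theta_0)$ per agent. In round $r=0,\dots,R-1$ every agent $i$, independently of the others, starts at $\theta^{(i)}_{r,0}=\theta_r$ and performs, for $k=0,\dots,K-1$, the step $\theta^{(i)}_{r,k+1}=\theta^{(i)}_{r,k}+\eta u^{(i)}_{r,k}$. The server then sets $u_{r+1}=\frac1{\eta NK}\sum_i(\theta^{(i)}_{r,K}-\theta_r)$ and $\theta_{r+1}=\theta_r+\lambda u_{r+1}$. Write $x=\theta^{(i)}_{r,k}$. - *FedSVRPG-M*: sample $\tau\sim p^{(i)}(\cdot\mid x)$ and put $u^{(i)}_{r,k}=\beta g_i(\tau\mid x)+(1-\beta)\big[u_r+g_i(\tau\mid x)-w^{(i)}(\tau\mid\theta_{r-1},x)\,g_i(\tau\mid\theta_{r-1})\big]$. - *FedHAPG-M*: sample $\alpha$ uniformly from $[0,1]$, put $y=\alpha\theta_{r-1}+(1-\alpha)x$ and $v=x-\theta_{r-1}$, sample $\tau\sim p^{(i)}(\cdot\mid y)$, and put $u^{(i)}_{r,k}=\beta w^{(i)}(\tau\mid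 x,y)\,g_i(\tau\mid x)+(1-\beta)\big[u_r+\Lambda\big]$ with $\Lambda=\langle\nabla\log p^{(i)}(\tau\mid y),v\rangle\,g_i(\tau\mid y)+\nabla\langle g_i(\tau\mid\cdot),v\rangle(y)$. So each agent samples $B+RK$ trajectories in total. **Corollary 1.** For each of the two algorithms there is a constant $C>0$, depending only on $H,\gamma,R_{\max},G,M,\sigma,W$, such that the following holds. For all $N,K\ge1$ and all $0<\epsilon\le 1/(NK)^2$ there are $R\ge1$, $\eta,\lambda>0$ and $\beta\in(0,1]$ such that the number of trajectories sampled by each agent satisfies $$B+RK\;\le\;C\,\frac{\epsilon^{-3/2}}{N},$$ and, for all $N$ environments and every policy satisfying Assumptions (1)–(3) and every $\theta_0$, the algorithm with these parameters satisfies $$\frac1R\sum_{r=0}^{R-1}\mathbb E\big[\|\nabla J(\theta_r)\|^2\big]\le\epsilon .$$ That is, an iterate chosen uniformly at random among $\theta_0,\dots,\theta_{R-1}$ is, in expectation, an $\epsilon$-first-order stationary point ($\|\nabla J(\theta)\|^2\le\epsilon$). Hence both algorithms need $\mathcal O(\epsilon^{-3/2}/N)$ trajectories per agent. -/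

import Mathlib

open MeasureTheory ProbabilityTheory

universe u v

noncomputable section

namespace FedRL

/-- The parameter space `ℝ^d` with the Euclidean norm. -/
abbrev Param (d : ℕ) : Type := EuclideanSpace ℝ (Fin d)

/-- A trajectory `(s_0, a_0, …, s_{H-1}, a_{H-1}, s_H)`: its `H + 1` states and its `H` actions. -/
abbrev Traj (S : Type u) (A : Type v) (H : ℕ) : Type (max u v) := (Fin (H + 1) → S) × (Fin H → A)

/-- The environment of one agent: reward function with values in `[0, Rmax]`, transition kernel
and initial state distribution. -/
structure Env (S : Type u) (A : Type v) [MeasurableSpace S] [MeasurableSpace A] (Rmax : ℝ) where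
  reward : S → A → ℝ
  reward_measurable : Measurable (fun x : S × A => reward x.1 x.2)
  reward_nonneg : ∀ s a, 0 ≤ reward s a
  reward_le : ∀ s a, reward s a ≤ Rmax
  trans : Kernel (S × A) S
  trans_markov : IsMarkovKernel trans
  init : Measure S
  init_prob : IsProbabilityMeasure init

/-- A parametrized stochastic policy, given by its density `π_θ(a | s)` with respect to a reference
measure `ν` on the actions (counting measure for discrete actions, Lebesgue measure for continuous
ones). The density is positive, so that its logarithm makes sense for all states and actions. -/
structure Policy (d : ℕ) (S : Type u) (A : Type v) [MeasurableSpace S] [MeasurableSpace A]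
    (ν : Measure A) where
  dens : Param d → S → A → ℝ
  dens_measurable : Measurable (fun x : Param d × S × A => dens x.1 x.2.1 x.2.2)
  dens_pos : ∀ θ s a, 0 < dens θ s a
  dens_lintegral : ∀ θ s, ∫⁻ a, ENNReal.ofReal (dens θ s a) ∂ν = 1

section Trajectories

variable {d : ℕ} {S : Type u} {A : Type v} [MeasurableSpace S] [MeasurableSpace A]
  {ν : Measure A} {Rmax : ℝ}

/-- Reference measure for the next action and the next state after a partial trajectory `τ`:
`ν(da) P(ds' | s, a)` with `s` the last state of `τ`. -/
def stepKernel (ν : Measure A) (e : Env S A Rmax) (n : ℕ) : Kernel (Traj S A n) (A × S) :=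
  (Kernel.const (Traj S A n) ν) ⊗ₖ
    (e.trans.comap (fun x : Traj S A n × A => (x.1.1 (Fin.last n), x.2)) (by fun_prop))

/-- The reference measure `ρ(ds_0) ∏_h ν(da_h) P(ds_{h+1} | s_h, a_h)` on trajectories. -/
def refMeasure (ν : Measure A) (e : Env S A Rmax) : (n : ℕ) → Measure (Traj S A n)
  | 0 => e.init.map (fun s => (fun _ => s, Fin.elim0))
  | n + 1 => (refMeasure ν e n ⊗ₘ stepKernel ν e n).map
      (fun x => (Fin.snoc (α := fun _ => S) x.1.1 x.2.2, Fin.snoc (α := fun _ => A) x.1.2 x.2.1))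

/-- The factor `∏_h π_θ(a_h | s_h)` of the trajectory density; the remaining factors of
`p(τ | θ)` do not depend on `θ` and make up the reference measure. -/
def trajDens (π : Policy d S A ν) {H : ℕ} (θ : Param d) (τ : Traj S A H) : ℝ :=
  ∏ h : Fin H, π.dens θ (τ.1 h.castSucc) (τ.2 h)

/-- The trajectory distribution
`p(τ | θ) = ρ(s_0) ∏_h π_θ(a_h | s_h) P(s_{h+1} | s_h, a_h)`. -/
def trajLaw (π : Policy d S A ν) (e : Env S A Rmax) (H : ℕ) (θ : Param d) :
    Measure (Traj S A H) :=
  (refMeasure ν e H).withDensity (fun τ => ENNReal.ofReal (trajDens π θ τ))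

/-- The importance weight `w(τ | θ', θ) = p(τ | θ') / p(τ | θ)`. -/
def isWeight (π : Policy d S A ν) {H : ℕ} (τ : Traj S A H) (θ' θ : Param d) : ℝ :=
  trajDens π θ' τ / trajDens π θ τ

/-- The log-density `θ ↦ log π_θ(a | s)` of the policy. -/
def logPolicy (π : Policy d S A ν) (s : S) (a : A) (θ : Param d) : ℝ := Real.log (π.dens θ s a)

/-- The cumulative discounted reward of a trajectory. -/
def totalReward (e : Env S A Rmax) (γ : ℝ) {H : ℕ} (τ : Traj S A H) : ℝ :=
  ∑ h : Fin H, γ ^ (h : ℕ) * e.reward (τ.1 h.castSucc) (τ.2 h)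

/-- The objective `J_i(θ)` of one agent. -/
def localObj (π : Policy d S A ν) (e : Env S A Rmax) (H : ℕ) (γ : ℝ) (θ : Param d) : ℝ :=
  ∫ τ, totalReward e γ τ ∂(trajLaw π e H θ)

/-- The federated objective `J(θ) = (1/N) ∑_i J_i(θ)`. -/
def obj {N : ℕ} (π : Policy d S A ν) (env : Fin N → Env S A Rmax) (H : ℕ) (γ : ℝ)
    (θ : Param d) : ℝ :=
  (1 / (N : ℝ)) * ∑ i, localObj π (env i) H γ θ

/-- The stochastic policy gradient
`g(τ | θ) = ∑_t (∑_{h ≥ t} γ^h R(s_h, a_h)) ∇ log π_θ(a_t | s_t)`. -/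
def pgEst (π : Policy d S A ν) (e : Env S A Rmax) (γ : ℝ) {H : ℕ} (τ : Traj S A H)
    (θ : Param d) : Param d :=
  ∑ t : Fin H, (∑ h ∈ Finset.Ici t, γ ^ (h : ℕ) * e.reward (τ.1 h.castSucc) (τ.2 h)) •
    gradient (logPolicy π (τ.1 t.castSucc) (τ.2 t)) θ

/-- The log-density of the policy is twice differentiable in the parameter, with gradient bounded
by `G` and Hessian bounded by `M` in operator norm. -/
def PolicyBounds (π : Policy d S A ν) (G M : ℝ) : Prop :=
  ∀ (s : S) (a : A), Differentiable ℝ (logPolicy π s a) ∧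
    Differentiable ℝ (gradient (logPolicy π s a)) ∧
    ∀ θ, ‖gradient (logPolicy π s a) θ‖ ≤ G ∧ ‖fderiv ℝ (gradient (logPolicy π s a)) θ‖ ≤ M

/-- The variance of the stochastic policy gradient is at most `σ ^ 2`. -/
def GradVarianceBound (π : Policy d S A ν) (e : Env S A Rmax) (H : ℕ) (γ σ : ℝ) : Prop :=
  ∀ θ, ∫⁻ τ, ‖pgEst π e γ τ θ - gradient (localObj π e H γ) θ‖ₑ ^ 2 ∂(trajLaw π e H θ) ≤
    ENNReal.ofReal (σ ^ 2)

/-- The variance of the importance weights is at most `W`. -/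
def WeightVarianceBound (π : Policy d S A ν) (e : Env S A Rmax) (H : ℕ) (W : ℝ) : Prop :=
  ∀ θ₁ θ₂, evariance (fun τ => isWeight π τ θ₁ θ₂) (trajLaw π e H θ₂) ≤ ENNReal.ofReal W

/-! The two algorithms. They differ only in the law of the local direction `u_{r,k}` of an agent
whose current local parameter is `x`, given the previous server parameter `θp = θ_{r-1}` and the
server direction `ur = u_r`. -/

/-- The local direction of FedSVRPG-M, for a trajectory sampled at `x`. -/
def svrpgLaw (π : Policy d S A ν) (e : Env S A Rmax) (H : ℕ) (γ β : ℝ) (θp ur x : Param d) :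
    Measure (Param d) :=
  (trajLaw π e H x).map (fun τ =>
    β • pgEst π e γ τ x +
      (1 - β) • (ur + pgEst π e γ τ x - isWeight π τ θp x • pgEst π e γ τ θp))

/-- The second-order correction
`⟨∇ log p(τ | y), v⟩ g(τ | y) + ∇ ⟨g(τ | y), v⟩` of FedHAPG-M. -/
def hessCorr (π : Policy d S A ν) (e : Env S A Rmax) (γ : ℝ) {H : ℕ} (τ : Traj S A H)
    (y w : Param d) : Param d :=
  (inner ℝ (gradient (fun θ => Real.log (trajDens π θ τ)) y) w) • pgEst π e γ τ y +
    gradient (fun θ => inner ℝ (pgEst π e γ τ θ) w) y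

/-- The local direction of FedHAPG-M: `α` is uniform on `[0, 1]` and the trajectory is sampled at
`α θp + (1 - α) x`. -/
def hapgLaw (π : Policy d S A ν) (e : Env S A Rmax) (H : ℕ) (γ β : ℝ) (θp ur x : Param d) :
    Measure (Param d) :=
  ((volume : Measure ℝ).restrict (Set.Icc 0 1)).bind (fun α =>
    (trajLaw π e H (α • θp + (1 - α) • x)).map (fun τ =>
      β • (isWeight π τ x (α • θp + (1 - α) • x) • pgEst π e γ τ x) +
        (1 - β) • (ur + hessCorr π e γ τ (α • θp + (1 - α) • x) (x - θp))))

/-- The two algorithms. -/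
inductive Algo where
  | fedSVRPGM : Algo
  | fedHAPGM : Algo

/-- The law of the local direction used by an algorithm. -/
def dirLaw (alg : Algo) (π : Policy d S A ν) (e : Env S A Rmax) (H : ℕ) (γ β : ℝ)
    (θp ur x : Param d) : Measure (Param d) :=
  match alg with
  | .fedSVRPGM => svrpgLaw π e H γ β θp ur x
  | .fedHAPGM => hapgLaw π e H γ β θp ur x

/-- The law of the local parameter `θ_{r,k}` of one agent, started at `θr = θ_r`. -/
def localLaw (alg : Algo) (π : Policy d S A ν) (e : Env S A Rmax) (H : ℕ) (γ η β : ℝ)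
    (θp θr ur : Param d) : ℕ → Measure (Param d)
  | 0 => Measure.dirac θr
  | k + 1 => (localLaw alg π e H γ η β θp θr ur k).bind (fun x =>
      (dirLaw alg π e H γ β θp ur x).map (fun dir => x + η • dir))

/-- One communication round: the law of `(θ_r, θ_{r+1}, u_{r+1})` given
`x = (θ_{r-1}, θ_r, u_r)`. The agents perform their `K` local steps independently. -/
def roundLaw (alg : Algo) {N : ℕ} (π : Policy d S A ν) (env : Fin N → Env S A Rmax) (H : ℕ)
    (γ : ℝ) (K : ℕ) (η lam β : ℝ) (x : Param d × Param d × Param d) :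
    Measure (Param d × Param d × Param d) :=
  (Measure.pi (fun i => localLaw alg π (env i) H γ η β x.1 x.2.1 x.2.2 K)).map (fun y =>
    let unew : Param d := (1 / (η * N * K)) • ∑ i, (y i - x.2.1)
    (x.2.1, x.2.1 + lam • unew, unew))

/-- The law of `(θ_{-1}, θ_0, u_0)`, where `θ_{-1} = θ_0` and `u_0` is the average of the
stochastic gradients of `B` independent trajectories of each agent, sampled at `θ_0`. -/
def initLaw {N : ℕ} (π : Policy d S A ν) (env : Fin N → Env S A Rmax) (H : ℕ) (γ : ℝ) (B : ℕ)
    (θ₀ : Param d) : Measure (Param d × Param d × Param d) :=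
  (Measure.pi (fun ib : Fin N × Fin B => trajLaw π (env ib.1) H θ₀)).map (fun τ =>
    (θ₀, θ₀, (1 / ((N : ℝ) * B)) • ∑ ib : Fin N × Fin B, pgEst π (env ib.1) γ (τ ib) θ₀))

/-- The law of the server state `(θ_{r-1}, θ_r, u_r)` at the start of round `r`. -/
def serverLaw (alg : Algo) {N : ℕ} (π : Policy d S A ν) (env : Fin N → Env S A Rmax) (H : ℕ)
    (γ : ℝ) (K B : ℕ) (η lam β : ℝ) (θ₀ : Param d) : ℕ → Measure (Param d × Param d × Param d)
  | 0 => initLaw π env H γ B θ₀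
  | r + 1 => (serverLaw alg π env H γ K B η lam β θ₀ r).bind
      (roundLaw alg π env H γ K η lam β)

end Trajectories

/-- The size `B = ⌈K / (R β²)⌉` of the initial batch of each agent. -/
def initBatch (K R : ℕ) (β : ℝ) : ℕ := ⌈(K : ℝ) / (R * β ^ 2)⌉₊

/-- The number of trajectories sampled by each agent in `R` rounds: `B` for the initial direction
and one in each of the `R K` local steps. -/
def samplesPerAgent (K R : ℕ) (β : ℝ) : ℕ := initBatch K R β + R * K

end FedRL

end

/-! Both algorithms are momentum methods whose local direction at `x` has the same conditional mean
`meanDir`, namely (1-β)(u_r - ∇J_i(θ_{r-1})) + ∇J_i(x), and variance of order β² + ‖x - θ_{r-1}‖²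
(`hasMeanVar_dirLaw`). For FedSVRPG-M the mean follows from importance weighting; for FedHAPG-M it
follows from writing ∇J_i(x) - ∇J_i(θ_{r-1}) as the integral of Hessian-vector products along the
segment (`integral_meanHessCorr`). The variance estimates rest on deterministic bounds for the score
and for g_i and its derivative, together with the second moment of the importance weights.

The number of samples does not involve η, so η can be taken so small that an agent barely moves
during its K steps. The normalized local update is then the mean direction at θ_r plus noise of
variance of order 1/K and a negligible bias (`LocalBounds.normDev_bounds`). Averaging over the
independent agents divides the noise by N and leaves the bias. Different environments do no harm:
every ∇J_i is bounded, so the mean directions of single agents are bounded in terms of the server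
error, and only a small multiple of their size enters. With e_r = u_r - ∇J(θ_{r-1}) this gives the
recursion E‖e_{r+1}‖² ≤ (1 - β/2)‖e_r‖² + c/(NK) (β² + ‖θ_r - θ_{r-1}‖²) of
`Regular.integral_newDir_sub_sq_le`.

The function (H Rmax - J(θ_r)) + (λ/β)‖e_r‖² + ‖θ_r - θ_{r-1}‖²/(4λ) then decreases in expectation
by (λ/2)‖∇J(θ_r)‖² per round, up to an error of order λβ/(NK). It is nonnegative, so summing over
the rounds bounds the average squared gradient (`Regular.serverLaw_bound`).

Finally, with s = √ε, take β = c₁NKs², λ = c₂NKs and R of order 1/(λs²). Then RK is of order s⁻³/N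
and the initial batch is of order s⁻¹/N up to rounding. The condition NKs ≤ 1 keeps β ≤ 1 and λ
bounded, and it absorbs the rounding of R and B. -/

noncomputable section

namespace FedRL

/-! ### Measurability and integration for mixtures and products of laws -/

section General

variable {X T Y : Type*} [MeasurableSpace X] [MeasurableSpace T] [MeasurableSpace Y]

theorem measurable_map_of_uncurry {κ : X → Measure T} (hκ : Measurable κ)
    [∀ x, IsProbabilityMeasure (κ x)] {f : X → T → Y} (hf : Measurable (Function.uncurry f)) :
    Measurable fun x => (κ x).map (f x) := by
  refine Measure.measurable_of_measurable_coe _ fun s hs => ?_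
  simp_rw [fun x => Measure.map_apply (μ := κ x) (hf.of_uncurry_left (x := x)) hs]
  let k : Kernel X T := ⟨κ, hκ⟩
  have : IsMarkovKernel k := ⟨fun x => inferInstanceAs (IsProbabilityMeasure (κ x))⟩
  exact Kernel.measurable_kernel_prodMk_left (κ := k) (hf hs)

theorem measurable_bind_of_uncurry {κ : X → Measure T} (hκ : Measurable κ)
    [∀ x, IsProbabilityMeasure (κ x)] {f : X → T → Measure Y}
    (hf : Measurable (Function.uncurry f)) :
    Measurable fun x => (κ x).bind (f x) := by
  refine Measure.measurable_of_measurable_coe _ fun s hs => ?_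
  simp_rw [fun x => Measure.bind_apply (m := κ x) hs (hf.of_uncurry_left (x := x)).aemeasurable]
  let k : Kernel X T := ⟨κ, hκ⟩
  have : IsMarkovKernel k := ⟨fun x => inferInstanceAs (IsProbabilityMeasure (κ x))⟩
  exact Measurable.lintegral_kernel_prod_right (κ := k) (f := fun x t => f x t s)
    ((Measure.measurable_coe hs).comp hf)

/-- Measurable boxes form a generating π-system, and on a box the product measure is a finite
product of measurable functions of the parameter. -/
theorem measurable_pi_measure {ι : Type*} [Fintype ι] {κ : ι → X → Measure T}
    (hκ : ∀ i, Measurable (κ i)) [∀ i x, IsProbabilityMeasure (κ i x)] :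
    Measurable fun x => Measure.pi fun i => κ i x := by
  refine Measurable.measure_of_isPiSystem_of_isProbabilityMeasure
    (generateFrom_pi (α := fun _ : ι => T)).symm (isPiSystem_pi (α := fun _ : ι => T)) ?_
  rintro _ ⟨s, hs, rfl⟩
  simp_rw [Measure.pi_pi]
  exact Finset.measurable_prod _ fun i _ =>
    (Measure.measurable_coe (hs i (Set.mem_univ i))).comp (hκ i)

theorem isProbabilityMeasure_bind {μ : Measure X} [IsProbabilityMeasure μ] {κ : X → Measure T}
    (hκ : Measurable κ) [∀ x, IsProbabilityMeasure (κ x)] : IsProbabilityMeasure (μ.bind κ) :=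
  ⟨by simp [Measure.bind_apply MeasurableSet.univ hκ.aemeasurable]⟩

theorem integral_bind {E : Type*} [NormedAddCommGroup E] [NormedSpace ℝ E] {μ : Measure X}
    {κ : X → Measure T} (hκ : Measurable κ) {f : T → E} (hf : Integrable f (μ.bind κ)) :
    ∫ t, f t ∂(μ.bind κ) = ∫ x, ∫ t, f t ∂(κ x) ∂μ := by
  let k : Kernel X T := ⟨κ, hκ⟩
  change ∫ t, f t ∂(k ∘ₘ μ) = _
  have h : (k ∘ₘ μ) = (k ∘ₖ Kernel.const Unit μ) () := Measure.comp_eq_comp_const_apply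
  have hf' : Integrable f ((k ∘ₖ Kernel.const Unit μ) ()) := h ▸ hf
  rw [h, Kernel.integral_comp hf']
  rfl

theorem integrable_integral_of_bind {E : Type*} [NormedAddCommGroup E] [NormedSpace ℝ E]
    {μ : Measure X}
    {κ : X → Measure T} (hκ : Measurable κ) {f : T → E} (hf : Integrable f (μ.bind κ)) :
    Integrable (fun x => ∫ t, f t ∂(κ x)) μ := by
  let k : Kernel X T := ⟨κ, hκ⟩
  have h : (k ∘ₘ μ) = (k ∘ₖ Kernel.const Unit μ) () := Measure.comp_eq_comp_const_apply
  have hf' : Integrable f ((k ∘ₖ Kernel.const Unit μ) ()) := h ▸ hf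
  exact hf'.integral_comp

end General

/-! ### Second moments of vector-valued random variables -/

section SecondMoment

variable {E : Type*} [NormedAddCommGroup E] [InnerProductSpace ℝ E] [CompleteSpace E]

theorem ofReal_norm_sq {E : Type*} [SeminormedAddCommGroup E] (x : E) :
    ENNReal.ofReal (‖x‖ ^ 2) = ‖x‖ₑ ^ 2 := by
  rw [ENNReal.ofReal_pow (norm_nonneg x), ofReal_norm]

theorem lintegral_enorm_sq_eq {Ω F : Type*} [MeasurableSpace Ω] [NormedAddCommGroup F]
    {μ : Measure Ω} [IsFiniteMeasure μ] {f : Ω → F} (hf : MemLp f 2 μ) :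
    ∫⁻ x, ‖f x‖ₑ ^ 2 ∂μ = ENNReal.ofReal (∫ x, ‖f x‖ ^ 2 ∂μ) := by
  rw [ofReal_integral_eq_lintegral_ofReal hf.integrable_norm_pow' (ae_of_all _ fun x => by positivity)]
  exact lintegral_congr fun x => (ofReal_norm_sq _).symm

theorem memLp_two_of_lintegral_ne_top {Ω F : Type*} [MeasurableSpace Ω] [NormedAddCommGroup F]
    {μ : Measure Ω} {f : Ω → F} (hf : AEStronglyMeasurable f μ)
    (h : ∫⁻ x, ‖f x‖ₑ ^ 2 ∂μ ≠ ⊤) : MemLp f 2 μ := by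
  refine ⟨hf, ?_⟩
  rw [eLpNorm_lt_top_iff_lintegral_rpow_enorm_lt_top (by norm_num) (by norm_num)]
  simpa using h.lt_top

theorem integral_norm_sq_le_of_lintegral_le {Ω F : Type*} [MeasurableSpace Ω]
    [NormedAddCommGroup F] {μ : Measure Ω} [IsFiniteMeasure μ] {f : Ω → F} (hf : MemLp f 2 μ)
    {c : ℝ} (hc : 0 ≤ c)
    (h : ∫⁻ x, ‖f x‖ₑ ^ 2 ∂μ ≤ ENNReal.ofReal c) : ∫ x, ‖f x‖ ^ 2 ∂μ ≤ c := by
  rw [lintegral_enorm_sq_eq hf] at h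
  exact (ENNReal.ofReal_le_ofReal_iff hc).1 h

theorem sq_integral_norm_le {Ω F : Type*} [MeasurableSpace Ω] [NormedAddCommGroup F]
    {μ : Measure Ω} [IsProbabilityMeasure μ] {f : Ω → F} (hf : MemLp f 2 μ) :
    (∫ x, ‖f x‖ ∂μ) ^ 2 ≤ ∫ x, ‖f x‖ ^ 2 ∂μ := by
  have := variance_nonneg (fun x => ‖f x‖) μ
  rw [variance_eq_sub hf.norm] at this
  simpa using this

/-- Bias-variance decomposition. -/
theorem integral_norm_add_smul_sq [MeasurableSpace E] [BorelSpace E]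
    {D : Measure E} [IsProbabilityMeasure D] (h : MemLp id 2 D)
    {m : E} (hm : ∫ x, x ∂D = m) (a : E) (η : ℝ) :
    ∫ x, ‖a + η • x‖ ^ 2 ∂D = ‖a + η • m‖ ^ 2 + η ^ 2 * ∫ x, ‖x - m‖ ^ 2 ∂D := by
  have hi : Integrable (fun x : E => x) D := h.integrable (by norm_num)
  have h2 : MemLp (fun x : E => x - m) 2 D := h.sub (memLp_const m)
  have hs : Integrable (fun x => ‖x - m‖ ^ 2) D := h2.integrable_norm_pow'
  have hl : Integrable (fun x => inner ℝ (a + η • m) (x - m)) D :=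
    (hi.sub (integrable_const m)).const_inner _
  have e : ∀ x : E, ‖a + η • x‖ ^ 2 =
      ‖a + η • m‖ ^ 2 + 2 * η * inner ℝ (a + η • m) (x - m) + η ^ 2 * ‖x - m‖ ^ 2 := by
    intro x
    have : a + η • x = (a + η • m) + η • (x - m) := by rw [smul_sub]; abel
    rw [this, norm_add_sq_real, norm_smul, inner_smul_right, mul_pow, Real.norm_eq_abs, sq_abs]
    ring
  have hz : ∫ x, inner ℝ (a + η • m) (x - m) ∂D = 0 := by
    have hi' : Integrable (fun x => x - m) D := hi.sub (integrable_const m)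
    rw [integral_inner hi', integral_sub hi (integrable_const m), hm]
    simp
  have h1 : Integrable (fun x => ‖a + η • m‖ ^ 2 + 2 * η * inner ℝ (a + η • m) (x - m)) D :=
    (integrable_const _).add (hl.const_mul _)
  rw [integral_congr_ae (ae_of_all _ e), integral_add h1 (hs.const_mul _),
    integral_add (integrable_const _) (hl.const_mul _), integral_const_mul, integral_const_mul, hz,
    integral_const, probReal_univ, one_smul, mul_zero, add_zero]

/-- The mean minimizes the mean squared distance to a constant. Used below with `c = 0`, to bound a
variance by a second moment. -/
theorem integral_norm_sub_integral_sq_le {Ω : Type*} [MeasurableSpace Ω] {D : Measure Ω}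
    [IsProbabilityMeasure D] {f : Ω → E} (h : MemLp f 2 D) (c : E) :
    ∫ x, ‖f x - ∫ y, f y ∂D‖ ^ 2 ∂D ≤ ∫ x, ‖f x - c‖ ^ 2 ∂D := by
  set m := ∫ y, f y ∂D with hm
  have hi : Integrable f D := h.integrable (by norm_num)
  have h2 : MemLp (fun x => f x - m) 2 D := h.sub (memLp_const m)
  have hs : Integrable (fun x => ‖f x - m‖ ^ 2) D := h2.integrable_norm_pow'
  have hl : Integrable (fun x => inner ℝ (m - c) (f x - m)) D :=
    (hi.sub (integrable_const m)).const_inner _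
  have e : ∀ x, ‖f x - c‖ ^ 2 = ‖m - c‖ ^ 2 + 2 * inner ℝ (m - c) (f x - m) + ‖f x - m‖ ^ 2 := by
    intro x
    rw [← norm_add_sq_real]; congr 2; abel
  have hz : ∫ x, inner ℝ (m - c) (f x - m) ∂D = 0 := by
    have hi' : Integrable (fun x => f x - m) D := hi.sub (integrable_const m)
    rw [integral_inner hi', integral_sub hi (integrable_const m), ← hm]
    simp
  have h1 : Integrable (fun x => ‖m - c‖ ^ 2 + 2 * inner ℝ (m - c) (f x - m)) D :=
    (integrable_const _).add (hl.const_mul _)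
  simp_rw [e]
  rw [integral_add h1 hs,
    integral_add (integrable_const _) (hl.const_mul _), integral_const_mul, hz]
  simp

end SecondMoment

/-! ### Sums of independent vectors, and joint measurability of gradients -/

section Pi

variable {d : ℕ}

theorem integral_param_apply {Ω : Type*} [MeasurableSpace Ω] {μ : Measure Ω} {f : Ω → Param d}
    (hf : Integrable f μ) (j : Fin d) : (∫ x, f x ∂μ) j = ∫ x, f x j ∂μ :=
  ((EuclideanSpace.proj (𝕜 := ℝ) j).integral_comp_comm hf).symm

theorem memLp_param_apply {Ω : Type*} [MeasurableSpace Ω] {μ : Measure Ω} {f : Ω → Param d}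
    (hf : MemLp f 2 μ) (j : Fin d) : MemLp (fun x => f x j) 2 μ :=
  (EuclideanSpace.proj (𝕜 := ℝ) j).comp_memLp' hf

/-- Coordinatewise, the variance of a sum of independent variables is the sum of the variances, each
at most a second moment. This is the source of the factors 1/N: noise adds up in squares, whereas
the means stay inside one norm. -/
theorem integral_norm_sum_sq_pi_le {ι : Type*} [Fintype ι] {Ω : ι → Type*}
    [∀ i, MeasurableSpace (Ω i)] {μ : ∀ i, Measure (Ω i)} [∀ i, IsProbabilityMeasure (μ i)]
    {f : ∀ i, Ω i → Param d} (hf : ∀ i, MemLp (f i) 2 (μ i)) :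
    ∫ ω, ‖∑ i, f i (ω i)‖ ^ 2 ∂(Measure.pi μ) ≤
      ‖∑ i, ∫ x, f i x ∂(μ i)‖ ^ 2 + ∑ i, ∫ x, ‖f i x‖ ^ 2 ∂(μ i) := by
  have hfj : ∀ i j, MemLp (fun x => f i x j) 2 (μ i) := fun i j => memLp_param_apply (hf i) j
  have hp : ∀ i j, MemLp (fun ω : ∀ i, Ω i => f i (ω i) j) 2 (Measure.pi μ) := fun i j =>
    (hfj i j).comp_measurePreserving (measurePreserving_eval _ i)
  have hS : ∀ j, MemLp (∑ i, fun ω : ∀ i, Ω i => f i (ω i) j) 2 (Measure.pi μ) := fun j =>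
    memLp_finsetSum' _ fun i _ => hp i j
  have hm : ∀ i j, ∫ ω, f i (ω i) j ∂(Measure.pi μ) = ∫ x, f i x j ∂(μ i) := fun i j => by
    have h := integral_map (μ := Measure.pi μ) (φ := Function.eval i)
      (f := fun x => f i x j) (measurable_pi_apply i).aemeasurable
      (by rw [(measurePreserving_eval μ i).map_eq]; exact (hfj i j).1)
    rw [(measurePreserving_eval μ i).map_eq] at h
    exact h.symm
  have key : ∀ j, ∫ ω, (∑ i, f i (ω i) j) ^ 2 ∂(Measure.pi μ) ≤
      (∑ i, ∫ x, f i x j ∂(μ i)) ^ 2 + ∑ i, ∫ x, (f i x j) ^ 2 ∂(μ i) := by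
    intro j
    have h1 := variance_eq_sub (hS j)
    rw [variance_sum_pi fun i => hfj i j] at h1
    have h2 : ∀ i, Var[fun x => f i x j; μ i] ≤ ∫ x, (f i x j) ^ 2 ∂(μ i) := fun i =>
      variance_le_expectation_sq (hfj i j).1
    have h3 := Finset.sum_le_sum fun i (_ : i ∈ Finset.univ) => h2 i
    have h4 : ∫ ω, (∑ i, fun ω : ∀ i, Ω i => f i (ω i) j) ω ∂(Measure.pi μ) =
        ∑ i, ∫ x, f i x j ∂(μ i) := by
      simp only [Finset.sum_apply]
      rw [integral_finsetSum _ fun i _ => (hp i j).integrable (by norm_num)]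
      exact Finset.sum_congr rfl fun i _ => hm i j
    rw [h4] at h1
    simp only [Pi.pow_apply, Finset.sum_apply] at h1
    linarith
  have hL : ∫ ω, ‖∑ i, f i (ω i)‖ ^ 2 ∂(Measure.pi μ) =
      ∑ j, ∫ ω, (∑ i, f i (ω i) j) ^ 2 ∂(Measure.pi μ) := by
    rw [← integral_finsetSum]
    · simp only [EuclideanSpace.real_norm_sq_eq, WithLp.ofLp_sum, Finset.sum_apply]
    · intro j _
      have := (hS j).integrable_sq
      simpa using this
  have hR : ∀ i, ∫ x, ‖f i x‖ ^ 2 ∂(μ i) = ∑ j, ∫ x, (f i x j) ^ 2 ∂(μ i) := by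
    intro i
    rw [← integral_finsetSum]
    · simp only [EuclideanSpace.real_norm_sq_eq]
    · intro j _
      exact (hfj i j).integrable_sq
  rw [hL, EuclideanSpace.real_norm_sq_eq, Finset.sum_congr rfl fun i _ => hR i, Finset.sum_comm,
    ← Finset.sum_add_distrib]
  refine Finset.sum_le_sum fun j _ => (key j).trans_eq ?_
  simp only [WithLp.ofLp_sum, Finset.sum_apply,
    integral_param_apply ((hf _).integrable (by norm_num))]

/-- The gradient of a jointly measurable function is jointly measurable. -/
theorem measurable_gradient_uncurry {X : Type*} [MeasurableSpace X] {f : X → Param d → ℝ}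
    (hf : Measurable (Function.uncurry f)) (hd : ∀ x, Differentiable ℝ (f x)) :
    Measurable fun p : X × Param d => gradient (f p.1) p.2 := by
  have hcoord : ∀ j, Measurable fun p : X × Param d => gradient (f p.1) p.2 j := by
    intro j
    let e : Param d := EuclideanSpace.single j 1
    -- Each partial derivative is the pointwise limit of difference quotients of step 1/(n+1), which
    -- are jointly measurable.
    have hlim : ∀ p : X × Param d, Filter.Tendsto (fun n : ℕ => ((n : ℝ) + 1) *
        (f p.1 (p.2 + ((n : ℝ) + 1)⁻¹ • e) - f p.1 p.2)) Filter.atTop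
        (nhds (gradient (f p.1) p.2 j)) := by
      intro p
      have h := (hd p.1 p.2).hasGradientAt.hasFDerivAt.lim (v := e) (l := Filter.atTop)
        (c := fun n : ℕ => ((n : ℝ) + 1)) (by
          simp only [Real.norm_eq_abs]
          exact Filter.tendsto_abs_atTop_atTop.comp
            (Filter.tendsto_atTop_add_const_right _ _ tendsto_natCast_atTop_atTop))
      have h2 : (InnerProductSpace.toDual ℝ (Param d)) (gradient (f p.1) p.2) e =
          gradient (f p.1) p.2 j := by
        rw [InnerProductSpace.toDual_apply_apply, EuclideanSpace.inner_single_right]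
        simp
      rw [h2] at h
      simpa using h
    refine measurable_of_tendsto_metrizable (f := fun (n : ℕ) (p : X × Param d) =>
      ((n : ℝ) + 1) * (f p.1 (p.2 + ((n : ℝ) + 1)⁻¹ • e) - f p.1 p.2)) (fun n => ?_)
      (tendsto_pi_nhds.2 hlim)
    refine Measurable.const_mul (Measurable.sub ?_ hf) _
    exact hf.comp (measurable_fst.prodMk (measurable_snd.add_const _))
  have := (MeasurableEquiv.toLp 2 (Fin d → ℝ)).measurable.comp (measurable_pi_iff.2 hcoord)
  exact this

end Pi

/-! ### Bounds and derivatives of log-densities, importance weights and gradient estimators -/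

section Calculus

variable {d : ℕ} {S : Type u} {A : Type v} [MeasurableSpace S] [MeasurableSpace A]
  {ν : Measure A} {Rmax : ℝ} {H : ℕ} {G M : ℝ}

/-- The score `∇_θ log p(τ | θ)` of a trajectory. -/
def score (π : Policy d S A ν) (τ : Traj S A H) (θ : Param d) : Param d :=
  ∑ h : Fin H, gradient (logPolicy π (τ.1 h.castSucc) (τ.2 h)) θ

/-- The discounted reward collected from time `t` on. -/
def rewardToGo (e : Env S A Rmax) (γ : ℝ) (τ : Traj S A H) (t : Fin H) : ℝ :=
  ∑ h ∈ Finset.Ici t, γ ^ (h : ℕ) * e.reward (τ.1 h.castSucc) (τ.2 h)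

theorem trajDens_pos (π : Policy d S A ν) (θ : Param d) (τ : Traj S A H) : 0 < trajDens π θ τ :=
  Finset.prod_pos fun _ _ => π.dens_pos _ _ _

theorem log_trajDens (π : Policy d S A ν) (θ : Param d) (τ : Traj S A H) :
    Real.log (trajDens π θ τ) = ∑ h : Fin H, logPolicy π (τ.1 h.castSucc) (τ.2 h) θ :=
  Real.log_prod fun _ _ => (π.dens_pos _ _ _).ne'

theorem isWeight_pos (π : Policy d S A ν) (τ : Traj S A H) (θ' θ : Param d) :
    0 < isWeight π τ θ' θ := div_pos (trajDens_pos _ _ _) (trajDens_pos _ _ _)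

theorem isWeight_eq_exp (π : Policy d S A ν) (τ : Traj S A H) (θ' θ : Param d) :
    isWeight π τ θ' θ =
      Real.exp (Real.log (trajDens π θ' τ) - Real.log (trajDens π θ τ)) := by
  rw [Real.exp_sub, Real.exp_log (trajDens_pos _ _ _), Real.exp_log (trajDens_pos _ _ _), isWeight]

theorem hasGradientAt_log_trajDens {π : Policy d S A ν} (hP : PolicyBounds π G M)
    (τ : Traj S A H) (θ : Param d) :
    HasGradientAt (fun θ => Real.log (trajDens π θ τ)) (score π τ θ) θ := by
  simp_rw [log_trajDens]
  rw [hasGradientAt_iff_hasFDerivAt, score, map_sum]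
  exact HasFDerivAt.fun_sum fun h _ => ((hP _ _).1 θ).hasGradientAt.hasFDerivAt

theorem norm_score_le {π : Policy d S A ν} (hP : PolicyBounds π G M)
    (τ : Traj S A H) (θ : Param d) : ‖score π τ θ‖ ≤ H * G := by
  refine (norm_sum_le _ _).trans ?_
  refine (Finset.sum_le_sum fun h _ => ((hP _ _).2.2 θ).1).trans ?_
  simp

theorem abs_log_trajDens_sub_le {π : Policy d S A ν} (hP : PolicyBounds π G M)
    (τ : Traj S A H) (θ θ' : Param d) :
    |Real.log (trajDens π θ' τ) - Real.log (trajDens π θ τ)| ≤ H * G * ‖θ' - θ‖ := by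
  refine Convex.norm_image_sub_le_of_norm_hasFDerivWithin_le (s := Set.univ)
    (fun x _ => (hasGradientAt_log_trajDens hP τ x).hasFDerivAt.hasFDerivWithinAt)
    (fun x _ => ?_) convex_univ (Set.mem_univ θ) (Set.mem_univ θ')
  rw [LinearIsometryEquiv.norm_map]
  exact norm_score_le hP τ x

theorem isWeight_le_exp {π : Policy d S A ν} (hP : PolicyBounds π G M)
    (τ : Traj S A H) (θ' θ : Param d) :
    isWeight π τ θ' θ ≤ Real.exp (H * G * ‖θ' - θ‖) := by
  rw [isWeight_eq_exp]
  exact Real.exp_le_exp.2 ((le_abs_self _).trans (abs_log_trajDens_sub_le hP τ θ θ'))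

/-- With x the logarithm of an importance weight, the right side contains the weight itself. Its
first two moments are controlled independently of the distance of the parameters, unlike a
worst-case exponential. -/
theorem abs_exp_sub_one_le (x : ℝ) : |Real.exp x - 1| ≤ |x| * max 1 (Real.exp x) := by
  have h0 := Real.exp_pos x
  have h1 := Real.add_one_le_exp x
  rcases le_total 0 x with hx | hx
  · have h2 : 1 ≤ Real.exp x := Real.one_le_exp hx
    rw [max_eq_right h2, abs_of_nonneg hx, abs_of_nonneg (by linarith)]
    have h3 := Real.add_one_le_exp (-x)
    have h4 : Real.exp x * Real.exp (-x) = 1 := by rw [← Real.exp_add]; simp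
    nlinarith
  · have h2 : Real.exp x ≤ 1 := Real.exp_le_one_iff.2 hx
    rw [max_eq_left h2, abs_of_nonpos hx, abs_of_nonpos (by linarith)]
    linarith

theorem abs_isWeight_sub_one_le {π : Policy d S A ν} (hP : PolicyBounds π G M)
    (τ : Traj S A H) (θ' θ : Param d) :
    |isWeight π τ θ' θ - 1| ≤ H * G * ‖θ' - θ‖ * max 1 (isWeight π τ θ' θ) := by
  have h := abs_exp_sub_one_le (Real.log (trajDens π θ' τ) - Real.log (trajDens π θ τ))
  rw [← isWeight_eq_exp] at h
  refine h.trans ?_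
  gcongr
  exact abs_log_trajDens_sub_le hP τ θ θ'

theorem hasGradientAt_isWeight {π : Policy d S A ν} (hP : PolicyBounds π G M)
    (τ : Traj S A H) (θ₀ θ : Param d) :
    HasGradientAt (fun θ => isWeight π τ θ θ₀) (isWeight π τ θ θ₀ • score π τ θ) θ := by
  simp_rw [isWeight_eq_exp]
  rw [hasGradientAt_iff_hasFDerivAt, map_smul]
  exact ((hasGradientAt_log_trajDens hP τ θ).hasFDerivAt.sub_const _).exp

theorem pgEst_eq (π : Policy d S A ν) (e : Env S A Rmax) (γ : ℝ) (τ : Traj S A H) (θ : Param d) :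
    pgEst π e γ τ θ =
      ∑ t, rewardToGo e γ τ t • gradient (logPolicy π (τ.1 t.castSucc) (τ.2 t)) θ := rfl

theorem discounted_reward_mem (e : Env S A Rmax) {γ : ℝ} (hγ0 : 0 ≤ γ) (hγ1 : γ ≤ 1) (n : ℕ)
    (s : S) (a : A) : 0 ≤ γ ^ n * e.reward s a ∧ γ ^ n * e.reward s a ≤ Rmax :=
  ⟨mul_nonneg (pow_nonneg hγ0 _) (e.reward_nonneg s a),
    (mul_le_of_le_one_left (e.reward_nonneg s a) (pow_le_one₀ hγ0 hγ1)).trans (e.reward_le s a)⟩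

theorem rewardToGo_nonneg (e : Env S A Rmax) {γ : ℝ} (hγ0 : 0 ≤ γ) (hγ1 : γ ≤ 1)
    (τ : Traj S A H) (t : Fin H) : 0 ≤ rewardToGo e γ τ t :=
  Finset.sum_nonneg fun _ _ => (discounted_reward_mem e hγ0 hγ1 _ _ _).1

theorem totalReward_nonneg (e : Env S A Rmax) {γ : ℝ} (hγ0 : 0 ≤ γ) (hγ1 : γ ≤ 1)
    (τ : Traj S A H) : 0 ≤ totalReward e γ τ :=
  Finset.sum_nonneg fun _ _ => (discounted_reward_mem e hγ0 hγ1 _ _ _).1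

theorem totalReward_le (e : Env S A Rmax) {γ : ℝ} (hγ0 : 0 ≤ γ) (hγ1 : γ ≤ 1)
    (τ : Traj S A H) : totalReward e γ τ ≤ H * Rmax := by
  refine (Finset.sum_le_sum fun _ _ => (discounted_reward_mem e hγ0 hγ1 _ _ _).2).trans ?_
  simp

theorem rewardToGo_le (e : Env S A Rmax) {γ : ℝ} (hγ0 : 0 ≤ γ) (hγ1 : γ ≤ 1)
    (τ : Traj S A H) (t : Fin H) : rewardToGo e γ τ t ≤ H * Rmax :=
  (Finset.sum_le_univ_sum_of_nonneg fun _ => (discounted_reward_mem e hγ0 hγ1 _ _ _).1).trans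
    (totalReward_le e hγ0 hγ1 τ)

theorem norm_rewardToGo_smul_sum_le {F : Type*} [NormedAddCommGroup F] [NormedSpace ℝ F]
    (e : Env S A Rmax) {γ : ℝ} (hγ0 : 0 ≤ γ) (hγ1 : γ ≤ 1)
    (τ : Traj S A H) {c : ℝ} {f : Fin H → F} (hf : ∀ t, ‖f t‖ ≤ c) :
    ‖∑ t, rewardToGo e γ τ t • f t‖ ≤ (H : ℝ) ^ 2 * Rmax * c := by
  refine (norm_sum_le _ _).trans ?_
  have h : ∀ t ∈ Finset.univ, ‖rewardToGo e γ τ t • f t‖ ≤ H * Rmax * c := fun t _ => by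
    rw [norm_smul, Real.norm_eq_abs, abs_of_nonneg (rewardToGo_nonneg e hγ0 hγ1 τ t)]
    exact mul_le_mul (rewardToGo_le e hγ0 hγ1 τ t) (hf t) (norm_nonneg _)
      ((rewardToGo_nonneg e hγ0 hγ1 τ t).trans (rewardToGo_le e hγ0 hγ1 τ t))
  refine (Finset.sum_le_sum h).trans_eq ?_
  simp; ring

theorem norm_pgEst_le {π : Policy d S A ν} (hP : PolicyBounds π G M) (e : Env S A Rmax) {γ : ℝ}
    (hγ0 : 0 ≤ γ) (hγ1 : γ ≤ 1) (τ : Traj S A H) (θ : Param d) :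
    ‖pgEst π e γ τ θ‖ ≤ (H : ℝ) ^ 2 * Rmax * G :=
  norm_rewardToGo_smul_sum_le e hγ0 hγ1 τ fun _ => ((hP _ _).2.2 θ).1

/-- The derivative of the stochastic policy gradient in the parameter. -/
def pgEstDeriv (π : Policy d S A ν) (e : Env S A Rmax) (γ : ℝ) (τ : Traj S A H) (θ : Param d) :
    Param d →L[ℝ] Param d :=
  ∑ t, rewardToGo e γ τ t • fderiv ℝ (gradient (logPolicy π (τ.1 t.castSucc) (τ.2 t))) θ

theorem hasFDerivAt_pgEst {π : Policy d S A ν} (hP : PolicyBounds π G M) (e : Env S A Rmax)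
    (γ : ℝ) (τ : Traj S A H) (θ : Param d) :
    HasFDerivAt (pgEst π e γ τ) (pgEstDeriv π e γ τ θ) θ :=
  HasFDerivAt.fun_sum fun t _ =>
    ((hP (τ.1 t.castSucc) (τ.2 t)).2.1 θ).hasFDerivAt.fun_const_smul (rewardToGo e γ τ t)

theorem norm_pgEstDeriv_le {π : Policy d S A ν} (hP : PolicyBounds π G M) (e : Env S A Rmax)
    {γ : ℝ} (hγ0 : 0 ≤ γ) (hγ1 : γ ≤ 1) (τ : Traj S A H) (θ : Param d) :
    ‖pgEstDeriv π e γ τ θ‖ ≤ (H : ℝ) ^ 2 * Rmax * M :=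
  norm_rewardToGo_smul_sum_le e hγ0 hγ1 τ fun _ => ((hP _ _).2.2 θ).2

theorem norm_pgEst_sub_le {π : Policy d S A ν} (hP : PolicyBounds π G M) (e : Env S A Rmax)
    {γ : ℝ} (hγ0 : 0 ≤ γ) (hγ1 : γ ≤ 1) (τ : Traj S A H) (θ θ' : Param d) :
    ‖pgEst π e γ τ θ' - pgEst π e γ τ θ‖ ≤ (H : ℝ) ^ 2 * Rmax * M * ‖θ' - θ‖ :=
  Convex.norm_image_sub_le_of_norm_hasFDerivWithin_le (s := Set.univ)
    (fun x _ => (hasFDerivAt_pgEst hP e γ τ x).hasFDerivWithinAt)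
    (fun x _ => norm_pgEstDeriv_le hP e hγ0 hγ1 τ x) convex_univ (Set.mem_univ θ) (Set.mem_univ θ')

/-- Symmetry of the second derivative, which needs no continuity of the Hessian. It identifies the
gradient of θ ↦ ⟨g(τ | θ), w⟩, a priori the adjoint of the derivative of g applied to w, with that
derivative itself. -/
theorem inner_fderiv_gradient_comm {f : Param d → ℝ} (hf : Differentiable ℝ f)
    (hg : Differentiable ℝ (gradient f)) (θ v w : Param d) :
    inner ℝ (fderiv ℝ (gradient f) θ v) w = inner ℝ (fderiv ℝ (gradient f) θ w) v := by
  have h := second_derivative_symmetric (𝕜 := ℝ)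
    (f' := fun y => InnerProductSpace.toDual ℝ (Param d) (gradient f y))
    (fun y => (hf y).hasGradientAt.hasFDerivAt)
    ((InnerProductSpace.toDual ℝ (Param d)).toContinuousLinearEquiv.hasFDerivAt.comp θ
      (hg θ).hasFDerivAt) v w
  simpa using h

theorem inner_pgEstDeriv_comm {π : Policy d S A ν} (hP : PolicyBounds π G M) (e : Env S A Rmax)
    (γ : ℝ) (τ : Traj S A H) (θ v w : Param d) :
    inner ℝ (pgEstDeriv π e γ τ θ v) w = inner ℝ (pgEstDeriv π e γ τ θ w) v := by
  simp only [pgEstDeriv, sum_apply, smul_apply, sum_inner,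
    inner_smul_left]
  exact Finset.sum_congr rfl fun t _ => by
    rw [inner_fderiv_gradient_comm (hP _ _).1 (hP _ _).2.1]

theorem hasFDerivAt_inner_pgEst {π : Policy d S A ν} (hP : PolicyBounds π G M)
    (e : Env S A Rmax) (γ : ℝ) (τ : Traj S A H) (θ w : Param d) :
    HasFDerivAt (fun θ => inner ℝ (pgEst π e γ τ θ) w)
      ((innerSL ℝ w).comp (pgEstDeriv π e γ τ θ)) θ := by
  have := (innerSL ℝ w).hasFDerivAt.comp θ (hasFDerivAt_pgEst hP e γ τ θ)
  refine this.congr_of_eventuallyEq (Filter.Eventually.of_forall fun x => ?_)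
  simp [real_inner_comm]

theorem gradient_inner_pgEst {π : Policy d S A ν} (hP : PolicyBounds π G M)
    (e : Env S A Rmax) (γ : ℝ) (τ : Traj S A H) (θ w : Param d) :
    gradient (fun θ => inner ℝ (pgEst π e γ τ θ) w) θ = pgEstDeriv π e γ τ θ w := by
  refine ext_inner_right ℝ fun v => ?_
  rw [gradient, InnerProductSpace.toDual_symm_apply, (hasFDerivAt_inner_pgEst hP e γ τ θ w).fderiv,
    inner_pgEstDeriv_comm hP]
  simp [real_inner_comm]

theorem hessCorr_eq {π : Policy d S A ν} (hP : PolicyBounds π G M)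
    (e : Env S A Rmax) (γ : ℝ) (τ : Traj S A H) (y w : Param d) :
    hessCorr π e γ τ y w =
      (inner ℝ (score π τ y) w : ℝ) • pgEst π e γ τ y + pgEstDeriv π e γ τ y w := by
  rw [hessCorr, (hasGradientAt_log_trajDens hP τ y).gradient, gradient_inner_pgEst hP]

theorem norm_hessCorr_le {π : Policy d S A ν} (hP : PolicyBounds π G M) (hG : 0 ≤ G)
    (e : Env S A Rmax) {γ : ℝ} (hγ0 : 0 ≤ γ) (hγ1 : γ ≤ 1) (τ : Traj S A H) (y w : Param d) :
    ‖hessCorr π e γ τ y w‖ ≤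
      (H * G * ((H : ℝ) ^ 2 * Rmax * G) + (H : ℝ) ^ 2 * Rmax * M) * ‖w‖ := by
  rw [hessCorr_eq hP, add_mul]
  refine (norm_add_le _ _).trans (add_le_add ?_ ?_)
  · rw [norm_smul]
    calc ‖(inner ℝ (score π τ y) w : ℝ)‖ * ‖pgEst π e γ τ y‖
        ≤ (H * G * ‖w‖) * ((H : ℝ) ^ 2 * Rmax * G) := by
          refine mul_le_mul ((norm_inner_le_norm _ _).trans ?_) (norm_pgEst_le hP e hγ0 hγ1 τ y)
            (norm_nonneg _) (by positivity)
          gcongr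
          exact norm_score_le hP τ y
      _ = _ := by ring
  · exact ContinuousLinearMap.le_of_opNorm_le _ (norm_pgEstDeriv_le hP e hγ0 hγ1 τ y) w

end Calculus

/-! ### Joint measurability in the trajectory and the parameter -/

section Measurability

variable {d : ℕ} {S : Type u} {A : Type v} [MeasurableSpace S] [MeasurableSpace A]
  {ν : Measure A} {Rmax : ℝ} {H : ℕ} {G M : ℝ} {X : Type*} [MeasurableSpace X]

theorem measurable_state (h : Fin (H + 1)) : Measurable fun τ : Traj S A H => τ.1 h :=
  (measurable_pi_apply h).comp measurable_fst

theorem measurable_action (h : Fin H) : Measurable fun τ : Traj S A H => τ.2 h :=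
  (measurable_pi_apply h).comp measurable_snd

theorem measurable_dens (π : Policy d S A ν) {θ : X → Param d} (hθ : Measurable θ)
    {s : X → S} (hs : Measurable s) {a : X → A} (ha : Measurable a) :
    Measurable fun x => π.dens (θ x) (s x) (a x) :=
  π.dens_measurable.comp (hθ.prodMk (hs.prodMk ha))

theorem measurable_trajDens (π : Policy d S A ν) {θ : X → Param d} (hθ : Measurable θ)
    {τ : X → Traj S A H} (hτ : Measurable τ) : Measurable fun x => trajDens π (θ x) (τ x) :=
  Finset.measurable_prod _ fun h _ =>
    measurable_dens π hθ ((measurable_state _).comp hτ) ((measurable_action h).comp hτ)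

theorem measurable_isWeight (π : Policy d S A ν) {θ θ' : X → Param d} (hθ : Measurable θ)
    (hθ' : Measurable θ') {τ : X → Traj S A H} (hτ : Measurable τ) :
    Measurable fun x => isWeight π (τ x) (θ' x) (θ x) :=
  (measurable_trajDens π hθ' hτ).div (measurable_trajDens π hθ hτ)

theorem measurable_gradient_logPolicy {π : Policy d S A ν} (hP : PolicyBounds π G M)
    {θ : X → Param d} (hθ : Measurable θ) {s : X → S} (hs : Measurable s) {a : X → A}
    (ha : Measurable a) : Measurable fun x => gradient (logPolicy π (s x) (a x)) (θ x) :=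
  (measurable_gradient_uncurry (X := S × A) (f := fun p => logPolicy π p.1 p.2)
    (Real.measurable_log.comp (measurable_dens π measurable_snd (measurable_fst.comp measurable_fst)
      (measurable_snd.comp measurable_fst))) fun p => (hP p.1 p.2).1).comp
    ((hs.prodMk ha).prodMk hθ)

theorem measurable_score {π : Policy d S A ν} (hP : PolicyBounds π G M) {θ : X → Param d}
    (hθ : Measurable θ) {τ : X → Traj S A H} (hτ : Measurable τ) :
    Measurable fun x => score π (τ x) (θ x) :=
  Finset.measurable_fun_sum _ fun h _ =>
    measurable_gradient_logPolicy hP hθ ((measurable_state _).comp hτ) ((measurable_action h).comp hτ)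

theorem measurable_reward (e : Env S A Rmax) (h : Fin H) :
    Measurable fun τ : Traj S A H => e.reward (τ.1 h.castSucc) (τ.2 h) :=
  e.reward_measurable.comp ((measurable_state _).prodMk (measurable_action h))

theorem measurable_rewardToGo (e : Env S A Rmax) (γ : ℝ) (t : Fin H) :
    Measurable fun τ : Traj S A H => rewardToGo e γ τ t :=
  Finset.measurable_fun_sum _ fun h _ => (measurable_reward e h).const_mul _

theorem measurable_totalReward (e : Env S A Rmax) (γ : ℝ) :
    Measurable fun τ : Traj S A H => totalReward e γ τ :=
  Finset.measurable_fun_sum _ fun h _ => (measurable_reward e h).const_mul _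

theorem measurable_pgEst {π : Policy d S A ν} (hP : PolicyBounds π G M) (e : Env S A Rmax) (γ : ℝ)
    {θ : X → Param d} (hθ : Measurable θ) {τ : X → Traj S A H} (hτ : Measurable τ) :
    Measurable fun x => pgEst π e γ (τ x) (θ x) := by
  simp_rw [pgEst_eq]
  refine Finset.measurable_fun_sum _ fun h _ => ?_
  have h1 : Measurable fun x => rewardToGo e γ (τ x) h := (measurable_rewardToGo e γ h).comp hτ
  have h2 : Measurable fun x => gradient (logPolicy π ((τ x).1 h.castSucc) ((τ x).2 h)) (θ x) :=
    measurable_gradient_logPolicy hP hθ ((measurable_state h.castSucc).comp hτ)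
      ((measurable_action h).comp hτ)
  exact h1.smul h2

theorem measurable_gradient_inner_pgEst {π : Policy d S A ν} (hP : PolicyBounds π G M)
    (e : Env S A Rmax) (γ : ℝ) : Measurable fun p : (Traj S A H × Param d) × Param d =>
      gradient (fun θ => (inner ℝ (pgEst π e γ p.1.1 θ) p.1.2 : ℝ)) p.2 := by
  have h1 : Measurable fun p : (Traj S A H × Param d) × Param d => pgEst π e γ p.1.1 p.2 :=
    measurable_pgEst hP e γ (θ := fun p : (Traj S A H × Param d) × Param d => p.2)
      (τ := fun p => p.1.1) measurable_snd measurable_fst.fst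
  have h2 : Measurable fun p : (Traj S A H × Param d) × Param d => p.1.2 := measurable_fst.snd
  refine measurable_gradient_uncurry (X := Traj S A H × Param d)
    (f := fun p θ => inner ℝ (pgEst π e γ p.1 θ) p.2) (h1.inner h2) ?_
  intro p θ
  exact (hasFDerivAt_inner_pgEst hP e γ p.1 θ p.2).differentiableAt

/-- By symmetry of the Hessian the vector is a gradient of a scalar function, so
`measurable_gradient_uncurry` applies a second time. -/
theorem measurable_pgEstDeriv_apply {π : Policy d S A ν} (hP : PolicyBounds π G M)
    (e : Env S A Rmax) (γ : ℝ) {θ w : X → Param d} (hθ : Measurable θ) (hw : Measurable w)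
    {τ : X → Traj S A H} (hτ : Measurable τ) :
    Measurable fun x => pgEstDeriv π e γ (τ x) (θ x) (w x) := by
  have h : (fun x => pgEstDeriv π e γ (τ x) (θ x) (w x)) =
      (fun p : (Traj S A H × Param d) × Param d =>
      gradient (fun θ => (inner ℝ (pgEst π e γ p.1.1 θ) p.1.2 : ℝ)) p.2) ∘
        fun x => ((τ x, w x), θ x) := by
    ext1 x
    exact (gradient_inner_pgEst hP e γ (τ x) (θ x) (w x)).symm
  rw [h]
  exact (measurable_gradient_inner_pgEst hP e γ).comp ((hτ.prodMk hw).prodMk hθ)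

theorem measurable_hessCorr {π : Policy d S A ν} (hP : PolicyBounds π G M)
    (e : Env S A Rmax) (γ : ℝ) {θ w : X → Param d} (hθ : Measurable θ) (hw : Measurable w)
    {τ : X → Traj S A H} (hτ : Measurable τ) :
    Measurable fun x => hessCorr π e γ (τ x) (θ x) (w x) := by
  simp_rw [hessCorr_eq hP]
  have h1 : Measurable fun x => (inner ℝ (score π (τ x) (θ x)) (w x) : ℝ) :=
    (measurable_score hP hθ hτ).inner hw
  exact (h1.smul (measurable_pgEst hP e γ hθ hτ)).add (measurable_pgEstDeriv_apply hP e γ hθ hw hτ)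

end Measurability

/-! ### Trajectory laws: change of measure, marginals, normalization -/

section Law

variable {d : ℕ} {S : Type u} {A : Type v} [MeasurableSpace S] [MeasurableSpace A]
  {ν : Measure A} {Rmax : ℝ} {H : ℕ} {X : Type*} [MeasurableSpace X]

/-- The first `n` steps of a trajectory of length `n + 1`. -/
def trajInit {n : ℕ} (τ : Traj S A (n + 1)) : Traj S A n :=
  (fun i => τ.1 i.castSucc, fun i => τ.2 i.castSucc)

theorem measurable_trajInit {n : ℕ} : Measurable (trajInit : Traj S A (n + 1) → Traj S A n) :=
  (measurable_pi_iff.2 fun _ => measurable_state _).prodMk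
    (measurable_pi_iff.2 fun _ => measurable_action _)

theorem trajDens_succ (π : Policy d S A ν) {n : ℕ} (θ : Param d) (τ : Traj S A (n + 1)) :
    trajDens π θ τ = trajDens π θ (trajInit τ) *
      π.dens θ (τ.1 (Fin.last n).castSucc) (τ.2 (Fin.last n)) :=
  Fin.prod_univ_castSucc _

/-- Appending an action and a state to a trajectory. -/
def trajSnoc {n : ℕ} (x : Traj S A n × A × S) : Traj S A (n + 1) :=
  (Fin.snoc (α := fun _ => S) x.1.1 x.2.2, Fin.snoc (α := fun _ => A) x.1.2 x.2.1)

theorem measurable_trajSnoc {n : ℕ} :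
    Measurable (trajSnoc : Traj S A n × A × S → Traj S A (n + 1)) := by
  refine Measurable.prodMk (measurable_pi_iff.2 fun i => ?_) (measurable_pi_iff.2 fun i => ?_)
  · refine Fin.lastCases ?_ (fun j => ?_) i
    · simpa using measurable_snd.snd
    · simp only [Fin.snoc_castSucc]
      exact (measurable_state j).comp measurable_fst
  · refine Fin.lastCases ?_ (fun j => ?_) i
    · simpa using measurable_snd.fst
    · simp only [Fin.snoc_castSucc]
      exact (measurable_action j).comp measurable_fst

theorem trajInit_trajSnoc {n : ℕ} {S : Type u} {A : Type v} (x : Traj S A n × A × S) :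
    trajInit (trajSnoc x) = x.1 := by
  ext i <;> simp [trajInit, trajSnoc]

instance (e : Env S A Rmax) (n : ℕ) : IsSFiniteKernel (stepKernel ν e n) := by
  have := e.trans_markov
  unfold stepKernel
  infer_instance

instance sFinite_refMeasure (e : Env S A Rmax) : ∀ n, SFinite (refMeasure ν e n)
  | 0 => by
    have := e.init_prob
    unfold refMeasure
    infer_instance
  | n + 1 => by
    have := sFinite_refMeasure e n
    unfold refMeasure
    infer_instance

theorem measurable_trajLaw (π : Policy d S A ν) (e : Env S A Rmax) (n : ℕ) :
    Measurable (trajLaw π e n) := by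
  refine Measure.measurable_of_measurable_coe _ fun s hs => ?_
  simp_rw [trajLaw, withDensity_apply _ hs]
  exact Measurable.lintegral_prod_right'
    (f := fun p : Param d × Traj S A n => ENNReal.ofReal (trajDens π p.1 p.2))
    (measurable_trajDens π measurable_fst measurable_snd).ennreal_ofReal

theorem trajLaw_change (π : Policy d S A ν) (e : Env S A Rmax) (n : ℕ) (θ θ' : Param d) :
    trajLaw π e n θ' =
      (trajLaw π e n θ).withDensity fun τ => ENNReal.ofReal (isWeight π τ θ' θ) := by
  rw [trajLaw, trajLaw, ← withDensity_mul]
  · congr 1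
    ext τ
    rw [Pi.mul_apply, ← ENNReal.ofReal_mul (trajDens_pos _ _ _).le, isWeight,
      mul_div_cancel₀ _ (trajDens_pos _ _ _).ne']
  · exact (measurable_trajDens π measurable_const measurable_id).ennreal_ofReal
  · exact (measurable_isWeight π measurable_const measurable_const measurable_id).ennreal_ofReal

/-- Change of measure by importance weights. -/
theorem integral_trajLaw_change {E : Type*} [NormedAddCommGroup E] [NormedSpace ℝ E]
    (π : Policy d S A ν) (e : Env S A Rmax) (n : ℕ) (θ θ' : Param d) (f : Traj S A n → E) :
    ∫ τ, f τ ∂(trajLaw π e n θ') = ∫ τ, isWeight π τ θ' θ • f τ ∂(trajLaw π e n θ) := by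
  have hm : Measurable fun τ : Traj S A n => ENNReal.ofReal (isWeight π τ θ' θ) :=
    (measurable_isWeight π measurable_const measurable_const measurable_id).ennreal_ofReal
  rw [trajLaw_change π e n θ θ', integral_withDensity_eq_integral_toReal_smul hm (by simp)]
  simp_rw [ENNReal.toReal_ofReal (isWeight_pos _ _ _ _).le]

variable [SigmaFinite ν]

theorem lintegral_refMeasure_succ (e : Env S A Rmax) (n : ℕ) {f : Traj S A (n + 1) → ENNReal}
    (hf : Measurable f) :
    ∫⁻ τ, f τ ∂(refMeasure ν e (n + 1)) = ∫⁻ τ, ∫⁻ a, ∫⁻ s, f (trajSnoc (τ, a, s))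
      ∂(e.trans (τ.1 (Fin.last n), a)) ∂ν ∂(refMeasure ν e n) := by
  have := e.trans_markov
  have h : refMeasure ν e (n + 1) =
      (refMeasure ν e n ⊗ₘ stepKernel ν e n).map trajSnoc := rfl
  have hm : Measurable fun x => f (trajSnoc x) := hf.comp measurable_trajSnoc
  rw [h, lintegral_map hf measurable_trajSnoc, Measure.lintegral_compProd hm]
  refine lintegral_congr fun τ => ?_
  have hm' : Measurable fun x => f (trajSnoc (τ, x)) := hm.comp measurable_prodMk_left
  rw [stepKernel, Kernel.lintegral_compProd _ _ _ hm']
  rfl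

/-- Integrating out the last state gives 1 because the transition kernel is Markov; integrating out
the last action against the policy density gives 1 as well. -/
theorem map_trajInit_trajLaw (π : Policy d S A ν) (e : Env S A Rmax) (n : ℕ) (θ : Param d) :
    (trajLaw π e (n + 1) θ).map trajInit = trajLaw π e n θ := by
  have := e.trans_markov
  refine Measure.ext_of_lintegral _ fun f hf => ?_
  have hm : ∀ m, Measurable fun τ : Traj S A m => ENNReal.ofReal (trajDens π θ τ) := fun m =>
    (measurable_trajDens π measurable_const measurable_id).ennreal_ofReal
  have hf' : Measurable fun τ : Traj S A (n + 1) => f (trajInit τ) := hf.comp measurable_trajInit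
  rw [lintegral_map hf measurable_trajInit, trajLaw, trajLaw,
    lintegral_withDensity_eq_lintegral_mul _ (hm _) hf',
    lintegral_withDensity_eq_lintegral_mul _ (hm _) hf,
    lintegral_refMeasure_succ e n ((hm _).mul hf')]
  refine lintegral_congr fun τ => ?_
  have h1 : ∀ a s, ((fun τ : Traj S A (n + 1) => ENNReal.ofReal (trajDens π θ τ)) *
      fun τ => f (trajInit τ)) (trajSnoc (τ, a, s)) =
      (ENNReal.ofReal (trajDens π θ τ) * f τ) * ENNReal.ofReal (π.dens θ (τ.1 (Fin.last n)) a) := by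
    intro a s
    have h2 : (trajSnoc (τ, a, s)).1 (Fin.last n).castSucc = τ.1 (Fin.last n) := by
      simp only [trajSnoc, Fin.snoc_castSucc]
    have h3 : (trajSnoc (τ, a, s)).2 (Fin.last n) = a := by
      simp only [trajSnoc, Fin.snoc_last]
    simp only [Pi.mul_apply, trajDens_succ, trajInit_trajSnoc, h2, h3]
    rw [ENNReal.ofReal_mul (trajDens_pos _ _ _).le]
    ring
  simp_rw [h1]
  simp only [lintegral_const, measure_univ, mul_one]
  have hd : Measurable fun a => ENNReal.ofReal (π.dens θ (τ.1 (Fin.last n)) a) :=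
    (measurable_dens π measurable_const measurable_const measurable_id).ennreal_ofReal
  rw [lintegral_const_mul _ hd, π.dens_lintegral, mul_one]
  rfl

/-- A measure and its image have the same total mass, so normalization passes from the marginal on
the first `n` steps to length `n + 1`. -/
instance isProbabilityMeasure_trajLaw (π : Policy d S A ν) (e : Env S A Rmax) (θ : Param d) :
    ∀ n, IsProbabilityMeasure (trajLaw π e n θ)
  | 0 => by
    have := e.init_prob
    have h : trajLaw π e 0 θ = refMeasure ν e 0 := by
      simp [trajLaw, trajDens]
    rw [h, refMeasure]
    refine Measure.isProbabilityMeasure_map (Measurable.aemeasurable ?_)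
    exact (measurable_pi_iff.2 fun _ => measurable_id).prodMk measurable_const
  | n + 1 => by
    have := isProbabilityMeasure_trajLaw π e θ n
    rw [← map_trajInit_trajLaw] at this
    exact (Measure.isProbabilityMeasure_map_iff measurable_trajInit.aemeasurable).1 this

end Law

/-! ### Policy gradient theorem, smoothness of the objective, Hessian-vector products -/

section Gradient

variable {d : ℕ} {S : Type u} {A : Type v} [MeasurableSpace S] [MeasurableSpace A]
  {ν : Measure A} {Rmax : ℝ} {H : ℕ} {G M : ℝ} {γ : ℝ} {π : Policy d S A ν}

theorem isWeight_self (π : Policy d S A ν) (τ : Traj S A H) (θ : Param d) :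
    isWeight π τ θ θ = 1 := div_self (trajDens_pos _ _ _).ne'

theorem totalReward_succ (e : Env S A Rmax) (γ : ℝ) {n : ℕ} (τ : Traj S A (n + 1)) :
    totalReward e γ τ = totalReward e γ (trajInit τ) +
      γ ^ n * e.reward (τ.1 (Fin.last n).castSucc) (τ.2 (Fin.last n)) := by
  rw [totalReward, Fin.sum_univ_castSucc]
  rfl

theorem rewardToGo_eq_sum_ite (e : Env S A Rmax) (γ : ℝ) (τ : Traj S A H) (t : Fin H) :
    rewardToGo e γ τ t =
      ∑ h : Fin H, if t ≤ h then γ ^ (h : ℕ) * e.reward (τ.1 h.castSucc) (τ.2 h) else 0 := by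
  rw [rewardToGo, ← Finset.sum_filter]
  congr 1
  ext h
  simp

theorem rewardToGo_castSucc (e : Env S A Rmax) (γ : ℝ) {n : ℕ} (τ : Traj S A (n + 1)) (t : Fin n) :
    rewardToGo e γ τ t.castSucc = rewardToGo e γ (trajInit τ) t +
      γ ^ n * e.reward (τ.1 (Fin.last n).castSucc) (τ.2 (Fin.last n)) := by
  rw [rewardToGo_eq_sum_ite, rewardToGo_eq_sum_ite, Fin.sum_univ_castSucc]
  simp [trajInit, Fin.le_last]

theorem rewardToGo_last (e : Env S A Rmax) (γ : ℝ) {n : ℕ} (τ : Traj S A (n + 1)) :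
    rewardToGo e γ τ (Fin.last n) =
      γ ^ n * e.reward (τ.1 (Fin.last n).castSucc) (τ.2 (Fin.last n)) := by
  rw [rewardToGo_eq_sum_ite, Fin.sum_univ_castSucc]
  simp [Fin.castSucc_lt_last, not_le_of_gt]

/-- The last reward belongs to the reward-to-go of every time step, hence it multiplies the whole
score. This is the recursion behind the induction on the horizon in `hasGradientAt_localObj`. -/
theorem pgEst_succ (e : Env S A Rmax) (γ : ℝ) {n : ℕ} (τ : Traj S A (n + 1)) (θ : Param d) :
    pgEst π e γ τ θ = pgEst π e γ (trajInit τ) θ +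
      (γ ^ n * e.reward (τ.1 (Fin.last n).castSucc) (τ.2 (Fin.last n))) • score π τ θ := by
  rw [pgEst_eq, pgEst_eq, score, Fin.sum_univ_castSucc, Fin.sum_univ_castSucc, rewardToGo_last,
    smul_add, ← add_assoc, Finset.smul_sum, ← Finset.sum_add_distrib]
  congr 1
  refine Finset.sum_congr rfl fun t _ => ?_
  rw [rewardToGo_castSucc, add_smul]
  rfl

theorem localObj_nonneg (e : Env S A Rmax) (hγ0 : 0 ≤ γ) (hγ1 : γ ≤ 1) (H : ℕ) (θ : Param d) :
    0 ≤ localObj π e H γ θ :=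
  integral_nonneg fun τ => totalReward_nonneg e hγ0 hγ1 τ

variable [SigmaFinite ν]

/-- Differentiation of an expectation over trajectories. -/
theorem hasGradientAt_integral_trajLaw (hP : PolicyBounds π G M) (hG : 0 ≤ G) (e : Env S A Rmax)
    {F : Param d → Traj S A H → ℝ} {F' : Param d → Traj S A H → Param d}
    (hFm : ∀ θ, Measurable (F θ)) (hFm' : ∀ θ, Measurable (F' θ))
    (hd : ∀ θ τ, HasGradientAt (fun θ => F θ τ) (F' θ τ) θ) {c c' : ℝ}
    (hc : ∀ θ τ, |F θ τ| ≤ c) (hc' : ∀ θ τ, ‖F' θ τ‖ ≤ c') (θ₀ : Param d) :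
    HasGradientAt (fun θ => ∫ τ, F θ τ ∂(trajLaw π e H θ))
      (∫ τ, (F' θ₀ τ + F θ₀ τ • score π τ θ₀) ∂(trajLaw π e H θ₀)) θ₀ := by
  -- All laws are referred to the fixed law at θ₀, so θ enters only through the integrand w · F. `D`
  -- is the gradient of that integrand; at θ = θ₀ the weight is 1.
  let D : Param d → Traj S A H → Param d := fun θ τ =>
    isWeight π τ θ θ₀ • F' θ τ + F θ τ • isWeight π τ θ θ₀ • score π τ θ
  have hDm : ∀ θ, Measurable (D θ) := fun θ => by
    have h1 : Measurable fun τ : Traj S A H => isWeight π τ θ θ₀ :=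
      measurable_isWeight π measurable_const measurable_const measurable_id
    have h2 : Measurable fun τ : Traj S A H => score π τ θ :=
      measurable_score hP measurable_const measurable_id
    exact (h1.smul (hFm' θ)).add ((hFm θ).smul (h1.smul h2))
  have hD0 : D θ₀ = fun τ => F' θ₀ τ + F θ₀ τ • score π τ θ₀ := by
    ext1 τ
    simp [D, isWeight_self]
  rw [← hD0, hasGradientAt_iff_hasFDerivAt]
  have hex : (fun θ => ∫ τ, F θ τ ∂(trajLaw π e H θ)) =
      fun θ => ∫ τ, isWeight π τ θ θ₀ * F θ τ ∂(trajLaw π e H θ₀) := by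
    ext1 θ
    rw [integral_trajLaw_change π e H θ₀ θ]
    rfl
  have hlin : (InnerProductSpace.toDual ℝ (Param d)) (∫ τ, D θ₀ τ ∂(trajLaw π e H θ₀)) =
      ∫ τ, (InnerProductSpace.toDual ℝ (Param d)) (D θ₀ τ) ∂(trajLaw π e H θ₀) :=
    ((InnerProductSpace.toDual ℝ (Param d)).toContinuousLinearEquiv.integral_comp_comm _).symm
  rw [hex, hlin]
  have hwm : ∀ θ, Measurable fun τ : Traj S A H => isWeight π τ θ θ₀ := fun θ =>
    measurable_isWeight π measurable_const measurable_const measurable_id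
  -- On the unit ball the weights are bounded uniformly in the trajectory, so a constant dominates
  -- the derivative.
  have hw : ∀ θ ∈ Metric.ball θ₀ 1, ∀ τ : Traj S A H,
      isWeight π τ θ θ₀ ≤ Real.exp (H * G) := fun θ hθ τ => by
    refine (isWeight_le_exp hP τ θ θ₀).trans (Real.exp_le_exp.2 ?_)
    rw [mem_ball_iff_norm] at hθ
    exact mul_le_of_le_one_right (by positivity) hθ.le
  refine (hasFDerivAt_integral_of_dominated_of_fderiv_le (s := Metric.ball θ₀ 1)
    (F' := fun θ τ => (InnerProductSpace.toDual ℝ (Param d)) (D θ τ))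
    (bound := fun _ => Real.exp (H * G) * c' + c * (Real.exp (H * G) * (H * G)))
    (Metric.ball_mem_nhds θ₀ one_pos) ?_ ?_ ?_ ?_ (integrable_const _) ?_)
  · exact Filter.Eventually.of_forall fun θ => ((hwm θ).mul (hFm θ)).aestronglyMeasurable
  · refine Integrable.of_bound (C := c) ((hwm θ₀).mul (hFm θ₀)).aestronglyMeasurable
      (ae_of_all _ fun τ => ?_)
    simpa [isWeight_self] using hc θ₀ τ
  · exact (InnerProductSpace.toDual ℝ (Param d)).continuous.comp_aestronglyMeasurable
      (hDm θ₀).aestronglyMeasurable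
  · refine ae_of_all _ fun τ θ hθ => ?_
    have h0 := (isWeight_pos π τ θ θ₀).le
    have hc0 : 0 ≤ c := (abs_nonneg _).trans (hc θ τ)
    rw [LinearIsometryEquiv.norm_map]
    refine (norm_add_le _ _).trans (add_le_add ?_ ?_)
    · rw [norm_smul, Real.norm_eq_abs, abs_of_nonneg h0]
      exact mul_le_mul (hw θ hθ τ) (hc' θ τ) (norm_nonneg _) (Real.exp_pos _).le
    · rw [norm_smul, norm_smul, Real.norm_eq_abs, Real.norm_eq_abs, abs_of_nonneg h0]
      refine mul_le_mul (hc θ τ) ?_ (by positivity) hc0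
      exact mul_le_mul (hw θ hθ τ) (norm_score_le hP τ θ) (norm_nonneg _) (Real.exp_pos _).le
  · refine ae_of_all _ fun τ θ _ => ?_
    have h := (hasGradientAt_isWeight hP τ θ₀ θ).hasFDerivAt.mul (hd θ τ).hasFDerivAt
    convert! h using 1
    simp [D]

theorem integrable_trajLaw_of_bound {F : Type*} [NormedAddCommGroup F] (e : Env S A Rmax)
    {θ : Param d} {f : Traj S A H → F} (hf : AEStronglyMeasurable f (trajLaw π e H θ)) {c : ℝ}
    (hc : ∀ τ, ‖f τ‖ ≤ c) : Integrable f (trajLaw π e H θ) :=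
  Integrable.of_bound hf c (ae_of_all _ hc)

theorem integrable_pgEst (hP : PolicyBounds π G M) (e : Env S A Rmax) (hγ0 : 0 ≤ γ) (hγ1 : γ ≤ 1)
    (θ θ' : Param d) : Integrable (fun τ : Traj S A H => pgEst π e γ τ θ') (trajLaw π e H θ) :=
  integrable_trajLaw_of_bound e
    (measurable_pgEst hP e γ measurable_const measurable_id).aestronglyMeasurable
    fun τ => norm_pgEst_le hP e hγ0 hγ1 τ θ'

/-- The policy gradient theorem. -/
theorem hasGradientAt_localObj (hP : PolicyBounds π G M) (hG : 0 ≤ G) (e : Env S A Rmax)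
    (hγ0 : 0 ≤ γ) (hγ1 : γ ≤ 1) (θ : Param d) : ∀ H,
    HasGradientAt (localObj π e H γ) (∫ τ, pgEst π e γ τ θ ∂(trajLaw π e H θ)) θ
  | 0 => by
    have h1 : localObj π e 0 γ = fun _ => 0 := by
      ext1 θ
      simp [localObj, totalReward]
    have h2 : ∫ τ, pgEst π e γ τ θ ∂(trajLaw π e 0 θ) = 0 := by simp [pgEst]
    rw [h1, h2]
    exact hasGradientAt_const θ 0
  | n + 1 => by
    have ih := hasGradientAt_localObj hP hG e hγ0 hγ1 θ n
    let r : Traj S A (n + 1) → ℝ := fun τ =>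
      γ ^ n * e.reward (τ.1 (Fin.last n).castSucc) (τ.2 (Fin.last n))
    have hrm : Measurable r := (measurable_reward e (Fin.last n)).const_mul _
    have hrb : ∀ τ, |r τ| ≤ Rmax := fun τ => by
      have h := discounted_reward_mem e hγ0 hγ1 n (τ.1 (Fin.last n).castSucc) (τ.2 (Fin.last n))
      exact (abs_of_nonneg h.1).trans_le h.2
    have hr := hasGradientAt_integral_trajLaw hP hG e (F := fun _ => r) (F' := fun _ _ => 0)
      (fun _ => hrm) (fun _ => measurable_const) (fun θ τ => hasGradientAt_const θ (r τ))
      (fun _ => hrb) (c' := 0) (fun _ _ => by simp) θ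
    simp only [zero_add] at hr
    have hsm : Measurable fun τ : Traj S A (n + 1) => score π τ θ :=
      measurable_score hP measurable_const measurable_id
    -- The first n rewards depend only on the first n steps, so by marginalization their expectation
    -- is the objective of horizon n. Only the last reward needs the score of the full trajectory.
    have hobj : localObj π e (n + 1) γ =
        fun θ => localObj π e n γ θ + ∫ τ, r τ ∂(trajLaw π e (n + 1) θ) := by
      ext1 θ
      have h1 : localObj π e n γ θ =
          ∫ τ, totalReward e γ (trajInit τ) ∂(trajLaw π e (n + 1) θ) := by
        rw [localObj, ← map_trajInit_trajLaw, integral_map measurable_trajInit.aemeasurable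
          (measurable_totalReward e γ).aestronglyMeasurable]
      rw [h1, ← integral_add, localObj]
      · simp_rw [totalReward_succ]
        rfl
      · refine integrable_trajLaw_of_bound e (c := n * Rmax)
          ((measurable_totalReward e γ).comp measurable_trajInit).aestronglyMeasurable fun τ => ?_
        rw [Real.norm_eq_abs, abs_of_nonneg (totalReward_nonneg e hγ0 hγ1 _)]
        exact totalReward_le e hγ0 hγ1 _
      · exact integrable_trajLaw_of_bound e hrm.aestronglyMeasurable hrb
    have hgrad : ∫ τ, pgEst π e γ τ θ ∂(trajLaw π e (n + 1) θ) =
        (∫ τ, pgEst π e γ τ θ ∂(trajLaw π e n θ)) +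
          ∫ τ, r τ • score π τ θ ∂(trajLaw π e (n + 1) θ) := by
      have hgm : Measurable fun τ : Traj S A n => pgEst π e γ τ θ :=
        measurable_pgEst hP e γ measurable_const measurable_id
      rw [← map_trajInit_trajLaw π e n, integral_map measurable_trajInit.aemeasurable
        hgm.aestronglyMeasurable, ← integral_add]
      · simp_rw [pgEst_succ]
        rfl
      · exact integrable_trajLaw_of_bound e
          (hgm.comp measurable_trajInit).aestronglyMeasurable fun τ =>
            norm_pgEst_le hP e hγ0 hγ1 (trajInit τ) θ
      · refine integrable_trajLaw_of_bound e (c := Rmax * ((n + 1 : ℕ) * G))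
          (hrm.smul hsm).aestronglyMeasurable fun τ => ?_
        rw [norm_smul]
        exact mul_le_mul (hrb τ) (norm_score_le hP τ θ) (norm_nonneg _)
          ((abs_nonneg _).trans (hrb τ))
    rw [hobj, hgrad, hasGradientAt_iff_hasFDerivAt, map_add]
    exact ih.hasFDerivAt.add hr.hasFDerivAt

theorem gradient_localObj (hP : PolicyBounds π G M) (hG : 0 ≤ G) (e : Env S A Rmax)
    (hγ0 : 0 ≤ γ) (hγ1 : γ ≤ 1) (H : ℕ) (θ : Param d) :
    gradient (localObj π e H γ) θ = ∫ τ, pgEst π e γ τ θ ∂(trajLaw π e H θ) :=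
  (hasGradientAt_localObj hP hG e hγ0 hγ1 θ H).gradient

theorem norm_gradient_localObj_le (hP : PolicyBounds π G M) (hG : 0 ≤ G) (e : Env S A Rmax)
    (hγ0 : 0 ≤ γ) (hγ1 : γ ≤ 1) (H : ℕ) (θ : Param d) :
    ‖gradient (localObj π e H γ) θ‖ ≤ (H : ℝ) ^ 2 * Rmax * G := by
  rw [gradient_localObj hP hG e hγ0 hγ1]
  refine (norm_integral_le_of_norm_le_const (ae_of_all _ fun τ =>
    norm_pgEst_le hP e hγ0 hγ1 τ θ)).trans_eq ?_
  simp

theorem localObj_le (e : Env S A Rmax) (hγ0 : 0 ≤ γ) (hγ1 : γ ≤ 1) (H : ℕ) (θ : Param d) :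
    localObj π e H γ θ ≤ H * Rmax := by
  have h : ‖localObj π e H γ θ‖ ≤ (H * Rmax) * (trajLaw π e H θ).real Set.univ :=
    norm_integral_le_of_norm_le_const (ae_of_all _ fun τ => ?_)
  · refine (le_abs_self _).trans (h.trans_eq ?_)
    simp
  · rw [Real.norm_eq_abs, abs_of_nonneg (totalReward_nonneg e hγ0 hγ1 _)]
    exact totalReward_le e hγ0 hγ1 _

theorem memLp_isWeight (hP : PolicyBounds π G M) (e : Env S A Rmax) (θ θ' : Param d) :
    MemLp (fun τ : Traj S A H => isWeight π τ θ' θ) 2 (trajLaw π e H θ) :=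
  MemLp.of_bound
    (measurable_isWeight π measurable_const measurable_const measurable_id).aestronglyMeasurable
    (Real.exp (H * G * ‖θ' - θ‖)) (ae_of_all _ fun τ => by
      rw [Real.norm_eq_abs, abs_of_nonneg (isWeight_pos _ _ _ _).le]
      exact isWeight_le_exp hP τ θ' θ)

theorem integral_isWeight (e : Env S A Rmax) (θ θ' : Param d) :
    ∫ τ, isWeight π τ θ' θ ∂(trajLaw π e H θ) = 1 := by
  have h := integral_trajLaw_change π e H θ θ' (fun _ => (1 : ℝ))
  simpa using h.symm

/-- Both gradients are expectations under the law at θ, one of them with importance weights. The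
difference splits into (w - 1) g(θ') and g(θ') - g(θ); since |w - 1| ≤ HG‖θ' - θ‖(1 + w) and w has
mean 1, the first part contributes the factor 2. -/
theorem norm_gradient_localObj_sub_le (hP : PolicyBounds π G M) (hG : 0 ≤ G) (e : Env S A Rmax)
    (hγ0 : 0 ≤ γ) (hγ1 : γ ≤ 1) (H : ℕ) (θ θ' : Param d) :
    ‖gradient (localObj π e H γ) θ' - gradient (localObj π e H γ) θ‖ ≤
      (2 * (H * G) * ((H : ℝ) ^ 2 * Rmax * G) + (H : ℝ) ^ 2 * Rmax * M) * ‖θ' - θ‖ := by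
  have hwi : Integrable (fun τ : Traj S A H => isWeight π τ θ' θ) (trajLaw π e H θ) :=
    (memLp_isWeight hP e θ θ').integrable (by norm_num)
  have hgm : Measurable fun τ : Traj S A H => pgEst π e γ τ θ' :=
    measurable_pgEst hP e γ measurable_const measurable_id
  have hwg : Integrable (fun τ : Traj S A H => isWeight π τ θ' θ • pgEst π e γ τ θ')
      (trajLaw π e H θ) :=
    hwi.smul_bdd _ hgm.aestronglyMeasurable
      (ae_of_all _ fun τ => norm_pgEst_le hP e hγ0 hγ1 τ θ')
  rw [gradient_localObj hP hG e hγ0 hγ1, gradient_localObj hP hG e hγ0 hγ1,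
    integral_trajLaw_change π e H θ θ', ← integral_sub hwg (integrable_pgEst hP e hγ0 hγ1 θ θ)]
  have hb : ∀ τ : Traj S A H,
      ‖isWeight π τ θ' θ • pgEst π e γ τ θ' - pgEst π e γ τ θ‖ ≤
      (H * G * ‖θ' - θ‖ * ((H : ℝ) ^ 2 * Rmax * G)) * (1 + isWeight π τ θ' θ) +
        (H : ℝ) ^ 2 * Rmax * M * ‖θ' - θ‖ := by
    intro τ
    have h0 := (isWeight_pos π τ θ' θ).le
    have h1 : isWeight π τ θ' θ • pgEst π e γ τ θ' - pgEst π e γ τ θ =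
        (isWeight π τ θ' θ - 1) • pgEst π e γ τ θ' + (pgEst π e γ τ θ' - pgEst π e γ τ θ) := by
      rw [sub_smul, one_smul]; abel
    rw [h1]
    refine (norm_add_le _ _).trans (add_le_add ?_ (norm_pgEst_sub_le hP e hγ0 hγ1 τ θ θ'))
    rw [norm_smul, Real.norm_eq_abs]
    calc |isWeight π τ θ' θ - 1| * ‖pgEst π e γ τ θ'‖
        ≤ (H * G * ‖θ' - θ‖ * (1 + isWeight π τ θ' θ)) * ((H : ℝ) ^ 2 * Rmax * G) := by
          refine mul_le_mul ((abs_isWeight_sub_one_le hP τ θ' θ).trans ?_)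
            (norm_pgEst_le hP e hγ0 hγ1 τ θ') (norm_nonneg _) (by positivity)
          gcongr
          exact max_le (by linarith) (by linarith)
      _ = _ := by ring
  have hbi : Integrable (fun τ : Traj S A H =>
      (H * G * ‖θ' - θ‖ * ((H : ℝ) ^ 2 * Rmax * G)) * (1 + isWeight π τ θ' θ) +
        (H : ℝ) ^ 2 * Rmax * M * ‖θ' - θ‖) (trajLaw π e H θ) :=
    (((integrable_const _).add hwi).const_mul _).add (integrable_const _)
  refine (norm_integral_le_of_norm_le hbi (ae_of_all _ hb)).trans_eq ?_
  have h1 : Integrable (fun τ : Traj S A H => 1 + isWeight π τ θ' θ) (trajLaw π e H θ) :=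
    (integrable_const _).add hwi
  rw [integral_add (h1.const_mul _) (integrable_const _), integral_const_mul,
    integral_add (integrable_const _) hwi, integral_isWeight]
  simp
  ring

theorem integral_isWeight_sq_le (hP : PolicyBounds π G M) (e : Env S A Rmax) {W : ℝ} (hW : 0 ≤ W)
    (hV : WeightVarianceBound π e H W) (θ θ' : Param d) :
    ∫ τ, isWeight π τ θ' θ ^ 2 ∂(trajLaw π e H θ) ≤ 1 + W := by
  have h1 : Var[fun τ => isWeight π τ θ' θ; trajLaw π e H θ] ≤ W :=
    ENNReal.toReal_le_of_le_ofReal hW (hV θ' θ)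
  rw [variance_eq_sub (memLp_isWeight hP e θ θ'), integral_isWeight] at h1
  simp only [Pi.pow_apply] at h1
  linarith

/-- The bounded variance of the weights is upgraded to a variance quadratic in the distance: square
|w - 1| ≤ HG‖θ' - θ‖ max(1, w) and use E w² ≤ 1 + W. -/
theorem integral_isWeight_sub_one_sq_le (hP : PolicyBounds π G M) (e : Env S A Rmax)
    {W : ℝ} (hW : 0 ≤ W) (hV : WeightVarianceBound π e H W) (θ θ' : Param d) :
    ∫ τ, (isWeight π τ θ' θ - 1) ^ 2 ∂(trajLaw π e H θ) ≤
      (H * G) ^ 2 * (2 + W) * ‖θ' - θ‖ ^ 2 := by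
  have hm := memLp_isWeight (H := H) hP e θ θ'
  have hi : Integrable (fun τ : Traj S A H => 1 + isWeight π τ θ' θ ^ 2) (trajLaw π e H θ) :=
    (integrable_const _).add hm.integrable_sq
  calc ∫ τ, (isWeight π τ θ' θ - 1) ^ 2 ∂(trajLaw π e H θ)
      ≤ ∫ τ, (H * G * ‖θ' - θ‖) ^ 2 * (1 + isWeight π τ θ' θ ^ 2) ∂(trajLaw π e H θ) := by
        refine integral_mono (hm.sub (memLp_const 1)).integrable_sq (hi.const_mul _) fun τ => ?_
        have h0 := (isWeight_pos π τ θ' θ).le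
        have h := abs_isWeight_sub_one_le hP τ θ' θ
        rw [← sq_abs]
        refine (pow_le_pow_left₀ (abs_nonneg _) h 2).trans ?_
        rw [mul_pow]
        refine mul_le_mul_of_nonneg_left ?_ (sq_nonneg _)
        rcases max_choice 1 (isWeight π τ θ' θ) with h2 | h2 <;> rw [h2] <;> nlinarith
    _ = (H * G * ‖θ' - θ‖) ^ 2 * (1 + ∫ τ, isWeight π τ θ' θ ^ 2 ∂(trajLaw π e H θ)) := by
        rw [integral_const_mul, integral_add (integrable_const _) hm.integrable_sq]
        simp
    _ ≤ (H * G * ‖θ' - θ‖) ^ 2 * (1 + (1 + W)) := by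
        gcongr
        exact integral_isWeight_sq_le hP e hW hV θ θ'
    _ = _ := by ring

/-- The point at `α` on the segment from `x` to `θp`. -/
abbrev segPoint (θp x : Param d) (α : ℝ) : Param d := α • θp + (1 - α) • x

theorem measurable_segPoint (θp x : Param d) : Measurable (segPoint θp x) := by
  unfold segPoint
  fun_prop

/-- The expected second-order correction at a point of the segment from `x` to `θp`. -/
def meanHessCorr (π : Policy d S A ν) (e : Env S A Rmax) (H : ℕ) (γ : ℝ) (θp x : Param d)
    (α : ℝ) : Param d :=
  ∫ τ, hessCorr π e γ τ (segPoint θp x α) (x - θp) ∂(trajLaw π e H (segPoint θp x α))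

theorem integrable_hessCorr (hP : PolicyBounds π G M) (hG : 0 ≤ G) (e : Env S A Rmax)
    (hγ0 : 0 ≤ γ) (hγ1 : γ ≤ 1) (H : ℕ) (y w θ : Param d) :
    Integrable (fun τ => hessCorr π e γ τ y w) (trajLaw π e H θ) :=
  integrable_trajLaw_of_bound e
    (measurable_hessCorr hP e γ measurable_const measurable_const
      measurable_id).aestronglyMeasurable fun τ => norm_hessCorr_le hP hG e hγ0 hγ1 τ y w

theorem stronglyMeasurable_meanHessCorr (hP : PolicyBounds π G M) (e : Env S A Rmax) (H : ℕ)
    (γ : ℝ) (θp x : Param d) : StronglyMeasurable (meanHessCorr π e H γ θp x) := by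
  let k : Kernel ℝ (Traj S A H) :=
    ⟨fun α => trajLaw π e H (segPoint θp x α),
      (measurable_trajLaw π e H).comp (measurable_segPoint θp x)⟩
  have : IsMarkovKernel k :=
    ⟨fun α => isProbabilityMeasure_trajLaw π e (segPoint θp x α) H⟩
  have hm : Measurable fun p : ℝ × Traj S A H =>
      hessCorr π e γ p.2 (segPoint θp x p.1) (x - θp) :=
    measurable_hessCorr hP e γ ((measurable_segPoint θp x).comp measurable_fst) measurable_const
      measurable_snd
  exact StronglyMeasurable.integral_kernel_prod_right (κ := k)
    (f := fun α τ => hessCorr π e γ τ (segPoint θp x α) (x - θp)) hm.stronglyMeasurable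

theorem norm_meanHessCorr_le (hP : PolicyBounds π G M) (hG : 0 ≤ G) (e : Env S A Rmax)
    (hγ0 : 0 ≤ γ) (hγ1 : γ ≤ 1) (H : ℕ) (θp x : Param d) (α : ℝ) :
    ‖meanHessCorr π e H γ θp x α‖ ≤
      (H * G * ((H : ℝ) ^ 2 * Rmax * G) + (H : ℝ) ^ 2 * Rmax * M) * ‖x - θp‖ := by
  refine (norm_integral_le_of_norm_le_const (ae_of_all _ fun τ =>
    norm_hessCorr_le hP hG e hγ0 hγ1 τ _ _)).trans_eq ?_
  simp

/-- Tested against a fixed `z`, the gradient of the objective is the expectation of a scalar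
function, and `hasGradientAt_integral_trajLaw` differentiates it once more. The sign comes from the
direction of the segment, whose velocity is θp - x while the correction uses x - θp. -/
theorem hasDerivAt_inner_gradient_segPoint (hP : PolicyBounds π G M) (hG : 0 ≤ G)
    (e : Env S A Rmax) (hγ0 : 0 ≤ γ) (hγ1 : γ ≤ 1) (H : ℕ) (θp x z : Param d) (α : ℝ) :
    HasDerivAt (fun α => (inner ℝ (gradient (localObj π e H γ) (segPoint θp x α)) z : ℝ))
      (-inner ℝ (meanHessCorr π e H γ θp x α) z) α := by
  have hgm : ∀ θ, Measurable fun τ : Traj S A H => pgEst π e γ τ θ := fun θ =>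
    measurable_pgEst hP e γ measurable_const measurable_id
  have hdm : ∀ θ, Measurable fun τ : Traj S A H => pgEstDeriv π e γ τ θ z := fun θ =>
    measurable_pgEstDeriv_apply hP e γ measurable_const measurable_const measurable_id
  have hsm : ∀ θ, Measurable fun τ : Traj S A H => score π τ θ := fun θ =>
    measurable_score hP measurable_const measurable_id
  have key : ∀ θ, HasGradientAt (fun θ => (inner ℝ (gradient (localObj π e H γ) θ) z : ℝ))
      (∫ τ, (pgEstDeriv π e γ τ θ z + (inner ℝ (pgEst π e γ τ θ) z : ℝ) • score π τ θ)
        ∂(trajLaw π e H θ)) θ := by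
    intro θ
    have h1 : (fun θ => (inner ℝ (gradient (localObj π e H γ) θ) z : ℝ)) =
        fun θ => ∫ τ, inner ℝ (pgEst π e γ τ θ) z ∂(trajLaw π e H θ) := by
      ext1 θ
      rw [gradient_localObj hP hG e hγ0 hγ1, real_inner_comm,
        ← integral_inner (integrable_pgEst hP e hγ0 hγ1 θ θ)]
      simp_rw [real_inner_comm]
    rw [h1]
    refine hasGradientAt_integral_trajLaw hP hG e (F' := fun θ τ => pgEstDeriv π e γ τ θ z)
      (c := (H : ℝ) ^ 2 * Rmax * G * ‖z‖) (c' := (H : ℝ) ^ 2 * Rmax * M * ‖z‖)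
      (fun θ => (hgm θ).inner measurable_const) hdm (fun θ τ => ?_) (fun θ τ => ?_)
      (fun θ τ => ?_) θ
    · rw [← gradient_inner_pgEst hP]
      exact (hasFDerivAt_inner_pgEst hP e γ τ θ z).differentiableAt.hasGradientAt
    · refine (norm_inner_le_norm (𝕜 := ℝ) _ _).trans ?_
      gcongr
      exact norm_pgEst_le hP e hγ0 hγ1 τ θ
    · exact ContinuousLinearMap.le_of_opNorm_le _ (norm_pgEstDeriv_le hP e hγ0 hγ1 τ θ) z
  have hseg : HasDerivAt (segPoint θp x) (θp - x) α := by
    have h := ((hasDerivAt_id α).smul_const θp).add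
      (((hasDerivAt_const α (1 : ℝ)).sub (hasDerivAt_id α)).smul_const x)
    convert! h using 1
    simp [sub_eq_add_neg]
  have hcomp := (key (segPoint θp x α)).hasFDerivAt.comp_hasDerivAt α hseg
  refine hcomp.congr_deriv ?_
  set y := segPoint θp x α with hy
  have hzm : Measurable fun τ : Traj S A H => (inner ℝ (pgEst π e γ τ y) z : ℝ) :=
    (hgm y).inner measurable_const
  have hi : Integrable (fun τ : Traj S A H =>
      pgEstDeriv π e γ τ y z + (inner ℝ (pgEst π e γ τ y) z : ℝ) • score π τ y)
      (trajLaw π e H y) := by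
    refine (integrable_trajLaw_of_bound e (hdm y).aestronglyMeasurable fun τ =>
      ContinuousLinearMap.le_of_opNorm_le _ (norm_pgEstDeriv_le hP e hγ0 hγ1 τ y) z).add
      (integrable_trajLaw_of_bound e (c := (H : ℝ) ^ 2 * Rmax * G * ‖z‖ * (H * G))
        (hzm.smul (hsm y)).aestronglyMeasurable fun τ => ?_)
    rw [norm_smul]
    have h1 : ‖(inner ℝ (pgEst π e γ τ y) z : ℝ)‖ ≤ (H : ℝ) ^ 2 * Rmax * G * ‖z‖ := by
      refine (norm_inner_le_norm (𝕜 := ℝ) _ _).trans ?_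
      gcongr
      exact norm_pgEst_le hP e hγ0 hγ1 τ y
    exact mul_le_mul h1 (norm_score_le hP τ y) (norm_nonneg _) ((norm_nonneg _).trans h1)
  rw [InnerProductSpace.toDual_apply_apply, real_inner_comm, ← integral_inner hi, meanHessCorr,
    real_inner_comm, ← integral_inner (integrable_hessCorr hP hG e hγ0 hγ1 H _ _ _),
    ← integral_neg]
  refine integral_congr_ae (ae_of_all _ fun τ => ?_)
  simp only
  rw [← hy, hessCorr_eq hP, ← neg_sub x θp, inner_neg_left, inner_add_right, inner_add_right,
    inner_smul_right, inner_smul_right, real_inner_comm _ (x - θp),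
    inner_pgEstDeriv_comm hP, real_inner_comm _ z, real_inner_comm z, real_inner_comm (x - θp)]
  simp [real_inner_comm, mul_comm]
  ring

/-- Fundamental theorem of calculus along the segment, one test vector at a time. The Hessian need
not be continuous: the derivative exists everywhere and is integrable, being measurable and bounded.
-/
theorem integral_meanHessCorr (hP : PolicyBounds π G M) (hG : 0 ≤ G)
    (e : Env S A Rmax) (hγ0 : 0 ≤ γ) (hγ1 : γ ≤ 1) (H : ℕ) (θp x : Param d) :
    ∫ α in Set.Icc 0 1, meanHessCorr π e H γ θp x α =
      gradient (localObj π e H γ) x - gradient (localObj π e H γ) θp := by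
  have hi : Integrable (meanHessCorr π e H γ θp x) (volume.restrict (Set.Icc (0 : ℝ) 1)) :=
    Integrable.of_bound (stronglyMeasurable_meanHessCorr hP e H γ θp x).aestronglyMeasurable _
      (ae_of_all _ (norm_meanHessCorr_le hP hG e hγ0 hγ1 H θp x))
  refine ext_inner_left ℝ fun z => ?_
  rw [← integral_inner hi, integral_Icc_eq_integral_Ioc,
    ← intervalIntegral.integral_of_le zero_le_one]
  have hii : IntervalIntegrable (fun α => -(inner ℝ (meanHessCorr π e H γ θp x α) z : ℝ))
      volume 0 1 := by
    rw [intervalIntegrable_iff_integrableOn_Icc_of_le zero_le_one]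
    exact (hi.inner_const z).neg
  have h := intervalIntegral.integral_eq_sub_of_hasDerivAt
    (fun α _ => hasDerivAt_inner_gradient_segPoint hP hG e hγ0 hγ1 H θp x z α) hii
  rw [intervalIntegral.integral_neg] at h
  simp only [segPoint, one_smul, sub_self, zero_smul, add_zero, sub_zero, zero_add] at h
  simp_rw [real_inner_comm z] at h
  rw [inner_sub_right]
  linarith

end Gradient

/-! ### Mean and variance of the local directions of both algorithms -/

section Direction

/-- The law `D` has finite second moment, mean `m` and variance at most `V`. -/
structure HasMeanVar {d : ℕ} (D : Measure (Param d)) (m : Param d) (V : ℝ) : Prop where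
  isProb : IsProbabilityMeasure D
  memLp : MemLp id 2 D
  mean : ∫ x, x ∂D = m
  var : ∫ x, ‖x - m‖ ^ 2 ∂D ≤ V

variable {d : ℕ} {S : Type u} {A : Type v} [MeasurableSpace S] [MeasurableSpace A]
  {ν : Measure A} {Rmax : ℝ} {H : ℕ} {G M : ℝ} {γ : ℝ} {π : Policy d S A ν}

/-- The local direction of FedHAPG-M as a function of the sampled `α` and `τ`. -/
def hapgDir (π : Policy d S A ν) (e : Env S A Rmax) (γ β : ℝ) (θp ur x : Param d) (α : ℝ)
    (τ : Traj S A H) : Param d :=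
  β • (isWeight π τ x (α • θp + (1 - α) • x) • pgEst π e γ τ x) +
        (1 - β) • (ur + hessCorr π e γ τ (α • θp + (1 - α) • x) (x - θp))

theorem measurable_hapgDir (hP : PolicyBounds π G M) (e : Env S A Rmax) (γ β : ℝ) {X : Type*}
    [MeasurableSpace X] {θp ur x : X → Param d} (hθp : Measurable θp) (hur : Measurable ur)
    (hx : Measurable x) {α : X → ℝ} (hα : Measurable α) {τ : X → Traj S A H} (hτ : Measurable τ) :
    Measurable fun p => hapgDir π e γ β (θp p) (ur p) (x p) (α p) (τ p) := by
  have hy : Measurable fun p => α p • θp p + (1 - α p) • x p :=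
    (hα.smul hθp).add ((measurable_const.sub hα).smul hx)
  have h1 : Measurable fun p => isWeight π (τ p) (x p) (α p • θp p + (1 - α p) • x p) :=
    measurable_isWeight π hy hx hτ
  have h2 : Measurable fun p => pgEst π e γ (τ p) (x p) := measurable_pgEst hP e γ hx hτ
  have h3 : Measurable fun p =>
      hessCorr π e γ (τ p) (α p • θp p + (1 - α p) • x p) (x p - θp p) :=
    measurable_hessCorr hP e γ hy (hx.sub hθp) hτ
  exact ((h1.smul h2).const_smul β).add ((hur.add h3).const_smul (1 - β))

theorem integral_id_map {Ω : Type*} [MeasurableSpace Ω] {μ : Measure Ω} {f : Ω → Param d}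
    (hf : Measurable f) : ∫ x, x ∂(μ.map f) = ∫ ω, f ω ∂μ :=
  integral_map hf.aemeasurable aestronglyMeasurable_id

theorem norm_add_sq_le_two_mul {E : Type*} [SeminormedAddCommGroup E] (a b : E) :
    ‖a + b‖ ^ 2 ≤ 2 * ‖a‖ ^ 2 + 2 * ‖b‖ ^ 2 := by
  nlinarith [norm_add_le a b, norm_nonneg (a + b), sq_nonneg (‖a‖ - ‖b‖)]

theorem norm_smul_add_smul_sq_le {β : ℝ} (hβ0 : 0 ≤ β) (hβ1 : β ≤ 1) (a b : Param d) :
    ‖β • a + (1 - β) • b‖ ^ 2 ≤ 2 * β ^ 2 * ‖a‖ ^ 2 + 2 * ‖b‖ ^ 2 := by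
  refine (norm_add_sq_le_two_mul _ _).trans ?_
  rw [norm_smul, norm_smul, mul_pow, mul_pow, Real.norm_eq_abs, Real.norm_eq_abs, sq_abs, sq_abs]
  have h1 : (1 - β) ^ 2 ≤ 1 := by nlinarith
  nlinarith [mul_le_of_le_one_left (sq_nonneg ‖b‖) h1]

/-- The common mean of the local directions of the two algorithms. -/
def meanDir (π : Policy d S A ν) (e : Env S A Rmax) (H : ℕ) (γ β : ℝ) (θp ur x : Param d) :
    Param d :=
  (1 - β) • (ur - gradient (localObj π e H γ) θp) + gradient (localObj π e H γ) x

/-- A bound for the stochastic policy gradients. -/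
def gradBound (H : ℕ) (Rmax G : ℝ) : ℝ := (H : ℝ) ^ 2 * Rmax * G

/-- A Lipschitz constant for the stochastic policy gradients. -/
def estLip (H : ℕ) (Rmax M : ℝ) : ℝ := (H : ℝ) ^ 2 * Rmax * M

/-- A Lipschitz constant for the gradient of the objective. -/
def objSmooth (H : ℕ) (Rmax G M : ℝ) : ℝ :=
  2 * (H * G) * gradBound H Rmax G + estLip H Rmax M

/-- The constant in the variance bound for the local directions. -/
def varConst (H : ℕ) (Rmax G M W : ℝ) : ℝ :=
  2 * gradBound H Rmax G ^ 2 * (1 + W) +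
    4 * (estLip H Rmax M ^ 2 + gradBound H Rmax G ^ 2 * ((H * G) ^ 2 * (2 + W))) +
    8 * objSmooth H Rmax G M ^ 2

variable [SigmaFinite ν]

theorem integral_norm_isWeight_smul_pgEst_sq_le (hP : PolicyBounds π G M)
    (e : Env S A Rmax) (hγ0 : 0 ≤ γ) (hγ1 : γ ≤ 1) {W : ℝ} (hW : 0 ≤ W)
    (hV : WeightVarianceBound π e H W) (x y : Param d) :
    ∫ τ, ‖isWeight π τ x y • pgEst π e γ τ x‖ ^ 2 ∂(trajLaw π e H y) ≤
      gradBound H Rmax G ^ 2 * (1 + W) := by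
  have hm := memLp_isWeight (H := H) hP e y x
  calc ∫ τ, ‖isWeight π τ x y • pgEst π e γ τ x‖ ^ 2 ∂(trajLaw π e H y)
      ≤ ∫ τ, gradBound H Rmax G ^ 2 * isWeight π τ x y ^ 2 ∂(trajLaw π e H y) := by
        refine integral_mono_of_nonneg (ae_of_all _ fun τ => by positivity)
          (hm.integrable_sq.const_mul _) (ae_of_all _ fun τ => ?_)
        simp only
        rw [norm_smul, mul_pow, Real.norm_eq_abs, sq_abs, mul_comm]
        gcongr
        exact norm_pgEst_le hP e hγ0 hγ1 τ x
    _ ≤ _ := by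
        rw [integral_const_mul]
        gcongr
        exact integral_isWeight_sq_le hP e hW hV y x

theorem memLp_isWeight_smul_pgEst (hP : PolicyBounds π G M) (e : Env S A Rmax) (hγ0 : 0 ≤ γ)
    (hγ1 : γ ≤ 1) (x y : Param d) :
    MemLp (fun τ => isWeight π τ x y • pgEst π e γ τ x) 2 (trajLaw π e H y) := by
  have hwm : Measurable fun τ : Traj S A H => isWeight π τ x y :=
    measurable_isWeight π measurable_const measurable_const measurable_id
  have hgm : Measurable fun τ : Traj S A H => pgEst π e γ τ x :=
    measurable_pgEst hP e γ measurable_const measurable_id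
  refine MemLp.of_bound (hwm.smul hgm).aestronglyMeasurable
    (Real.exp (H * G * ‖x - y‖) * gradBound H Rmax G) (ae_of_all _ fun τ => ?_)
  rw [norm_smul, Real.norm_eq_abs, abs_of_nonneg (isWeight_pos _ _ _ _).le]
  exact mul_le_mul (isWeight_le_exp hP τ x y) (norm_pgEst_le hP e hγ0 hγ1 τ x) (norm_nonneg _)
    (Real.exp_pos _).le

theorem integral_isWeight_smul_pgEst (hP : PolicyBounds π G M) (hG : 0 ≤ G) (e : Env S A Rmax)
    (hγ0 : 0 ≤ γ) (hγ1 : γ ≤ 1) (x y : Param d) :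
    ∫ τ, isWeight π τ x y • pgEst π e γ τ x ∂(trajLaw π e H y) =
      gradient (localObj π e H γ) x := by
  rw [← integral_trajLaw_change, gradient_localObj hP hG e hγ0 hγ1]

theorem memLp_pgEst (hP : PolicyBounds π G M) (e : Env S A Rmax) (hγ0 : 0 ≤ γ)
    (hγ1 : γ ≤ 1) (x y : Param d) :
    MemLp (fun τ => pgEst π e γ τ x) 2 (trajLaw π e H y) :=
  MemLp.of_bound (measurable_pgEst hP e γ measurable_const measurable_id).aestronglyMeasurable
    (gradBound H Rmax G) (ae_of_all _ fun τ => norm_pgEst_le hP e hγ0 hγ1 τ x)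

theorem integral_norm_pgEst_sub_sq_le (hP : PolicyBounds π G M) (hG : 0 ≤ G)
    (e : Env S A Rmax) (hγ0 : 0 ≤ γ) (hγ1 : γ ≤ 1) (x : Param d) :
    ∫ τ, ‖pgEst π e γ τ x - gradient (localObj π e H γ) x‖ ^ 2 ∂(trajLaw π e H x) ≤
      gradBound H Rmax G ^ 2 := by
  have h := integral_norm_sub_integral_sq_le (memLp_pgEst (H := H) hP e hγ0 hγ1 x x) 0
  rw [← gradient_localObj hP hG e hγ0 hγ1] at h
  refine h.trans ?_
  have h2 : ∀ τ : Traj S A H, ‖pgEst π e γ τ x - 0‖ ^ 2 ≤ gradBound H Rmax G ^ 2 := fun τ => by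
    rw [sub_zero]
    exact pow_le_pow_left₀ (norm_nonneg _) (norm_pgEst_le hP e hγ0 hγ1 τ x) 2
  refine (integral_mono_of_nonneg (ae_of_all _ fun τ => by positivity) (integrable_const _)
    (ae_of_all _ h2)).trans_eq ?_
  simp

/-- Split into g(x) - g(θp), which is Lipschitz trajectory by trajectory, and (w - 1) g(θp), where g
is bounded and w - 1 is small in mean square. -/
theorem integral_norm_pgEst_sub_isWeight_smul_sq_le (hP : PolicyBounds π G M)
    (e : Env S A Rmax) (hγ0 : 0 ≤ γ) (hγ1 : γ ≤ 1) {W : ℝ} (hW : 0 ≤ W)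
    (hV : WeightVarianceBound π e H W) (θp x : Param d) :
    ∫ τ, ‖pgEst π e γ τ x - isWeight π τ θp x • pgEst π e γ τ θp‖ ^ 2 ∂(trajLaw π e H x) ≤
      2 * (estLip H Rmax M ^ 2 + gradBound H Rmax G ^ 2 * ((H * G) ^ 2 * (2 + W))) *
        ‖x - θp‖ ^ 2 := by
  have hm : MemLp (fun τ : Traj S A H => isWeight π τ θp x - 1) 2 (trajLaw π e H x) :=
    (memLp_isWeight hP e x θp).sub (memLp_const 1)
  have hi : Integrable (fun τ : Traj S A H => 2 * gradBound H Rmax G ^ 2 *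
      (isWeight π τ θp x - 1) ^ 2) (trajLaw π e H x) := hm.integrable_sq.const_mul _
  calc ∫ τ, ‖pgEst π e γ τ x - isWeight π τ θp x • pgEst π e γ τ θp‖ ^ 2 ∂(trajLaw π e H x)
      ≤ ∫ τ, (2 * (estLip H Rmax M * ‖x - θp‖) ^ 2 +
          2 * gradBound H Rmax G ^ 2 * (isWeight π τ θp x - 1) ^ 2) ∂(trajLaw π e H x) := by
        refine integral_mono_of_nonneg (ae_of_all _ fun τ => by positivity)
          ((integrable_const _).add hi) (ae_of_all _ fun τ => ?_)
        have h1 : pgEst π e γ τ x - isWeight π τ θp x • pgEst π e γ τ θp =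
            (pgEst π e γ τ x - pgEst π e γ τ θp) +
              (-(isWeight π τ θp x - 1)) • pgEst π e γ τ θp := by
          rw [neg_smul, sub_smul, one_smul]; abel
        simp only
        rw [h1]
        refine (norm_add_sq_le_two_mul _ _).trans (add_le_add ?_ ?_)
        · gcongr
          exact norm_pgEst_sub_le hP e hγ0 hγ1 τ θp x
        · rw [norm_smul, norm_neg, mul_pow, Real.norm_eq_abs, sq_abs, mul_assoc,
            mul_comm (gradBound H Rmax G ^ 2)]
          gcongr
          exact norm_pgEst_le hP e hγ0 hγ1 τ θp
    _ = 2 * (estLip H Rmax M * ‖x - θp‖) ^ 2 + 2 * gradBound H Rmax G ^ 2 *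
          ∫ τ, (isWeight π τ θp x - 1) ^ 2 ∂(trajLaw π e H x) := by
        rw [integral_add (integrable_const _) hi, integral_const, probReal_univ, one_smul,
          integral_const_mul]
    _ ≤ 2 * (estLip H Rmax M * ‖x - θp‖) ^ 2 + 2 * gradBound H Rmax G ^ 2 *
          ((H * G) ^ 2 * (2 + W) * ‖θp - x‖ ^ 2) := by
        gcongr
        exact integral_isWeight_sub_one_sq_le hP e hW hV x θp
    _ = _ := by
        rw [norm_sub_rev θp x]
        ring

theorem varConst_bounds (Rmax G M : ℝ) {W : ℝ} (hW : 0 ≤ W) :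
    0 ≤ gradBound H Rmax G ^ 2 * (1 + W) ∧
    gradBound H Rmax G ^ 2 ≤ gradBound H Rmax G ^ 2 * (1 + W) ∧
    0 ≤ estLip H Rmax M ^ 2 + gradBound H Rmax G ^ 2 * ((H * G) ^ 2 * (2 + W)) ∧
    0 ≤ objSmooth H Rmax G M ^ 2 := by
  refine ⟨by positivity, ?_, by positivity, by positivity⟩
  nlinarith [mul_nonneg (sq_nonneg (gradBound H Rmax G)) hW]

/-- The deviation from the mean is β times the centred policy gradient plus 1 - β times the centred
variance-reduced difference. The first has bounded variance, giving β²; the second has variance of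
order ‖x - θp‖². -/
theorem hasMeanVar_svrpgLaw (hP : PolicyBounds π G M) (hG : 0 ≤ G) (e : Env S A Rmax)
    (hγ0 : 0 ≤ γ) (hγ1 : γ ≤ 1) {W : ℝ} (hW : 0 ≤ W) (hV : WeightVarianceBound π e H W)
    {β : ℝ} (hβ0 : 0 ≤ β) (hβ1 : β ≤ 1) (θp ur x : Param d) :
    HasMeanVar (svrpgLaw π e H γ β θp ur x) (meanDir π e H γ β θp ur x)
      (varConst H Rmax G M W * (β ^ 2 + ‖x - θp‖ ^ 2)) := by
  let f : Traj S A H → Param d := fun τ => β • pgEst π e γ τ x +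
      (1 - β) • (ur + pgEst π e γ τ x - isWeight π τ θp x • pgEst π e γ τ θp)
  have hg := memLp_pgEst (H := H) hP e hγ0 hγ1 x x
  have hwg := memLp_isWeight_smul_pgEst (H := H) hP e hγ0 hγ1 θp x
  have hf2 : MemLp f 2 (trajLaw π e H x) :=
    (hg.const_smul β).add ((((memLp_const ur).add hg).sub hwg).const_smul (1 - β))
  have hgm : ∀ y, Measurable fun τ : Traj S A H => pgEst π e γ τ y := fun y =>
    measurable_pgEst hP e γ measurable_const measurable_id
  have hwm : Measurable fun τ : Traj S A H => isWeight π τ θp x :=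
    measurable_isWeight π measurable_const measurable_const measurable_id
  have hfm : Measurable f :=
    ((hgm x).const_smul β).add (((measurable_const.add (hgm x)).sub
      (hwm.smul (hgm θp))).const_smul (1 - β))
  have hgi := hg.integrable (by norm_num)
  have hwgi := hwg.integrable (by norm_num)
  have hlaw : svrpgLaw π e H γ β θp ur x = (trajLaw π e H x).map f := rfl
  have hmem : MemLp id 2 ((trajLaw π e H x).map f) :=
    (memLp_map_measure_iff aestronglyMeasurable_id hfm.aemeasurable).2 hf2
  have hq2 : MemLp (fun τ : Traj S A H => pgEst π e γ τ x -
      isWeight π τ θp x • pgEst π e γ τ θp) 2 (trajLaw π e H x) := hg.sub hwg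
  have hqmean : ∫ τ, (pgEst π e γ τ x - isWeight π τ θp x • pgEst π e γ τ θp)
      ∂(trajLaw π e H x) =
      gradient (localObj π e H γ) x - gradient (localObj π e H γ) θp := by
    rw [integral_sub hgi hwgi, integral_isWeight_smul_pgEst hP hG e hγ0 hγ1,
      gradient_localObj hP hG e hγ0 hγ1 H x]
  have hfeq : ∀ τ, f τ - meanDir π e H γ β θp ur x =
      β • (pgEst π e γ τ x - gradient (localObj π e H γ) x) +
      (1 - β) • ((pgEst π e γ τ x - isWeight π τ θp x • pgEst π e γ τ θp) -
        (gradient (localObj π e H γ) x - gradient (localObj π e H γ) θp)) := fun τ => by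
    simp only [f, meanDir]
    module
  refine ⟨hlaw ▸ Measure.isProbabilityMeasure_map hfm.aemeasurable, hlaw ▸ hmem, ?_, ?_⟩
  · rw [hlaw, integral_id_map hfm]
    have h1 : Integrable (fun τ => β • (pgEst π e γ τ x - gradient (localObj π e H γ) x))
        (trajLaw π e H x) := (hgi.sub (integrable_const _)).smul β
    have h2 : Integrable (fun τ => (1 - β) •
        ((pgEst π e γ τ x - isWeight π τ θp x • pgEst π e γ τ θp) -
        (gradient (localObj π e H γ) x - gradient (localObj π e H γ) θp)))
        (trajLaw π e H x) := ((hgi.sub hwgi).sub (integrable_const _)).smul (1 - β)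
    have h3 : ∫ τ, (f τ - meanDir π e H γ β θp ur x) ∂(trajLaw π e H x) = 0 := by
      simp_rw [hfeq]
      rw [integral_add h1 h2, integral_smul, integral_smul,
        integral_sub hgi (integrable_const _), integral_sub (hq2.integrable (by norm_num))
        (integrable_const _), hqmean, ← gradient_localObj hP hG e hγ0 hγ1]
      simp
    rw [integral_sub (hf2.integrable (by norm_num)) (integrable_const _)] at h3
    simpa [sub_eq_zero] using h3
  · have hgs : MemLp (fun τ : Traj S A H => pgEst π e γ τ x - gradient (localObj π e H γ) x) 2
        (trajLaw π e H x) := hg.sub (memLp_const _)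
    have hqs : MemLp (fun τ : Traj S A H => (pgEst π e γ τ x -
        isWeight π τ θp x • pgEst π e γ τ θp) -
        (gradient (localObj π e H γ) x - gradient (localObj π e H γ) θp)) 2
        (trajLaw π e H x) := hq2.sub (memLp_const _)
    have hb1 := integral_norm_pgEst_sub_sq_le (H := H) hP hG e hγ0 hγ1 x
    have hb2 := integral_norm_sub_integral_sq_le hq2 0
    rw [hqmean] at hb2
    simp only [sub_zero] at hb2
    have hb3 := integral_norm_pgEst_sub_isWeight_smul_sq_le hP e hγ0 hγ1 hW hV θp x
    rw [hlaw, integral_map hfm.aemeasurable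
      (by fun_prop : AEStronglyMeasurable (fun y : Param d => ‖y - _‖ ^ 2) _)]
    have hi1 := (hgs.integrable_norm_pow' (p := 2)).const_mul (2 * β ^ 2)
    have hi2 := (hqs.integrable_norm_pow' (p := 2)).const_mul 2
    calc ∫ τ, ‖f τ - meanDir π e H γ β θp ur x‖ ^ 2 ∂(trajLaw π e H x)
        ≤ ∫ τ, (2 * β ^ 2 * ‖pgEst π e γ τ x - gradient (localObj π e H γ) x‖ ^ 2 +
          2 * ‖(pgEst π e γ τ x - isWeight π τ θp x • pgEst π e γ τ θp) -
        (gradient (localObj π e H γ) x - gradient (localObj π e H γ) θp)‖ ^ 2)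
          ∂(trajLaw π e H x) := by
          refine integral_mono_of_nonneg (ae_of_all _ fun τ => by positivity) (hi1.add hi2)
            (ae_of_all _ fun τ => ?_)
          simp only
          rw [hfeq]
          exact norm_smul_add_smul_sq_le hβ0 hβ1 _ _
      _ ≤ 2 * β ^ 2 * gradBound H Rmax G ^ 2 + 2 * (2 * (estLip H Rmax M ^ 2 +
          gradBound H Rmax G ^ 2 * ((H * G) ^ 2 * (2 + W))) * ‖x - θp‖ ^ 2) := by
          rw [integral_add hi1 hi2, integral_const_mul, integral_const_mul]
          gcongr
          exact hb2.trans hb3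
      _ ≤ _ := by
          obtain ⟨h1, h2, h3, h4⟩ := varConst_bounds (H := H) Rmax G M hW
          unfold varConst
          nlinarith [mul_nonneg (sq_nonneg β) h3, mul_nonneg (sq_nonneg β) h4,
            mul_le_mul_of_nonneg_left h2 (sq_nonneg β), mul_nonneg (sq_nonneg ‖x - θp‖) h1,
            mul_nonneg (sq_nonneg ‖x - θp‖) h4]

theorem isProbabilityMeasure_restrict_Icc :
    IsProbabilityMeasure ((volume : Measure ℝ).restrict (Set.Icc 0 1)) := ⟨by simp⟩

theorem measurable_hapgDir_law (hP : PolicyBounds π G M) (e : Env S A Rmax) (γ β : ℝ) {X : Type*}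
    [MeasurableSpace X] {θp ur x : X → Param d} (hθp : Measurable θp) (hur : Measurable ur)
    (hx : Measurable x) {α : X → ℝ} (hα : Measurable α) :
    Measurable fun p => (trajLaw π e H (α p • θp p + (1 - α p) • x p)).map
      (hapgDir π e γ β (θp p) (ur p) (x p) (α p)) := by
  have hy : Measurable fun p => α p • θp p + (1 - α p) • x p :=
    (hα.smul hθp).add ((measurable_const.sub hα).smul hx)
  refine measurable_map_of_uncurry
    (κ := fun p => trajLaw π e H (α p • θp p + (1 - α p) • x p))
    (f := fun p τ => hapgDir π e γ β (θp p) (ur p) (x p) (α p) τ)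
    ((measurable_trajLaw π e H).comp hy) ?_
  exact measurable_hapgDir hP e γ β (hθp.comp measurable_fst) (hur.comp measurable_fst)
    (hx.comp measurable_fst) (hα.comp measurable_fst) measurable_snd

/-- For fixed α the deviation is measured from the mean over all α, not from the conditional mean.
This costs nothing, since the correction and the gradient difference it estimates are both at most
`objSmooth` times ‖x - θp‖ pointwise. -/
theorem integral_norm_hapgDir_sub_sq_le (hP : PolicyBounds π G M) (hG : 0 ≤ G)
    (hR : 0 ≤ Rmax) (e : Env S A Rmax)
    (hγ0 : 0 ≤ γ) (hγ1 : γ ≤ 1) {W : ℝ} (hW : 0 ≤ W) (hV : WeightVarianceBound π e H W)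
    {β : ℝ} (hβ0 : 0 ≤ β) (hβ1 : β ≤ 1) (θp ur x : Param d) (α : ℝ) :
    MemLp (hapgDir π e γ β θp ur x α) 2 (trajLaw π e H (segPoint θp x α)) ∧
    ∫ τ, ‖hapgDir π e γ β θp ur x α τ - meanDir π e H γ β θp ur x‖ ^ 2
      ∂(trajLaw π e H (segPoint θp x α)) ≤
      varConst H Rmax G M W * (β ^ 2 + ‖x - θp‖ ^ 2) := by
  set y := segPoint θp x α with hy
  have hwg := memLp_isWeight_smul_pgEst (H := H) hP e hγ0 hγ1 x y
  have hLb : ∀ τ : Traj S A H, ‖hessCorr π e γ τ y (x - θp)‖ ≤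
      objSmooth H Rmax G M * ‖x - θp‖ := fun τ => by
    refine (norm_hessCorr_le hP hG e hγ0 hγ1 τ y (x - θp)).trans ?_
    gcongr
    unfold objSmooth gradBound estLip
    have : 0 ≤ H * G * ((H : ℝ) ^ 2 * Rmax * G) := by positivity
    linarith
  have hL2 : MemLp (fun τ : Traj S A H => hessCorr π e γ τ y (x - θp)) 2 (trajLaw π e H y) :=
    MemLp.of_bound (measurable_hessCorr hP e γ measurable_const measurable_const
      measurable_id).aestronglyMeasurable _ (ae_of_all _ hLb)
  have hf2 : MemLp (hapgDir π e γ β θp ur x α) 2 (trajLaw π e H y) :=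
    (hwg.const_smul β).add (((memLp_const ur).add hL2).const_smul (1 - β))
  refine ⟨hf2, ?_⟩
  have hfeq : ∀ τ : Traj S A H, hapgDir π e γ β θp ur x α τ - meanDir π e H γ β θp ur x =
      β • (isWeight π τ x y • pgEst π e γ τ x - gradient (localObj π e H γ) x) +
      (1 - β) • (hessCorr π e γ τ y (x - θp) -
        (gradient (localObj π e H γ) x - gradient (localObj π e H γ) θp)) := fun τ => by
    simp only [hapgDir, meanDir, hy, segPoint]
    module
  have hgs : MemLp (fun τ : Traj S A H => isWeight π τ x y • pgEst π e γ τ x -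
      gradient (localObj π e H γ) x) 2 (trajLaw π e H y) := hwg.sub (memLp_const _)
  have hb1 := integral_norm_sub_integral_sq_le hwg 0
  rw [integral_isWeight_smul_pgEst hP hG e hγ0 hγ1] at hb1
  simp only [sub_zero] at hb1
  have hb2 := integral_norm_isWeight_smul_pgEst_sq_le (H := H) hP e hγ0 hγ1 hW hV x y
  have hi1 := (hgs.integrable_norm_pow' (p := 2)).const_mul (2 * β ^ 2)
  have hdiff := norm_gradient_localObj_sub_le hP hG e hγ0 hγ1 H θp x
  calc ∫ τ, ‖hapgDir π e γ β θp ur x α τ - meanDir π e H γ β θp ur x‖ ^ 2 ∂(trajLaw π e H y)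
      ≤ ∫ τ, (2 * β ^ 2 * ‖isWeight π τ x y • pgEst π e γ τ x -
          gradient (localObj π e H γ) x‖ ^ 2 +
        2 * (2 * objSmooth H Rmax G M * ‖x - θp‖) ^ 2) ∂(trajLaw π e H y) := by
        refine integral_mono_of_nonneg (ae_of_all _ fun τ => by positivity)
          (hi1.add (integrable_const _)) (ae_of_all _ fun τ => ?_)
        simp only
        rw [hfeq]
        refine (norm_smul_add_smul_sq_le hβ0 hβ1 _ _).trans ?_
        gcongr
        refine (norm_sub_le _ _).trans ?_
        have := hLb τ
        unfold objSmooth gradBound estLip at *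
        linarith
    _ ≤ 2 * β ^ 2 * (gradBound H Rmax G ^ 2 * (1 + W)) +
        2 * (2 * objSmooth H Rmax G M * ‖x - θp‖) ^ 2 := by
        rw [integral_add hi1 (integrable_const _), integral_const_mul]
        simp only [integral_const, probReal_univ, one_smul]
        gcongr
        exact hb1.trans hb2
    _ ≤ _ := by
        obtain ⟨h1, h2, h3, h4⟩ := varConst_bounds (H := H) Rmax G M hW
        unfold varConst
        nlinarith [mul_nonneg (sq_nonneg β) h3, mul_nonneg (sq_nonneg β) h4,
          mul_nonneg (sq_nonneg ‖x - θp‖) h1, mul_nonneg (sq_nonneg ‖x - θp‖) h3,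
          mul_nonneg (sq_nonneg ‖x - θp‖) h4]

/-- The variance bound is uniform in α around a centre independent of α, so it survives the mixture.
For the mean, averaging the Hessian-vector products over α gives the exact gradient difference. -/
theorem hasMeanVar_hapgLaw (hP : PolicyBounds π G M) (hG : 0 ≤ G)
    (hR : 0 ≤ Rmax) (e : Env S A Rmax)
    (hγ0 : 0 ≤ γ) (hγ1 : γ ≤ 1) {W : ℝ} (hW : 0 ≤ W) (hV : WeightVarianceBound π e H W)
    {β : ℝ} (hβ0 : 0 ≤ β) (hβ1 : β ≤ 1) (θp ur x : Param d) :
    HasMeanVar (hapgLaw π e H γ β θp ur x) (meanDir π e H γ β θp ur x)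
      (varConst H Rmax G M W * (β ^ 2 + ‖x - θp‖ ^ 2)) := by
  have hprob := isProbabilityMeasure_restrict_Icc
  let κ : ℝ → Measure (Param d) := fun α =>
    (trajLaw π e H (segPoint θp x α)).map (hapgDir π e γ β θp ur x α)
  have hlaw : hapgLaw π e H γ β θp ur x = ((volume : Measure ℝ).restrict (Set.Icc 0 1)).bind κ :=
    rfl
  have hκ : Measurable κ := measurable_hapgDir_law hP e γ β measurable_const measurable_const
    measurable_const measurable_id
  have hfm : ∀ α, Measurable (hapgDir (H := H) π e γ β θp ur x α) := fun α =>
    measurable_hapgDir hP e γ β measurable_const measurable_const measurable_const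
      measurable_const measurable_id
  have hκp : ∀ α, IsProbabilityMeasure (κ α) := fun α =>
    Measure.isProbabilityMeasure_map (hfm α).aemeasurable
  have hp : IsProbabilityMeasure (((volume : Measure ℝ).restrict (Set.Icc 0 1)).bind κ) :=
    isProbabilityMeasure_bind hκ
  set V := varConst H Rmax G M W * (β ^ 2 + ‖x - θp‖ ^ 2) with hVdef
  set m := meanDir π e H γ β θp ur x with hm
  have hVar := integral_norm_hapgDir_sub_sq_le (H := H) hP hG hR e hγ0 hγ1 hW hV hβ0 hβ1 θp ur x
  have hV0 : 0 ≤ V := (integral_nonneg fun _ => by positivity).trans (hVar 0).2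
  have hmeas : Measurable fun z : Param d => ‖z - m‖ₑ ^ 2 := by fun_prop
  -- Bounding the second moment in [0, ∞] first yields square integrability under the mixture, which
  -- is needed before the mean can be disintegrated.
  have hlint : ∫⁻ z, ‖z - m‖ₑ ^ 2 ∂(((volume : Measure ℝ).restrict (Set.Icc 0 1)).bind κ) ≤
      ENNReal.ofReal V := by
    rw [Measure.lintegral_bind hκ.aemeasurable hmeas.aemeasurable]
    have h1 : ∀ α, ∫⁻ z, ‖z - m‖ₑ ^ 2 ∂(κ α) ≤ ENNReal.ofReal V := fun α => by
      have h2 : MemLp (fun τ => hapgDir π e γ β θp ur x α τ - m) 2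
          (trajLaw π e H (segPoint θp x α)) := (hVar α).1.sub (memLp_const m)
      rw [lintegral_map hmeas (hfm α), lintegral_enorm_sq_eq h2]
      exact ENNReal.ofReal_le_ofReal (hVar α).2
    refine (lintegral_mono h1).trans_eq ?_
    simp
  have hsub : MemLp (fun z : Param d => z - m) 2
      (((volume : Measure ℝ).restrict (Set.Icc 0 1)).bind κ) :=
    memLp_two_of_lintegral_ne_top (by fun_prop) (hlint.trans_lt ENNReal.ofReal_lt_top).ne
  have hid : MemLp (fun z : Param d => z) 2
      (((volume : Measure ℝ).restrict (Set.Icc 0 1)).bind κ) := by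
    have h := hsub.add (memLp_const m)
    have he : ((fun z : Param d => z - m) + fun _ => m) = fun z => z := by
      ext1 z; simp
    rwa [he] at h
  refine ⟨hlaw ▸ hp, hlaw ▸ hid, ?_, ?_⟩
  · rw [hlaw, integral_bind hκ (hid.integrable (by norm_num))]
    have h1 : ∀ α, ∫ z, z ∂(κ α) = β • gradient (localObj π e H γ) x +
        (1 - β) • (ur + meanHessCorr π e H γ θp x α) := fun α => by
      have hwi := (memLp_isWeight_smul_pgEst (H := H) hP e hγ0 hγ1 x
        (segPoint θp x α)).integrable (by norm_num)
      have hLi := integrable_hessCorr hP hG e hγ0 hγ1 H (segPoint θp x α) (x - θp)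
        (segPoint θp x α)
      have hLi' : Integrable (fun τ : Traj S A H => ur + hessCorr π e γ τ (segPoint θp x α) (x - θp))
        (trajLaw π e H (segPoint θp x α)) := (integrable_const ur).add hLi
      rw [integral_id_map (hfm α)]
      unfold hapgDir
      have hwi2 : Integrable (fun τ : Traj S A H =>
          β • (isWeight π τ x (segPoint θp x α) • pgEst π e γ τ x))
        (trajLaw π e H (segPoint θp x α)) := hwi.smul β
      have hLi2 : Integrable (fun τ : Traj S A H =>
          (1 - β) • (ur + hessCorr π e γ τ (segPoint θp x α) (x - θp)))
        (trajLaw π e H (segPoint θp x α)) := hLi'.smul (1 - β)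
      rw [integral_add hwi2 hLi2, integral_smul, integral_smul,
        integral_add (integrable_const _) hLi, integral_isWeight_smul_pgEst hP hG e hγ0 hγ1]
      simp [meanHessCorr]
    have hi : Integrable (meanHessCorr π e H γ θp x)
        (volume.restrict (Set.Icc (0 : ℝ) 1)) :=
      Integrable.of_bound (stronglyMeasurable_meanHessCorr hP e H γ θp x).aestronglyMeasurable _
        (ae_of_all _ (norm_meanHessCorr_le hP hG e hγ0 hγ1 H θp x))
    have hi' : Integrable (fun α => ur + meanHessCorr π e H γ θp x α)
        (volume.restrict (Set.Icc (0 : ℝ) 1)) := (integrable_const ur).add hi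
    have hi2 : Integrable (fun α => (1 - β) • (ur + meanHessCorr π e H γ θp x α))
        (volume.restrict (Set.Icc (0 : ℝ) 1)) := hi'.smul (1 - β)
    simp_rw [h1]
    rw [integral_add (integrable_const _) hi2,
      integral_smul (1 - β) (fun α => ur + meanHessCorr π e H γ θp x α),
      integral_add (integrable_const _) hi, integral_meanHessCorr hP hG e hγ0 hγ1]
    simp only [integral_const, probReal_univ, one_smul, hm, meanDir]
    module
  · rw [hlaw]
    exact integral_norm_sq_le_of_lintegral_le hsub hV0 hlint

theorem hasMeanVar_dirLaw (alg : Algo) (hP : PolicyBounds π G M) (hG : 0 ≤ G)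
    (hR : 0 ≤ Rmax) (e : Env S A Rmax)
    (hγ0 : 0 ≤ γ) (hγ1 : γ ≤ 1) {W : ℝ} (hW : 0 ≤ W) (hV : WeightVarianceBound π e H W)
    {β : ℝ} (hβ0 : 0 ≤ β) (hβ1 : β ≤ 1) (θp ur x : Param d) :
    HasMeanVar (dirLaw alg π e H γ β θp ur x) (meanDir π e H γ β θp ur x)
      (varConst H Rmax G M W * (β ^ 2 + ‖x - θp‖ ^ 2)) := by
  cases alg
  · exact hasMeanVar_svrpgLaw hP hG e hγ0 hγ1 hW hV hβ0 hβ1 θp ur x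
  · exact hasMeanVar_hapgLaw hP hG hR e hγ0 hγ1 hW hV hβ0 hβ1 θp ur x

theorem measurable_dirLaw (alg : Algo) (hP : PolicyBounds π G M) (e : Env S A Rmax) (H : ℕ)
    (γ β : ℝ) {X : Type*} [MeasurableSpace X] {θp ur x : X → Param d} (hθp : Measurable θp)
    (hur : Measurable ur) (hx : Measurable x) :
    Measurable fun p => dirLaw alg π e H γ β (θp p) (ur p) (x p) := by
  cases alg
  · refine measurable_map_of_uncurry (κ := fun p => trajLaw π e H (x p))
      (f := fun p τ => β • pgEst π e γ τ (x p) + (1 - β) •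
        (ur p + pgEst π e γ τ (x p) - isWeight π τ (θp p) (x p) • pgEst π e γ τ (θp p)))
      ((measurable_trajLaw π e H).comp hx) ?_
    have h1 : Measurable fun q : X × Traj S A H => pgEst π e γ q.2 (x q.1) :=
      measurable_pgEst hP e γ (hx.comp measurable_fst) measurable_snd
    have h2 : Measurable fun q : X × Traj S A H => pgEst π e γ q.2 (θp q.1) :=
      measurable_pgEst hP e γ (hθp.comp measurable_fst) measurable_snd
    have h3 : Measurable fun q : X × Traj S A H => isWeight π q.2 (θp q.1) (x q.1) :=
      measurable_isWeight π (hx.comp measurable_fst) (hθp.comp measurable_fst) measurable_snd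
    have h4 : Measurable fun q : X × Traj S A H => ur q.1 := hur.comp measurable_fst
    exact (h1.const_smul β).add (((h4.add h1).sub (h3.smul h2)).const_smul (1 - β))
  · have hprob := isProbabilityMeasure_restrict_Icc
    refine measurable_bind_of_uncurry
      (κ := fun _ : X => (volume : Measure ℝ).restrict (Set.Icc 0 1))
      (f := fun p α => (trajLaw π e H (α • θp p + (1 - α) • x p)).map
        (hapgDir π e γ β (θp p) (ur p) (x p) α)) measurable_const ?_
    exact measurable_hapgDir_law hP e γ β (hθp.comp measurable_fst) (hur.comp measurable_fst)
      (hx.comp measurable_fst) measurable_snd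

end Direction

/-! ### Drift and noise of one agent over K local steps -/

section LocalSteps

variable {d : ℕ}

theorem norm_add_sq_le_young {E : Type*} [SeminormedAddCommGroup E] (a b : E) {t : ℝ}
    (ht : 0 < t) : ‖a + b‖ ^ 2 ≤ (1 + 1 / t) * ‖a‖ ^ 2 + (1 + t) * ‖b‖ ^ 2 := by
  have h1 : ‖a + b‖ ^ 2 ≤ (‖a‖ + ‖b‖) ^ 2 :=
    pow_le_pow_left₀ (norm_nonneg _) (norm_add_le a b) 2
  have h2 : (1 + 1 / t) * ‖a‖ ^ 2 + (1 + t) * ‖b‖ ^ 2 - (‖a‖ + ‖b‖) ^ 2 =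
      (‖a‖ - t * ‖b‖) ^ 2 / t := by
    field_simp
    ring
  have h3 : 0 ≤ (‖a‖ - t * ‖b‖) ^ 2 / t := by positivity
  linarith

/-- The law after `k` steps `x ↦ x + η u` with `u` of law `D x`, started at `θ`. -/
def iterLaw (D : Param d → Measure (Param d)) (η : ℝ) (θ : Param d) : ℕ → Measure (Param d)
  | 0 => Measure.dirac θ
  | k + 1 => (iterLaw D η θ k).bind fun x => (D x).map fun u => x + η • u

theorem measurable_stepLaw {X : Type*} [MeasurableSpace X] {D : X → Param d → Measure (Param d)}
    (hD : Measurable (Function.uncurry D)) [∀ p x, IsProbabilityMeasure (D p x)] (η : ℝ) :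
    Measurable fun q : X × Param d => (D q.1 q.2).map fun u => q.2 + η • u :=
  measurable_map_of_uncurry (κ := fun q : X × Param d => D q.1 q.2) hD
    (f := fun q u => q.2 + η • u)
    ((measurable_snd.comp measurable_fst).add (measurable_snd.const_smul η))

theorem isProbabilityMeasure_stepLaw {D : Measure (Param d)} [IsProbabilityMeasure D] (η : ℝ)
    (x : Param d) : IsProbabilityMeasure (D.map fun u => x + η • u) :=
  Measure.isProbabilityMeasure_map (by fun_prop)

theorem measurable_stepLaw_const {D : Param d → Measure (Param d)}
    (hD : Measurable D) [∀ x, IsProbabilityMeasure (D x)] (η : ℝ) :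
    Measurable fun x => (D x).map fun u => x + η • u :=
  measurable_map_of_uncurry hD (f := fun x u => x + η • u)
    (measurable_fst.add (measurable_snd.const_smul η))

instance isProbabilityMeasure_iterLaw {D : Param d → Measure (Param d)} [hD : Fact (Measurable D)]
    [∀ x, IsProbabilityMeasure (D x)] (η : ℝ) (θ : Param d) :
    ∀ k, IsProbabilityMeasure (iterLaw D η θ k)
  | 0 => by unfold iterLaw; infer_instance
  | k + 1 => by
    have := isProbabilityMeasure_iterLaw (D := D) η θ k
    have := fun x => isProbabilityMeasure_stepLaw (D := D x) η x
    unfold iterLaw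
    exact isProbabilityMeasure_bind (measurable_stepLaw_const hD.out η)

theorem measurable_iterLaw {X : Type*} [MeasurableSpace X] {D : X → Param d → Measure (Param d)}
    (hD : Measurable (Function.uncurry D)) [∀ p x, IsProbabilityMeasure (D p x)] (η : ℝ)
    {θ : X → Param d} (hθ : Measurable θ) :
    ∀ k, Measurable fun p => iterLaw (D p) η (θ p) k
  | 0 => Measure.measurable_dirac.comp hθ
  | k + 1 => by
    have : ∀ p, Fact (Measurable (D p)) := fun p => ⟨hD.of_uncurry_left⟩
    exact measurable_bind_of_uncurry (κ := fun p => iterLaw (D p) η (θ p) k)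
      (f := fun p x => (D p x).map fun u => x + η • u) (measurable_iterLaw hD η hθ k)
      (measurable_stepLaw hD η)

/-- Assumptions on the directions of a local iteration started at `θ`: the mean direction `m` is
within `L ‖x - θ‖` of `m₀`, and the variance is at most `v + c ‖x - θ‖ ^ 2`. -/
structure LocalBounds (D : Param d → Measure (Param d)) (m : Param d → Param d) (θ m₀ : Param d)
    (L c v : ℝ) : Prop where
  meas : Measurable D
  meanVar : ∀ x, HasMeanVar (D x) (m x) (v + c * ‖x - θ‖ ^ 2)
  mean_le : ∀ x, ‖m x - m₀‖ ≤ L * ‖x - θ‖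
  L_nonneg : 0 ≤ L
  c_nonneg : 0 ≤ c
  v_nonneg : 0 ≤ v

variable {D : Param d → Measure (Param d)} {m : Param d → Param d} {θ m₀ : Param d} {L c v : ℝ}

/-- The deviation of the local parameter after `k` steps from its noise-free linearization. -/
def dev (θ m₀ : Param d) (η : ℝ) (k : ℕ) (x : Param d) : Param d := x - θ - ((k : ℝ) * η) • m₀

@[fun_prop]
theorem measurable_dev (θ m₀ : Param d) (η : ℝ) (k : ℕ) : Measurable (dev θ m₀ η k) := by
  unfold dev
  fun_prop

theorem norm_sub_sq_le_dev {η : ℝ} {k K : ℕ} (hk : k ≤ K) (x : Param d) :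
    ‖x - θ‖ ^ 2 ≤ 2 * ‖dev θ m₀ η k x‖ ^ 2 + 2 * (K ^ 2 * η ^ 2 * ‖m₀‖ ^ 2) := by
  have h1 : x - θ = dev θ m₀ η k x + ((k : ℝ) * η) • m₀ := by simp [dev]
  have h2 : ‖((k : ℝ) * η) • m₀‖ ^ 2 ≤ K ^ 2 * η ^ 2 * ‖m₀‖ ^ 2 := by
    rw [norm_smul, mul_pow, Real.norm_eq_abs, sq_abs, mul_pow]
    gcongr
  have h3 := norm_add_sq_le_two_mul (dev θ m₀ η k x) (((k : ℝ) * η) • m₀)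
  rw [← h1] at h3
  linarith

/-- One-step recursion with κ₀ = K, y = ‖dev‖², X = ‖x - θ‖², z = ‖m₀‖². Young's inequality spends
one factor 1 + 1/K; the smallness of η lets the feedback of X into y spend only another 1/K. -/
theorem local_step_bound {c η κ₀ y X L v z : ℝ} (hc : 0 ≤ c) (hκ₀ : 0 < κ₀)
    (hη : 2 * ((1 + κ₀) * L ^ 2 + c) * η ^ 2 * κ₀ ≤ 1) (hy : 0 ≤ y)
    (hX : X ≤ 2 * y + 2 * (κ₀ ^ 2 * η ^ 2 * z)) :
    (1 + 1 / κ₀) * y + (1 + κ₀) * (η ^ 2 * (L ^ 2 * X)) + η ^ 2 * (v + c * X) ≤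
      (1 + 2 / κ₀) * y + η ^ 2 * (v + 2 * ((1 + κ₀) * L ^ 2 + c) * η ^ 2 * κ₀ ^ 2 * z) := by
  set κ := (1 + κ₀) * L ^ 2 + c with hκ
  have hκ0 : 0 ≤ κ := by positivity
  have h5 : η ^ 2 * κ * X ≤ η ^ 2 * κ * (2 * y + 2 * (κ₀ ^ 2 * η ^ 2 * z)) := by gcongr
  have h6 : 2 * κ * η ^ 2 * y ≤ 1 / κ₀ * y := by
    gcongr
    rw [le_div_iff₀ hκ₀]
    exact hη
  calc (1 + 1 / κ₀) * y + (1 + κ₀) * (η ^ 2 * (L ^ 2 * X)) + η ^ 2 * (v + c * X)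
      = (1 + 1 / κ₀) * y + η ^ 2 * κ * X + η ^ 2 * v := by rw [hκ]; ring
    _ ≤ (1 + 1 / κ₀) * y + η ^ 2 * κ * (2 * y + 2 * (κ₀ ^ 2 * η ^ 2 * z)) + η ^ 2 * v := by
        linarith
    _ = (1 + 1 / κ₀) * y + 2 * κ * η ^ 2 * y +
          η ^ 2 * (v + 2 * κ * η ^ 2 * κ₀ ^ 2 * z) := by ring
    _ ≤ (1 + 1 / κ₀) * y + 1 / κ₀ * y + η ^ 2 * (v + 2 * κ * η ^ 2 * κ₀ ^ 2 * z) := by linarith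
    _ = _ := by ring

theorem dev_succ_add_smul (η : ℝ) (k : ℕ) (x u : Param d) :
    dev θ m₀ η (k + 1) (x + η • u) = (dev θ m₀ η k x - η • m₀) + η • u := by
  simp only [dev]
  push_cast
  module

theorem LocalBounds.memLp_dev_succ (h : LocalBounds D m θ m₀ L c v) {η : ℝ} {k : ℕ}
    (x : Param d) : MemLp (fun u => dev θ m₀ η (k + 1) (x + η • u)) 2 (D x) := by
  have hprob := (h.meanVar x).isProb
  have hid : MemLp (fun u : Param d => u) 2 (D x) := (h.meanVar x).memLp
  have h1 : MemLp (fun u : Param d => η • u) 2 (D x) := hid.const_smul η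
  have h2 : MemLp (fun _ : Param d => dev θ m₀ η k x - η • m₀) 2 (D x) := memLp_const _
  have h3 : (fun u => dev θ m₀ η (k + 1) (x + η • u)) =
      (fun _ : Param d => dev θ m₀ η k x - η • m₀) + fun u => η • u :=
    funext fun u => dev_succ_add_smul η k x u
  rw [h3]
  exact h2.add h1

/-- Given x, the next deviation has mean dev + η(m x - m₀), and its noise is orthogonal to that
mean. Hence noise enters additively with η², while the drift is handled by Young's inequality with
parameter K. -/
theorem LocalBounds.integral_dev_succ_sq_le (h : LocalBounds D m θ m₀ L c v) {η : ℝ} {k K : ℕ}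
    (hK : 1 ≤ K) (hk : k ≤ K) (hη : 2 * ((1 + K) * L ^ 2 + c) * η ^ 2 * K ≤ 1) (x : Param d) :
    ∫ u, ‖dev θ m₀ η (k + 1) (x + η • u)‖ ^ 2 ∂(D x) ≤
      (1 + 2 / K) * ‖dev θ m₀ η k x‖ ^ 2 +
        η ^ 2 * (v + 2 * ((1 + K) * L ^ 2 + c) * η ^ 2 * K ^ 2 * ‖m₀‖ ^ 2) := by
  have hprob := (h.meanVar x).isProb
  have hK0 : (0 : ℝ) < K := by exact_mod_cast hK
  simp only [dev_succ_add_smul]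
  rw [integral_norm_add_smul_sq (h.meanVar x).memLp (h.meanVar x).mean]
  have h4 := norm_sub_sq_le_dev (θ := θ) (m₀ := m₀) (η := η) hk x
  generalize dev θ m₀ η k x = Y at *
  have e2 : Y - η • m₀ + η • m x = Y + η • (m x - m₀) := by module
  have h1 := norm_add_sq_le_young Y (η • (m x - m₀)) hK0
  have h2 : ‖η • (m x - m₀)‖ ^ 2 ≤ η ^ 2 * (L ^ 2 * ‖x - θ‖ ^ 2) := by
    rw [norm_smul, mul_pow, Real.norm_eq_abs, sq_abs, ← mul_pow L]
    exact mul_le_mul_of_nonneg_left (pow_le_pow_left₀ (norm_nonneg _) (h.mean_le x) 2)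
      (sq_nonneg η)
  have h3 := mul_le_mul_of_nonneg_left (h.meanVar x).var (sq_nonneg η)
  rw [e2]
  have h5 := mul_le_mul_of_nonneg_left h2 (by positivity : (0 : ℝ) ≤ 1 + K)
  have h6 := local_step_bound (L := L) (v := v) h.c_nonneg hK0 hη (sq_nonneg ‖Y‖) h4
  linarith

theorem one_add_two_div_pow_le {k K : ℕ} (hK : 1 ≤ K) (hk : k ≤ K) :
    (1 + 2 / (K : ℝ)) ^ k ≤ 8 := by
  have hK0 : (0 : ℝ) < K := by exact_mod_cast hK
  have h1 : (1 + 2 / (K : ℝ)) ^ k ≤ (1 + 2 / (K : ℝ)) ^ K :=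
    pow_le_pow_right₀ (by have : 0 ≤ 2 / (K : ℝ) := by positivity
                          linarith) hk
  have h2 : (1 + 2 / (K : ℝ)) ^ K ≤ Real.exp (2 / K) ^ K := by
    gcongr
    linarith [Real.add_one_le_exp (2 / (K : ℝ))]
  have h3 : Real.exp (2 / K) ^ K = Real.exp 1 ^ 2 := by
    rw [← Real.exp_nat_mul, ← Real.exp_nat_mul]
    congr 1
    push_cast
    field_simp
  have h4 := Real.exp_one_lt_d9
  have h5 : Real.exp 1 ^ 2 ≤ 8 := by nlinarith [Real.exp_pos 1]
  linarith

/-- Discrete Gronwall with growth factor 1 + 2/K, whose powers up to K stay below e² < 8. The noise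
of k steps therefore accumulates like kη², not like k²η². -/
theorem LocalBounds.lintegral_dev_sq_le (h : LocalBounds D m θ m₀ L c v) {η : ℝ} {K : ℕ}
    (hK : 1 ≤ K) (hη : 2 * ((1 + K) * L ^ 2 + c) * η ^ 2 * K ≤ 1) : ∀ k ≤ K,
    ∫⁻ x, ‖dev θ m₀ η k x‖ₑ ^ 2 ∂(iterLaw D η θ k) ≤ ENNReal.ofReal (k * (1 + 2 / K) ^ k *
      (η ^ 2 * (v + 2 * ((1 + K) * L ^ 2 + c) * η ^ 2 * K ^ 2 * ‖m₀‖ ^ 2)))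
  | 0, _ => by
    have hm : Measurable fun x : Param d => ‖dev θ m₀ η 0 x‖ₑ ^ 2 := by fun_prop
    simp only [iterLaw]
    rw [lintegral_dirac' _ hm]
    simp [dev]
  | k + 1, hk => by
    have ih := h.lintegral_dev_sq_le hK hη k (by lia)
    have hprob := fun x => (h.meanVar x).isProb
    have hfact : Fact (Measurable D) := ⟨h.meas⟩
    set s := η ^ 2 * (v + 2 * ((1 + K) * L ^ 2 + c) * η ^ 2 * K ^ 2 * ‖m₀‖ ^ 2) with hs
    have hs0 : 0 ≤ s := by
      have := h.v_nonneg
      have := h.c_nonneg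
      positivity
    have hm : Measurable fun x : Param d => ‖dev θ m₀ η (k + 1) x‖ₑ ^ 2 := by fun_prop
    have hmk : Measurable fun x : Param d => ‖dev θ m₀ η k x‖ₑ ^ 2 := by fun_prop
    have hρ : 1 ≤ 1 + 2 / (K : ℝ) := by
      have : 0 ≤ 2 / (K : ℝ) := by positivity
      linarith
    have hstep : ∀ x, ∫⁻ z, ‖dev θ m₀ η (k + 1) z‖ₑ ^ 2 ∂((D x).map fun u => x + η • u) ≤
        ENNReal.ofReal (1 + 2 / K) * ‖dev θ m₀ η k x‖ₑ ^ 2 + ENNReal.ofReal s := fun x => by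
      have hx := h.integral_dev_succ_sq_le hK (k := k) (by lia) hη x
      rw [lintegral_map hm (by fun_prop), lintegral_enorm_sq_eq (h.memLp_dev_succ x), ← ofReal_norm_sq,
        ← ENNReal.ofReal_mul (by linarith), ← ENNReal.ofReal_add (by positivity) hs0]
      exact ENNReal.ofReal_le_ofReal hx
    rw [iterLaw, Measure.lintegral_bind (measurable_stepLaw_const h.meas η).aemeasurable
      hm.aemeasurable]
    refine (lintegral_mono hstep).trans ?_
    rw [lintegral_add_right _ measurable_const, lintegral_const_mul _ hmk]
    simp only [lintegral_const, measure_univ, mul_one]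
    refine (add_le_add_left (mul_le_mul_right ih _) _).trans ?_
    rw [← ENNReal.ofReal_mul (by linarith), ← ENNReal.ofReal_add (by positivity) hs0]
    refine ENNReal.ofReal_le_ofReal ?_
    have h1 : s ≤ (1 + 2 / (K : ℝ)) ^ (k + 1) * s :=
      le_mul_of_one_le_left hs0 (one_le_pow₀ hρ)
    push_cast
    calc (1 + 2 / (K : ℝ)) * (k * (1 + 2 / K) ^ k * s) + s
        ≤ (1 + 2 / (K : ℝ)) * (k * (1 + 2 / K) ^ k * s) + (1 + 2 / (K : ℝ)) ^ (k + 1) * s := by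
          linarith
      _ = _ := by ring

/-- The variance bound for the normalized local update. -/
theorem LocalBounds.integral_dev_sq_le (h : LocalBounds D m θ m₀ L c v) {η : ℝ} {K : ℕ}
    (hK : 1 ≤ K) (hη : 2 * ((1 + K) * L ^ 2 + c) * η ^ 2 * K ≤ 1) {k : ℕ} (hk : k ≤ K) :
    MemLp (dev θ m₀ η k) 2 (iterLaw D η θ k) ∧
    ∫ x, ‖dev θ m₀ η k x‖ ^ 2 ∂(iterLaw D η θ k) ≤ 8 * K *
      (η ^ 2 * (v + 2 * ((1 + K) * L ^ 2 + c) * η ^ 2 * K ^ 2 * ‖m₀‖ ^ 2)) := by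
  have hprob := fun x => (h.meanVar x).isProb
  have hfact : Fact (Measurable D) := ⟨h.meas⟩
  have hl := h.lintegral_dev_sq_le hK hη k hk
  have hmem : MemLp (dev θ m₀ η k) 2 (iterLaw D η θ k) :=
    memLp_two_of_lintegral_ne_top (measurable_dev θ m₀ η k).aestronglyMeasurable (hl.trans_lt ENNReal.ofReal_lt_top).ne
  have := h.v_nonneg
  have := h.c_nonneg
  refine ⟨hmem, (integral_norm_sq_le_of_lintegral_le hmem (by positivity) hl).trans ?_⟩
  gcongr ?_ * _
  rw [mul_comm]
  have := one_add_two_div_pow_le hK hk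
  gcongr

/-- The bias is estimated apart from the second moment, because averaging over agents does not
reduce it. In expectation the noise cancels and only the drift ηL E‖x - θ‖ remains; `Q` bounds E‖x -
θ‖ for all iterates. -/
theorem LocalBounds.norm_integral_dev_le (h : LocalBounds D m θ m₀ L c v) {η Q : ℝ} {K : ℕ}
    (hK : 1 ≤ K) (hη0 : 0 ≤ η) (hη : 2 * ((1 + K) * L ^ 2 + c) * η ^ 2 * K ≤ 1) (hQ : 0 ≤ Q)
    (hQ2 : 2 * (8 * K * (η ^ 2 * (v + 2 * ((1 + K) * L ^ 2 + c) * η ^ 2 * K ^ 2 * ‖m₀‖ ^ 2))) +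
      2 * (K ^ 2 * η ^ 2 * ‖m₀‖ ^ 2) ≤ Q ^ 2) : ∀ k ≤ K,
    ‖∫ x, dev θ m₀ η k x ∂(iterLaw D η θ k)‖ ≤ k * (η * (L * Q))
  | 0, _ => by
    simp only [iterLaw]
    rw [integral_dirac]
    simp [dev]
  | k + 1, hk => by
    have hk' : k ≤ K := by lia
    have ih := h.norm_integral_dev_le hK hη0 hη hQ hQ2 k hk'
    have hprob := fun x => (h.meanVar x).isProb
    have hfact : Fact (Measurable D) := ⟨h.meas⟩
    have hk1 := h.integral_dev_sq_le hK hη hk'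
    have hk2 := (h.integral_dev_sq_le hK hη hk).1.integrable (by norm_num)
    have hmeas := measurable_stepLaw_const h.meas η
    have hinner : ∀ x, ∫ z, dev θ m₀ η (k + 1) z ∂((D x).map fun u => x + η • u) =
        dev θ m₀ η k x + η • (m x - m₀) := fun x => by
      have hid : MemLp (fun u : Param d => u) 2 (D x) := (h.meanVar x).memLp
      have hii : Integrable (fun u : Param d => η • u) (D x) :=
        (hid.integrable (by norm_num)).smul η
      rw [integral_map (by fun_prop) (measurable_dev θ m₀ η _).aestronglyMeasurable]
      simp only [dev_succ_add_smul]
      rw [integral_add (integrable_const _) hii, integral_smul, (h.meanVar x).mean]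
      simp only [integral_const, probReal_univ, one_smul]
      module
    rw [iterLaw] at hk2 ⊢
    have hint := integrable_integral_of_bind hmeas hk2
    rw [integral_bind hmeas hk2]
    simp_rw [hinner] at hint ⊢
    have hY := hk1.1.integrable (by norm_num)
    have hΔ : Integrable (fun x => η • (m x - m₀)) (iterLaw D η θ k) := by
      have h' := hint.sub hY
      have he : ((fun x => dev θ m₀ η k x + η • (m x - m₀)) - dev θ m₀ η k) =
          fun x => η • (m x - m₀) := by
        ext1 x; simp
      rwa [he] at h'
    rw [integral_add hY hΔ]
    have hX2 : MemLp (fun x => x - θ) 2 (iterLaw D η θ k) := by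
      have := hk1.1.add (memLp_const (((k : ℝ) * η) • m₀))
      have he : (dev θ m₀ η k + fun _ => ((k : ℝ) * η) • m₀) = fun x => x - θ := by
        ext1 x; simp [dev]
      rwa [he] at this
    have hXQ : ∫ x, ‖x - θ‖ ∂(iterLaw D η θ k) ≤ Q := by
      refine le_of_sq_le_sq ((sq_integral_norm_le hX2).trans ?_) hQ
      have hi := (hk1.1.integrable_norm_pow' (p := 2)).const_mul 2
      refine (integral_mono (hX2.integrable_norm_pow' (p := 2)) (hi.add (integrable_const _))
        fun x => norm_sub_sq_le_dev (m₀ := m₀) (η := η) hk' x).trans ?_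
      rw [integral_add' hi (integrable_const _), integral_const_mul]
      simp only [integral_const, probReal_univ, one_smul]
      linarith [hk1.2]
    have hb : ‖∫ x, η • (m x - m₀) ∂(iterLaw D η θ k)‖ ≤ η * (L * Q) := by
      have hi : Integrable (fun x => η * (L * ‖x - θ‖)) (iterLaw D η θ k) :=
        ((hX2.integrable (by norm_num)).norm.const_mul L).const_mul η
      refine (norm_integral_le_of_norm_le hi (ae_of_all _ fun x => ?_)).trans ?_
      · rw [norm_smul, Real.norm_eq_abs, abs_of_nonneg hη0]
        gcongr
        exact h.mean_le x
      · rw [integral_const_mul, integral_const_mul]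
        have := h.L_nonneg
        gcongr
    refine (norm_add_le _ _).trans ((add_le_add ih hb).trans_eq ?_)
    push_cast
    ring

/-- The normalized deviation of the local update after `K` steps. -/
def normDev (θ m₀ : Param d) (η : ℝ) (K : ℕ) (x : Param d) : Param d :=
  (1 / (η * K)) • (x - θ) - m₀

theorem normDev_eq {η : ℝ} (hη : 0 < η) {K : ℕ} (hK : 1 ≤ K) (x : Param d) :
    normDev θ m₀ η K x = (1 / (η * K)) • dev θ m₀ η K x := by
  have hK0 : (0 : ℝ) < K := by exact_mod_cast hK
  have : (1 / (η * K)) * ((K : ℝ) * η) = 1 := by field_simp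
  rw [normDev, dev, smul_sub _ _ (((K : ℝ) * η) • m₀), smul_smul, this, one_smul]

/-- Dividing by ηK turns accumulated noise of order Kη²v into 8v/K. Everything caused by the drift
carries a factor δ, which can be made as small as desired through η. -/
theorem LocalBounds.normDev_bounds (h : LocalBounds D m θ m₀ L c v) {η δ : ℝ} {K : ℕ}
    (hK : 1 ≤ K) (hη0 : 0 < η) (hδ1 : δ ≤ 1)
    (hη1 : 2 * ((1 + K) * L ^ 2 + c) * η ^ 2 * K ^ 2 ≤ δ) (hη2 : 18 * L ^ 2 * K ^ 2 * η ^ 2 ≤ δ) :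
    IsProbabilityMeasure (iterLaw D η θ K) ∧
    MemLp (normDev θ m₀ η K) 2 (iterLaw D η θ K) ∧
    ∫ x, ‖normDev θ m₀ η K x‖ ^ 2 ∂(iterLaw D η θ K) ≤ 8 / K * (v + δ * ‖m₀‖ ^ 2) ∧
    ‖∫ x, normDev θ m₀ η K x ∂(iterLaw D η θ K)‖ ^ 2 ≤ δ * (v + ‖m₀‖ ^ 2) := by
  have hprob := fun x => (h.meanVar x).isProb
  have hfact : Fact (Measurable D) := ⟨h.meas⟩
  have hv := h.v_nonneg
  have hc := h.c_nonneg
  have hK1 : (1 : ℝ) ≤ K := by exact_mod_cast hK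
  have hK0 : (0 : ℝ) < K := by linarith
  have hδ0 : 0 ≤ δ := le_trans (by positivity) hη2
  have hη : 2 * ((1 + K) * L ^ 2 + c) * η ^ 2 * K ≤ 1 := by
    refine le_trans ?_ (hη1.trans hδ1)
    gcongr
    nlinarith
  have h1 := h.integral_dev_sq_le hK hη le_rfl
  have hfun : normDev θ m₀ η K = fun x => (1 / (η * K)) • dev θ m₀ η K x :=
    funext fun x => normDev_eq hη0 hK x
  have hs : 2 * ((1 + K) * L ^ 2 + c) * η ^ 2 * K ^ 2 * ‖m₀‖ ^ 2 ≤ δ * ‖m₀‖ ^ 2 := by gcongr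
  refine ⟨inferInstance, hfun ▸ h1.1.const_smul (1 / (η * K)), ?_, ?_⟩
  · rw [hfun]
    simp only [norm_smul, mul_pow, Real.norm_eq_abs, sq_abs]
    rw [integral_const_mul]
    calc (1 / (η * K)) ^ 2 * ∫ x, ‖dev θ m₀ η K x‖ ^ 2 ∂(iterLaw D η θ K)
        ≤ (1 / (η * K)) ^ 2 * (8 * K * (η ^ 2 * (v + δ * ‖m₀‖ ^ 2))) := by
          refine mul_le_mul_of_nonneg_left (h1.2.trans ?_) (by positivity)
          gcongr
      _ = _ := by field_simp
  -- 18 = 2·8 + 2: twice the deviation bound plus twice the squared linear displacement Kη m₀, with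
  -- K ≤ K² in the first term.
  · set Q := Real.sqrt (18 * K ^ 2 * η ^ 2 * (v + ‖m₀‖ ^ 2)) with hQ
    have hQsq : Q ^ 2 = 18 * K ^ 2 * η ^ 2 * (v + ‖m₀‖ ^ 2) := Real.sq_sqrt (by positivity)
    have hQ2 : 2 * (8 * K * (η ^ 2 * (v + 2 * ((1 + K) * L ^ 2 + c) * η ^ 2 * K ^ 2 * ‖m₀‖ ^ 2))) +
      2 * (K ^ 2 * η ^ 2 * ‖m₀‖ ^ 2) ≤ Q ^ 2 := by
      have h2 : 2 * ((1 + K) * L ^ 2 + c) * η ^ 2 * K ^ 2 * ‖m₀‖ ^ 2 ≤ ‖m₀‖ ^ 2 :=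
        hs.trans (mul_le_of_le_one_left (by positivity) hδ1)
      rw [hQsq]
      calc _ ≤ 2 * (8 * (K : ℝ) ^ 2 * (η ^ 2 * (v + ‖m₀‖ ^ 2))) +
            2 * (K ^ 2 * η ^ 2 * (v + ‖m₀‖ ^ 2)) := by
            gcongr
            · nlinarith
            · linarith
        _ = _ := by ring
    have h3 := h.norm_integral_dev_le hK hη0.le hη (Real.sqrt_nonneg _) hQ2 K le_rfl
    rw [hfun, integral_smul, norm_smul, mul_pow, Real.norm_eq_abs, sq_abs]
    calc (1 / (η * K)) ^ 2 * ‖∫ x, dev θ m₀ η K x ∂(iterLaw D η θ K)‖ ^ 2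
        ≤ (1 / (η * K)) ^ 2 * (K * (η * (L * Q))) ^ 2 := by gcongr
      _ = L ^ 2 * Q ^ 2 := by field_simp
      _ = 18 * L ^ 2 * K ^ 2 * η ^ 2 * (v + ‖m₀‖ ^ 2) := by rw [hQsq]; ring
      _ ≤ _ := by gcongr

end LocalSteps

/-! ### One communication round: smoothness of J and the error recursion -/

section Round

variable {d N : ℕ} {S : Type u} {A : Type v} [MeasurableSpace S] [MeasurableSpace A]
  {ν : Measure A} {Rmax : ℝ} {H : ℕ} {G M W : ℝ} {γ : ℝ} {π : Policy d S A ν}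
  {env : Fin N → Env S A Rmax}

/-- The standing assumptions on the policy and the environments. -/
structure Regular (π : Policy d S A ν) (env : Fin N → Env S A Rmax) (H : ℕ) (γ G M W : ℝ) :
    Prop where
  bounds : PolicyBounds π G M
  weight : ∀ i, WeightVarianceBound π (env i) H W
  N_pos : 1 ≤ N
  G_nonneg : 0 ≤ G
  M_nonneg : 0 ≤ M
  W_nonneg : 0 ≤ W
  Rmax_nonneg : 0 ≤ Rmax
  γ_nonneg : 0 ≤ γ
  γ_le : γ ≤ 1

theorem localLaw_eq (alg : Algo) (π : Policy d S A ν) (e : Env S A Rmax) (H : ℕ) (γ η β : ℝ)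
    (θp θr ur : Param d) : ∀ k, localLaw alg π e H γ η β θp θr ur k =
      iterLaw (dirLaw alg π e H γ β θp ur) η θr k
  | 0 => rfl
  | k + 1 => by rw [localLaw, iterLaw, localLaw_eq alg π e H γ η β θp θr ur k]

theorem objSmooth_nonneg (hR : 0 ≤ Rmax) (hG : 0 ≤ G) (hM : 0 ≤ M) :
    0 ≤ objSmooth H Rmax G M := by
  unfold objSmooth gradBound estLip
  positivity

theorem varConst_nonneg (hW : 0 ≤ W) : 0 ≤ varConst H Rmax G M W := by
  unfold varConst
  positivity

theorem norm_average_le {F : Type*} [SeminormedAddCommGroup F] [NormedSpace ℝ F] (hN : 1 ≤ N)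
    {f : Fin N → F} {c : ℝ} (hf : ∀ i, ‖f i‖ ≤ c) : ‖(1 / (N : ℝ)) • ∑ i, f i‖ ≤ c := by
  have hN0 : (0 : ℝ) < N := by exact_mod_cast hN
  rw [norm_smul, Real.norm_eq_abs, abs_of_pos (by positivity)]
  have h1 : ‖∑ i, f i‖ ≤ N * c := by
    refine (norm_sum_le _ _).trans ((Finset.sum_le_sum fun i _ => hf i).trans_eq ?_)
    simp
  calc 1 / (N : ℝ) * ‖∑ i, f i‖ ≤ 1 / (N : ℝ) * (N * c) := by gcongr
    _ = c := by field_simp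

theorem Regular.obj_nonneg (h : Regular π env H γ G M W) (θ : Param d) :
    0 ≤ obj π env H γ θ :=
  mul_nonneg (by positivity)
    (Finset.sum_nonneg fun i _ => localObj_nonneg (env i) h.γ_nonneg h.γ_le H θ)

variable [SigmaFinite ν]

theorem Regular.hasGradientAt_obj (h : Regular π env H γ G M W) (θ : Param d) :
    HasGradientAt (obj π env H γ)
      ((1 / (N : ℝ)) • ∑ i, gradient (localObj π (env i) H γ) θ) θ := by
  rw [hasGradientAt_iff_hasFDerivAt, map_smul, map_sum]
  have h1 : ∀ i ∈ Finset.univ, HasFDerivAt (localObj π (env i) H γ)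
      ((InnerProductSpace.toDual ℝ (Param d)) (gradient (localObj π (env i) H γ) θ)) θ :=
    fun i _ => by
      have := hasGradientAt_localObj h.bounds h.G_nonneg (env i) h.γ_nonneg h.γ_le θ H
      exact this.differentiableAt.hasGradientAt.hasFDerivAt
  exact (HasFDerivAt.fun_sum h1).const_mul (1 / (N : ℝ))

theorem Regular.gradient_obj (h : Regular π env H γ G M W) (θ : Param d) :
    gradient (obj π env H γ) θ = (1 / (N : ℝ)) • ∑ i, gradient (localObj π (env i) H γ) θ :=
  (h.hasGradientAt_obj θ).gradient

theorem Regular.norm_gradient_obj_le (h : Regular π env H γ G M W) (θ : Param d) :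
    ‖gradient (obj π env H γ) θ‖ ≤ gradBound H Rmax G := by
  rw [h.gradient_obj]
  exact norm_average_le h.N_pos fun i =>
    norm_gradient_localObj_le h.bounds h.G_nonneg (env i) h.γ_nonneg h.γ_le H θ

theorem Regular.norm_gradient_obj_sub_le (h : Regular π env H γ G M W) (θ θ' : Param d) :
    ‖gradient (obj π env H γ) θ' - gradient (obj π env H γ) θ‖ ≤
      objSmooth H Rmax G M * ‖θ' - θ‖ := by
  rw [h.gradient_obj, h.gradient_obj, ← smul_sub, ← Finset.sum_sub_distrib]
  exact norm_average_le h.N_pos fun i =>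
    norm_gradient_localObj_sub_le h.bounds h.G_nonneg (env i) h.γ_nonneg h.γ_le H θ θ'

theorem Regular.obj_le (h : Regular π env H γ G M W) (θ : Param d) :
    obj π env H γ θ ≤ H * Rmax := by
  refine (le_abs_self _).trans (norm_average_le h.N_pos (f := fun i => localObj π (env i) H γ θ)
    fun i => ?_)
  rw [Real.norm_eq_abs, abs_of_nonneg (localObj_nonneg (env i) h.γ_nonneg h.γ_le H θ)]
  exact localObj_le (env i) h.γ_nonneg h.γ_le H θ

theorem Regular.measurable_obj (h : Regular π env H γ G M W) : Measurable (obj π env H γ) :=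
  (continuous_iff_continuousAt.2 fun θ =>
    (h.hasGradientAt_obj θ).differentiableAt.continuousAt).measurable

theorem Regular.measurable_gradient_obj (h : Regular π env H γ G M W) :
    Measurable (gradient (obj π env H γ)) :=
  (LipschitzWith.of_dist_le_mul (K := (objSmooth H Rmax G M).toNNReal) fun θ' θ => by
    rw [dist_eq_norm, dist_eq_norm, Real.coe_toNNReal _
      (objSmooth_nonneg h.Rmax_nonneg h.G_nonneg h.M_nonneg)]
    exact h.norm_gradient_obj_sub_le θ θ').continuous.measurable

/-- A lower bound for the objective after a step. -/
theorem Regular.obj_add_ge (h : Regular π env H γ G M W) (θ v : Param d) :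
    obj π env H γ θ + inner ℝ (gradient (obj π env H γ) θ) v - objSmooth H Rmax G M * ‖v‖ ^ 2 ≤
      obj π env H γ (θ + v) := by
  set L := objSmooth H Rmax G M with hL
  have hL0 : 0 ≤ L := objSmooth_nonneg h.Rmax_nonneg h.G_nonneg h.M_nonneg
  let D := InnerProductSpace.toDual ℝ (Param d)
  -- Mean value inequality for z ↦ J(z) - ⟨∇J(θ), z⟩ on the ball of radius ‖v‖. It gives the
  -- quadratic term with constant L instead of the sharp L/2, which suffices here.
  have hd : ∀ z ∈ Metric.closedBall θ ‖v‖, HasFDerivWithinAt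
      (fun z => obj π env H γ z - D (gradient (obj π env H γ) θ) z)
      (D (gradient (obj π env H γ) z) - D (gradient (obj π env H γ) θ))
      (Metric.closedBall θ ‖v‖) z := fun z _ =>
    ((h.hasGradientAt_obj z).differentiableAt.hasGradientAt.hasFDerivAt.sub
      (D (gradient (obj π env H γ) θ)).hasFDerivAt).hasFDerivWithinAt
  have hb : ∀ z ∈ Metric.closedBall θ ‖v‖,
      ‖D (gradient (obj π env H γ) z) - D (gradient (obj π env H γ) θ)‖ ≤ L * ‖v‖ := by
    intro z hz
    rw [← map_sub, LinearIsometryEquiv.norm_map]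
    refine (h.norm_gradient_obj_sub_le θ z).trans ?_
    rw [mem_closedBall_iff_norm] at hz
    gcongr
  have key := Convex.norm_image_sub_le_of_norm_hasFDerivWithin_le hd hb
    (convex_closedBall θ ‖v‖) (x := θ) (y := θ + v) (Metric.mem_closedBall_self (norm_nonneg v))
    (by simp)
  rw [Real.norm_eq_abs, abs_le] at key
  simp only [add_sub_cancel_left, map_add, D, InnerProductSpace.toDual_apply_apply] at key
  nlinarith [key.1]

/-- The variance is stated relative to ‖x - θp‖; splitting it through θ puts the server displacement
into `v` and leaves the local displacement with constant twice `varConst`. In the mean only ∇J_i(x)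
depends on x, so its Lipschitz constant is that of ∇J_i. -/
theorem Regular.localBounds (h : Regular π env H γ G M W) (alg : Algo) (i : Fin N) {β : ℝ}
    (hβ0 : 0 ≤ β) (hβ1 : β ≤ 1) (θp θ ur : Param d) :
    LocalBounds (dirLaw alg π (env i) H γ β θp ur) (meanDir π (env i) H γ β θp ur) θ
      (meanDir π (env i) H γ β θp ur θ) (objSmooth H Rmax G M) (2 * varConst H Rmax G M W)
      (varConst H Rmax G M W * (β ^ 2 + 2 * ‖θ - θp‖ ^ 2)) where
  meas := measurable_dirLaw alg h.bounds (env i) H γ β measurable_const measurable_const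
    measurable_id
  meanVar x := by
    have h1 := hasMeanVar_dirLaw alg h.bounds h.G_nonneg h.Rmax_nonneg (env i) h.γ_nonneg
      h.γ_le h.W_nonneg (h.weight i) hβ0 hβ1 θp ur x
    refine ⟨h1.isProb, h1.memLp, h1.mean, h1.var.trans ?_⟩
    have h2 := norm_add_sq_le_two_mul (x - θ) (θ - θp)
    rw [sub_add_sub_cancel] at h2
    have hc : 0 ≤ varConst H Rmax G M W := varConst_nonneg h.W_nonneg
    nlinarith [mul_le_mul_of_nonneg_left h2 hc]
  mean_le x := by
    have h1 : meanDir π (env i) H γ β θp ur x - meanDir π (env i) H γ β θp ur θ =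
        gradient (localObj π (env i) H γ) x - gradient (localObj π (env i) H γ) θ := by
      simp [meanDir]
    rw [h1]
    exact norm_gradient_localObj_sub_le h.bounds h.G_nonneg (env i) h.γ_nonneg h.γ_le H θ x
  L_nonneg := objSmooth_nonneg h.Rmax_nonneg h.G_nonneg h.M_nonneg
  c_nonneg := mul_nonneg zero_le_two (varConst_nonneg h.W_nonneg)
  v_nonneg := mul_nonneg (varConst_nonneg h.W_nonneg) (by positivity)

theorem Regular.average_meanDir (h : Regular π env H γ G M W) (β : ℝ) (θp ur θ : Param d) :
    (1 / (N : ℝ)) • ∑ i, meanDir π (env i) H γ β θp ur θ =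
      (1 - β) • (ur - gradient (obj π env H γ) θp) + gradient (obj π env H γ) θ := by
  have hN0 : (N : ℝ) ≠ 0 := by
    have := h.N_pos
    exact_mod_cast (by lia : N ≠ 0)
  have hN1 : (1 / (N : ℝ)) * N = 1 := by field_simp
  rw [h.gradient_obj, h.gradient_obj]
  simp only [meanDir]
  rw [Finset.sum_add_distrib, ← Finset.smul_sum, Finset.sum_sub_distrib, smul_add,
    smul_comm (1 / (N : ℝ)) (1 - β), smul_sub (1 / (N : ℝ)), Finset.sum_const, Finset.card_univ,
    Fintype.card_fin, ← Nat.cast_smul_eq_nsmul ℝ, smul_smul, hN1, one_smul]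

/-- Here the heterogeneity of the environments is absorbed: replacing the global gradient by that of
agent i costs at most two gradient bounds, and ∇J_i(θ) a third. The 18 is 2·3². -/
theorem Regular.norm_meanDir_sq_le (h : Regular π env H γ G M W) (i : Fin N) {β : ℝ}
    (hβ0 : 0 ≤ β) (hβ1 : β ≤ 1) (θp ur θ : Param d) :
    ‖meanDir π (env i) H γ β θp ur θ‖ ^ 2 ≤
      2 * ‖ur - gradient (obj π env H γ) θp‖ ^ 2 + 18 * gradBound H Rmax G ^ 2 := by
  set e := ur - gradient (obj π env H γ) θp with he
  set g := gradBound H Rmax G with hg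
  have h1 := norm_gradient_localObj_le h.bounds h.G_nonneg (env i) h.γ_nonneg h.γ_le H
  have h2 := h.norm_gradient_obj_le θp
  have h3 : meanDir π (env i) H γ β θp ur θ = (1 - β) • (e +
      (gradient (obj π env H γ) θp - gradient (localObj π (env i) H γ) θp)) +
      gradient (localObj π (env i) H γ) θ := by
    simp [meanDir, he]
  have h4 : ‖meanDir π (env i) H γ β θp ur θ‖ ≤ ‖e‖ + 3 * g := by
    rw [h3]
    refine (norm_add_le _ _).trans ?_
    rw [norm_smul, Real.norm_eq_abs, abs_of_nonneg (by linarith)]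
    have h5 : ‖e + (gradient (obj π env H γ) θp - gradient (localObj π (env i) H γ) θp)‖ ≤
        ‖e‖ + (g + g) :=
      (norm_add_le _ _).trans (add_le_add le_rfl ((norm_sub_le _ _).trans (add_le_add h2 (h1 θp))))
    have h6 := mul_le_of_le_one_left (norm_nonneg (e +
      (gradient (obj π env H γ) θp - gradient (localObj π (env i) H γ) θp)))
      (by linarith : 1 - β ≤ 1)
    have h7 : ‖gradient (localObj π (env i) H γ) θ‖ ≤ g := h1 θ
    linarith
  calc ‖meanDir π (env i) H γ β θp ur θ‖ ^ 2 ≤ (‖e‖ + 3 * g) ^ 2 :=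
        pow_le_pow_left₀ (norm_nonneg _) h4 2
    _ ≤ _ := by nlinarith [sq_nonneg (‖e‖ - 3 * g)]

/-- The deterministic part stays inside the norm together with the means. This lets Young's
inequality act on the momentum error and the bias only, never on the noise. -/
theorem integral_norm_add_sum_sq_pi_le {ι : Type*} [Fintype ι] {Ω : ι → Type*}
    [∀ i, MeasurableSpace (Ω i)] {μ : ∀ i, Measure (Ω i)} [∀ i, IsProbabilityMeasure (μ i)]
    {f : ∀ i, Ω i → Param d} (hf : ∀ i, MemLp (f i) 2 (μ i)) (a : Param d) :
    MemLp (fun ω : ∀ i, Ω i => a + ∑ i, f i (ω i)) 2 (Measure.pi μ) ∧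
    ∫ ω, ‖a + ∑ i, f i (ω i)‖ ^ 2 ∂(Measure.pi μ) ≤
      ‖a + ∑ i, ∫ x, f i x ∂(μ i)‖ ^ 2 + ∑ i, ∫ x, ‖f i x‖ ^ 2 ∂(μ i) := by
  have hp : ∀ i, MemLp (fun ω : ∀ i, Ω i => f i (ω i)) 2 (Measure.pi μ) := fun i =>
    (hf i).comp_measurePreserving (measurePreserving_eval _ i)
  have hS : MemLp (fun ω : ∀ i, Ω i => ∑ i, f i (ω i)) 2 (Measure.pi μ) :=
    memLp_finsetSum _ fun i _ => hp i
  have hSi := hS.integrable (by norm_num)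
  have hm : ∫ ω, ∑ i, f i (ω i) ∂(Measure.pi μ) = ∑ i, ∫ x, f i x ∂(μ i) := by
    rw [integral_finsetSum _ fun i _ => (hp i).integrable (by norm_num)]
    refine Finset.sum_congr rfl fun i _ => ?_
    have h := integral_map (μ := Measure.pi μ) (φ := Function.eval i)
      (f := f i) (measurable_pi_apply i).aemeasurable
      (by rw [(measurePreserving_eval μ i).map_eq]; exact (hf i).1)
    rw [(measurePreserving_eval μ i).map_eq] at h
    exact h.symm
  refine ⟨(memLp_const a).add hS, ?_⟩
  have h1 := integral_norm_sum_sq_pi_le hf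
  have hl : Integrable (fun ω : ∀ i, Ω i => (inner ℝ a (∑ i, f i (ω i)) : ℝ)) (Measure.pi μ) :=
    hSi.const_inner a
  have hs := hS.integrable_norm_pow' (p := 2)
  have hcl : Integrable (fun ω : ∀ i, Ω i => ‖a‖ ^ 2 + 2 * (inner ℝ a (∑ i, f i (ω i)) : ℝ))
    (Measure.pi μ) := (integrable_const _).add (hl.const_mul 2)
  simp_rw [norm_add_sq_real]
  rw [integral_add hcl hs, integral_add (integrable_const _) (hl.const_mul 2), integral_const_mul,
    integral_inner hSi, hm]
  simp only [integral_const, probReal_univ, one_smul]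
  linarith

/-- The new server direction as a function of the final local parameters. -/
def newDir (N K : ℕ) (η : ℝ) (θ : Param d) (y : Fin N → Param d) : Param d :=
  (1 / (η * N * K)) • ∑ i, (y i - θ)

/-- The local mean directions average to (1 - β)e + ∇J(θ) exactly, so the new error is the damped
old error plus the averaged normalized deviations of the agents. -/
theorem Regular.newDir_sub_eq (h : Regular π env H γ G M W) {η : ℝ} (β : ℝ) (K : ℕ)
    (θp θ ur : Param d) (y : Fin N → Param d) :
    newDir N K η θ y - gradient (obj π env H γ) θ =
      (1 - β) • (ur - gradient (obj π env H γ) θp) +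
        ∑ i, (1 / (N : ℝ)) • normDev θ (meanDir π (env i) H γ β θp ur θ) η K (y i) := by
  have h1 := h.average_meanDir β θp ur θ
  have h2 : (1 / (N : ℝ)) * (1 / (η * K)) = 1 / (η * N * K) := by
    rw [one_div_mul_one_div]; ring
  simp only [normDev, newDir]
  have h3 : ∑ i, (1 / (N : ℝ)) • ((1 / (η * K)) • (y i - θ) - meanDir π (env i) H γ β θp ur θ) =
      (1 / (η * N * K)) • ∑ i, (y i - θ) -
        (1 / (N : ℝ)) • ∑ i, meanDir π (env i) H γ β θp ur θ := by
    rw [← Finset.smul_sum, Finset.sum_sub_distrib (fun i => (1 / (η * K)) • (y i - θ)), smul_sub,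
      ← Finset.smul_sum, smul_smul, h2]
  rw [h3, h1]
  abel

/-- The constant in the recursion for the error of the server direction. -/
def errConst (H : ℕ) (Rmax G M W : ℝ) : ℝ := 18 * varConst H Rmax G M W + 1

/-- The local step-size is small enough for the drift of the agents to be negligible. -/
structure SmallStep (H : ℕ) (Rmax G M W : ℝ) (N K : ℕ) (η β δ : ℝ) : Prop where
  K_pos : 1 ≤ K
  η_pos : 0 < η
  β_pos : 0 < β
  β_le : β ≤ 1
  δ_le : δ ≤ 1
  curv : 2 * ((1 + K) * objSmooth H Rmax G M ^ 2 + 2 * varConst H Rmax G M W) * η ^ 2 * K ^ 2 ≤ δ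
  drift : 18 * objSmooth H Rmax G M ^ 2 * K ^ 2 * η ^ 2 ≤ δ
  small_β : (2 / β + 8) * δ ≤ β / 4
  small_N : (2 / β + 8) * δ ≤ 1 / (N * K)
  small_g : (2 / β + 8) * δ * (18 * gradBound H Rmax G ^ 2) ≤ β ^ 2 / (N * K)

/-- Arithmetic of the recursion: `E` is the old squared error, `b` the squared bias, `s` the noise,
`Dq` the squared server displacement and n = NK. Young's inequality with weight 1/β keeps a
contraction, since (1 + β)(1 - β)² ≤ 1 - β; half of the gain β pays for the part of `M₀`
proportional to `E`. The remaining δ-terms fit into (β² + Dq)/n by the choice of δ. -/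
theorem err_recursion_bound {β δ v E M₀ c g Dq n b s : ℝ} (hn : 0 < n) (hβ0 : 0 < β) (hβ1 : β ≤ 1)
    (hδ : 0 ≤ δ) (hE : 0 ≤ E) (hDq : 0 ≤ Dq) (hc : 0 ≤ c) (hv : v = c * (β ^ 2 + 2 * Dq))
    (hM : M₀ = 2 * E + 18 * g) (hg : 0 ≤ g) (hb : b ≤ δ * (v + M₀))
    (hs : s ≤ 8 / n * v + 8 * δ * M₀)
    (h1 : (2 / β + 8) * δ ≤ β / 4) (h2 : (2 / β + 8) * δ ≤ 1 / n)
    (h3 : (2 / β + 8) * δ * (18 * g) ≤ β ^ 2 / n) :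
    (1 + β) * ((1 - β) ^ 2 * E) + (1 + 1 / β) * b + s ≤
      (1 - β / 2) * E + (18 * c + 1) / n * (β ^ 2 + Dq) := by
  set δ₁ := (2 / β + 8) * δ with hδ₁
  have hv0 : 0 ≤ v := by rw [hv]; positivity
  have hM0 : 0 ≤ M₀ := by rw [hM]; positivity
  have e1 : (1 + β) * (1 - β) ^ 2 ≤ 1 - β := by
    nlinarith [mul_nonneg (sq_nonneg β) (by linarith : 0 ≤ 1 - β)]
  have e2 : 1 + 1 / β ≤ 2 / β := by
    rw [show 2 / β = 1 / β + 1 / β by ring]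
    have : 1 ≤ 1 / β := by rw [le_div_iff₀ hβ0]; linarith
    linarith
  have e3 : (1 + 1 / β) * b ≤ 2 / β * (δ * (v + M₀)) := by
    have : 0 ≤ 1 + 1 / β := by positivity
    calc (1 + 1 / β) * b ≤ (1 + 1 / β) * (δ * (v + M₀)) := by gcongr
      _ ≤ _ := by gcongr
  have e4 : (1 + β) * ((1 - β) ^ 2 * E) ≤ (1 - β) * E := by
    rw [← mul_assoc]; gcongr
  have e5 : 2 / β * (δ * (v + M₀)) + 8 * δ * M₀ ≤ δ₁ * v + δ₁ * M₀ := by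
    rw [hδ₁]
    nlinarith [mul_nonneg hδ hv0]
  have e6 : δ₁ * v ≤ 1 / n * v := by gcongr
  have e7 : δ₁ * E ≤ β / 4 * E := by gcongr
  have e8 : δ₁ * M₀ ≤ β / 2 * E + β ^ 2 / n := by rw [hM]; linarith
  have e9 : 1 / n * v + 8 / n * v + β ^ 2 / n = (9 * v + β ^ 2) / n := by ring
  have e10 : (9 * v + β ^ 2) / n ≤ (18 * c + 1) * (β ^ 2 + Dq) / n := by
    gcongr
    rw [hv]
    nlinarith [mul_nonneg hc (sq_nonneg β)]
  have e11 : (18 * c + 1) / n * (β ^ 2 + Dq) = (18 * c + 1) * (β ^ 2 + Dq) / n := by ring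
  linarith

/-- The linear speed-up appears here: the bias of the average is at most that of a single agent,
while N independent noises of size 1/K average to 1/(NK). -/
theorem Regular.integral_newDir_sub_sq_le (h : Regular π env H γ G M W) (alg : Algo) {K : ℕ}
    {η β δ : ℝ} (hs : SmallStep H Rmax G M W N K η β δ) (θp θ ur : Param d) :
    (∀ i, IsProbabilityMeasure (localLaw alg π (env i) H γ η β θp θ ur K)) ∧
    MemLp (fun y => newDir N K η θ y - gradient (obj π env H γ) θ) 2
      (Measure.pi fun i => localLaw alg π (env i) H γ η β θp θ ur K) ∧
    ∫ y, ‖newDir N K η θ y - gradient (obj π env H γ) θ‖ ^ 2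
      ∂(Measure.pi fun i => localLaw alg π (env i) H γ η β θp θ ur K) ≤
      (1 - β / 2) * ‖ur - gradient (obj π env H γ) θp‖ ^ 2 +
        errConst H Rmax G M W / (N * K) * (β ^ 2 + ‖θ - θp‖ ^ 2) := by
  simp only [localLaw_eq]
  have hloc := fun i => (h.localBounds alg i hs.β_pos.le hs.β_le θp θ ur).normDev_bounds hs.K_pos
    hs.η_pos hs.δ_le hs.curv hs.drift
  have hprob := fun i => (hloc i).1
  refine ⟨hprob, ?_⟩
  have hN0 : (0 : ℝ) < N := by exact_mod_cast h.N_pos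
  have hK0 : (0 : ℝ) < K := by exact_mod_cast hs.K_pos
  have hδ0 : 0 ≤ δ := le_trans (by positivity) hs.drift
  set c := varConst H Rmax G M W with hc
  have hc0 : 0 ≤ c := varConst_nonneg h.W_nonneg
  set v := c * (β ^ 2 + 2 * ‖θ - θp‖ ^ 2) with hv
  have hv0 : 0 ≤ v := by positivity
  set e := ur - gradient (obj π env H γ) θp with he
  set M₀ := 2 * ‖e‖ ^ 2 + 18 * gradBound H Rmax G ^ 2 with hM₀
  have hM₀0 : 0 ≤ M₀ := by positivity
  have hm := fun i => h.norm_meanDir_sq_le i hs.β_pos.le hs.β_le θp ur θ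
  rw [← he, ← hM₀] at hm
  have hpi := integral_norm_add_sum_sq_pi_le
    (f := fun i x => (1 / (N : ℝ)) • normDev θ (meanDir π (env i) H γ β θp ur θ) η K x)
    (fun i => (hloc i).2.1.const_smul (1 / (N : ℝ))) ((1 - β) • e)
  simp only [h.newDir_sub_eq β K θp θ ur]
  refine ⟨hpi.1, hpi.2.trans ?_⟩
  have hbias : ‖∑ i, ∫ x, (1 / (N : ℝ)) • normDev θ (meanDir π (env i) H γ β θp ur θ) η K x
      ∂(iterLaw (dirLaw alg π (env i) H γ β θp ur) η θ K)‖ ^ 2 ≤ δ * (v + M₀) := by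
    simp_rw [integral_smul]
    rw [← Finset.smul_sum]
    have h1 : ∀ i, ‖∫ x, normDev θ (meanDir π (env i) H γ β θp ur θ) η K x
        ∂(iterLaw (dirLaw alg π (env i) H γ β θp ur) η θ K)‖ ≤ Real.sqrt (δ * (v + M₀)) :=
      fun i => by
        refine Real.le_sqrt_of_sq_le ((hloc i).2.2.2.trans ?_)
        gcongr
        exact hm i
    refine (pow_le_pow_left₀ (norm_nonneg _) (norm_average_le h.N_pos h1) 2).trans_eq ?_
    exact Real.sq_sqrt (by positivity)
  have hvar : ∑ i, ∫ x, ‖(1 / (N : ℝ)) • normDev θ (meanDir π (env i) H γ β θp ur θ) η K x‖ ^ 2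
      ∂(iterLaw (dirLaw alg π (env i) H γ β θp ur) η θ K) ≤
      8 / (N * K) * v + 8 * δ * M₀ := by
    simp only [norm_smul, mul_pow, Real.norm_eq_abs, sq_abs]
    simp_rw [integral_const_mul]
    have h1 : ∀ i ∈ Finset.univ, (1 / (N : ℝ)) ^ 2 *
        ∫ x, ‖normDev θ (meanDir π (env i) H γ β θp ur θ) η K x‖ ^ 2
        ∂(iterLaw (dirLaw alg π (env i) H γ β θp ur) η θ K) ≤
        (1 / (N : ℝ)) ^ 2 * (8 / K * (v + δ * M₀)) := fun i _ => by
      refine mul_le_mul_of_nonneg_left ((hloc i).2.2.1.trans ?_) (by positivity)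
      gcongr
      exact hm i
    refine (Finset.sum_le_sum h1).trans ?_
    rw [Finset.sum_const, Finset.card_univ, Fintype.card_fin, nsmul_eq_mul]
    have h2 : (N : ℝ) * ((1 / (N : ℝ)) ^ 2 * (8 / K * (v + δ * M₀))) =
        8 / (N * K) * v + 1 / (N * K) * (8 * δ * M₀) := by
      field_simp
    rw [h2]
    -- For the drift part the gain 1/(NK) is discarded, because δ is already small enough.
    have h3 : 1 / ((N : ℝ) * K) ≤ 1 := by
      rw [div_le_one (by positivity)]
      have h4 : (1 : ℝ) ≤ N := by exact_mod_cast h.N_pos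
      have h5 : (1 : ℝ) ≤ K := by exact_mod_cast hs.K_pos
      nlinarith
    have h6 := mul_le_of_le_one_left (by positivity : 0 ≤ 8 * δ * M₀) h3
    linarith
  have hyoung := norm_add_sq_le_young ((1 - β) • e)
    (∑ i, ∫ x, (1 / (N : ℝ)) • normDev θ (meanDir π (env i) H γ β θp ur θ) η K x
      ∂(iterLaw (dirLaw alg π (env i) H γ β θp ur) η θ K))
    (t := 1 / β) (by have := hs.β_pos; positivity)
  rw [one_div_one_div, norm_smul, mul_pow, Real.norm_eq_abs, sq_abs] at hyoung
  refine (add_le_add_left hyoung _).trans ?_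
  exact err_recursion_bound (g := gradBound H Rmax G ^ 2) (by positivity) hs.β_pos hs.β_le hδ0
    (sq_nonneg ‖e‖) (sq_nonneg ‖θ - θp‖) hc0 hv hM₀ (sq_nonneg _) hbias hvar hs.small_β
    hs.small_N hs.small_g

end Round

/-! ### Lyapunov analysis of the server iteration -/

section Server

variable {d N : ℕ} {S : Type u} {A : Type v} [MeasurableSpace S] [MeasurableSpace A]
  {ν : Measure A} {Rmax : ℝ} {H : ℕ} {G M W : ℝ} {γ : ℝ} {π : Policy d S A ν}
  {env : Fin N → Env S A Rmax}

/-- The Lyapunov function of the server iteration. -/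
def lyapunov (π : Policy d S A ν) (env : Fin N → Env S A Rmax) (H : ℕ) (γ lam β : ℝ)
    (x : Param d × Param d × Param d) : ℝ :=
  (H * Rmax - obj π env H γ x.2.1) +
    lam / β * ‖x.2.2 - gradient (obj π env H γ) x.1‖ ^ 2 + 1 / (4 * lam) * ‖x.2.1 - x.1‖ ^ 2

theorem roundLaw_eq (alg : Algo) (π : Policy d S A ν) (env : Fin N → Env S A Rmax) (H : ℕ)
    (γ : ℝ) (K : ℕ) (η lam β : ℝ) (x : Param d × Param d × Param d) :
    roundLaw alg π env H γ K η lam β x =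
      (Measure.pi fun i => localLaw alg π (env i) H γ η β x.1 x.2.1 x.2.2 K).map fun y =>
        (x.2.1, x.2.1 + lam • newDir N K η x.2.1 y, newDir N K η x.2.1 y) := rfl

variable [SigmaFinite ν]

theorem Regular.lyapunov_nonneg (h : Regular π env H γ G M W) {lam β : ℝ} (hlam : 0 < lam)
    (hβ : 0 < β) (x : Param d × Param d × Param d) : 0 ≤ lyapunov π env H γ lam β x := by
  have h1 := h.obj_le x.2.1
  have h2 : 0 ≤ H * Rmax - obj π env H γ x.2.1 := by linarith
  unfold lyapunov
  positivity

theorem Regular.measurable_lyapunov (h : Regular π env H γ G M W) (lam β : ℝ) :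
    Measurable (lyapunov π env H γ lam β) := by
  have h1 := h.measurable_obj
  have h2 := h.measurable_gradient_obj
  unfold lyapunov
  fun_prop

/-- Decrease of the Lyapunov function along a server step with direction `u`. -/
theorem Regular.lyapunov_step_le (h : Regular π env H γ G M W) {lam β : ℝ} (hlam : 0 < lam)
    (hL : 4 * lam * objSmooth H Rmax G M ≤ 1) (θ u : Param d) :
    lyapunov π env H γ lam β (θ, θ + lam • u, u) ≤
      (H * Rmax - obj π env H γ θ - lam / 2 * ‖gradient (obj π env H γ) θ‖ ^ 2) +
        (lam / 2 + lam / β) * ‖u - gradient (obj π env H γ) θ‖ ^ 2 := by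
  set g := gradient (obj π env H γ) θ with hg
  have h1 := h.obj_add_ge θ (lam • u)
  rw [← hg, inner_smul_right] at h1
  -- Polarization yields a gain (λ/2)‖u‖² besides the gradient term. Half of it pays for the
  -- curvature, the other half for the displacement term of the new state.
  have h2 : inner ℝ g u = (‖g‖ ^ 2 + ‖u‖ ^ 2 - ‖u - g‖ ^ 2) / 2 := by
    rw [norm_sub_sq_real, real_inner_comm]; ring
  have h3 : ‖lam • u‖ ^ 2 = lam ^ 2 * ‖u‖ ^ 2 := by
    rw [norm_smul, mul_pow, Real.norm_eq_abs, sq_abs]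
  rw [h2, h3] at h1
  have h4 : 1 / (4 * lam) * (lam ^ 2 * ‖u‖ ^ 2) = lam / 4 * ‖u‖ ^ 2 := by field_simp
  have h5 : objSmooth H Rmax G M * (lam ^ 2 * ‖u‖ ^ 2) ≤ lam / 4 * ‖u‖ ^ 2 := by
    have : lam * objSmooth H Rmax G M * (lam * ‖u‖ ^ 2) ≤ 1 / 4 * (lam * ‖u‖ ^ 2) := by
      gcongr
      linarith
    linarith
  simp only [lyapunov, add_sub_cancel_left]
  rw [h3, h4, ← hg]
  nlinarith [h1, h5]

theorem measurable_round_map (N K : ℕ) (η lam : ℝ) :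
    Measurable fun p : (Param d × Param d × Param d) × (Fin N → Param d) =>
      (p.1.2.1, p.1.2.1 + lam • newDir N K η p.1.2.1 p.2, newDir N K η p.1.2.1 p.2) := by
  have h2 : Measurable fun p : (Param d × Param d × Param d) × (Fin N → Param d) => p.1.2.1 :=
    measurable_fst.snd.fst
  have h3 : ∀ i, Measurable fun p : (Param d × Param d × Param d) × (Fin N → Param d) =>
      p.2 i - p.1.2.1 := fun i => ((measurable_pi_apply i).comp measurable_snd).sub h2
  have h4 : Measurable fun p : (Param d × Param d × Param d) × (Fin N → Param d) =>
      ∑ i, (p.2 i - p.1.2.1) := Finset.measurable_fun_sum _ fun i _ => h3 i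
  have h1 : Measurable fun p : (Param d × Param d × Param d) × (Fin N → Param d) =>
      newDir N K η p.1.2.1 p.2 := h4.const_smul (1 / (η * N * K))
  have h5 : Measurable fun p : (Param d × Param d × Param d) × (Fin N → Param d) =>
      lam • newDir N K η p.1.2.1 p.2 := h1.const_smul lam
  have h6 : Measurable fun p : (Param d × Param d × Param d) × (Fin N → Param d) =>
      p.1.2.1 + lam • newDir N K η p.1.2.1 p.2 := h2.add h5
  exact h2.prodMk (h6.prodMk h1)

/-- The contraction 1 - β/2 of the error compensates the extra weight λ/2 from the server step, and
the displacement term of the old state absorbs the displacement in the recursion. What remains is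
the momentum noise of order λβ/(NK). Stating this in [0, ∞] makes integrability of the server states
unnecessary. -/
theorem Regular.lintegral_lyapunov_roundLaw_le (h : Regular π env H γ G M W) (alg : Algo) {K : ℕ}
    {η β δ lam : ℝ} (hs : SmallStep H Rmax G M W N K η β δ) (hlam : 0 < lam)
    (hL : 4 * lam * objSmooth H Rmax G M ≤ 1)
    (hlam2 : 6 * lam ^ 2 * errConst H Rmax G M W ≤ β * (N * K))
    (x : Param d × Param d × Param d) :
    IsProbabilityMeasure (roundLaw alg π env H γ K η lam β x) ∧
    ∫⁻ z, ENNReal.ofReal (lyapunov π env H γ lam β z) ∂(roundLaw alg π env H γ K η lam β x) +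
      ENNReal.ofReal (lam / 2) * ‖gradient (obj π env H γ) x.2.1‖ₑ ^ 2 ≤
    ENNReal.ofReal (lyapunov π env H γ lam β x) +
      ENNReal.ofReal (3 / 2 * lam * β * errConst H Rmax G M W / (N * K)) := by
  obtain ⟨θp, θ, ur⟩ := x
  obtain ⟨hprob, hmem, hint⟩ := h.integral_newDir_sub_sq_le alg hs θp θ ur
  have hβ := hs.β_pos
  have hN0 : (0 : ℝ) < N := by exact_mod_cast h.N_pos
  have hK0 : (0 : ℝ) < K := by exact_mod_cast hs.K_pos
  have hc0 : 0 ≤ errConst H Rmax G M W := by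
    have := varConst_nonneg (H := H) (Rmax := Rmax) (G := G) (M := M) h.W_nonneg
    unfold errConst
    positivity
  set c := errConst H Rmax G M W with hc
  have hmap : Measurable fun y : Fin N → Param d =>
      (θ, θ + lam • newDir N K η θ y, newDir N K η θ y) :=
    (measurable_round_map N K η lam).comp (measurable_prodMk_left (x := (θp, θ, ur)))
  rw [roundLaw_eq]
  simp only
  refine ⟨Measure.isProbabilityMeasure_map hmap.aemeasurable, ?_⟩
  rw [lintegral_map (h.measurable_lyapunov lam β).ennreal_ofReal hmap]
  set μ := Measure.pi fun i => localLaw alg π (env i) H γ η β θp θ ur K with hμ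
  have hstep := fun y => h.lyapunov_step_le (β := β) hlam hL θ (newDir N K η θ y)
  have hnn := fun y => h.lyapunov_nonneg hlam hβ
    (θ, θ + lam • newDir N K η θ y, newDir N K η θ y)
  set a := H * Rmax - obj π env H γ θ - lam / 2 * ‖gradient (obj π env H γ) θ‖ ^ 2 with ha
  have hi : Integrable (fun y => a + (lam / 2 + lam / β) *
      ‖newDir N K η θ y - gradient (obj π env H γ) θ‖ ^ 2) μ :=
    (integrable_const _).add ((hmem.integrable_norm_pow' (p := 2)).const_mul _)
  have h1 : ∫⁻ y, ENNReal.ofReal (lyapunov π env H γ lam β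
      (θ, θ + lam • newDir N K η θ y, newDir N K η θ y)) ∂μ ≤
      ENNReal.ofReal (∫ y, (a + (lam / 2 + lam / β) *
        ‖newDir N K η θ y - gradient (obj π env H γ) θ‖ ^ 2) ∂μ) := by
    rw [ofReal_integral_eq_lintegral_ofReal hi (ae_of_all _ fun y => (hnn y).trans (hstep y))]
    exact lintegral_mono fun y => ENNReal.ofReal_le_ofReal (hstep y)
  have h2 : ∫ y, (a + (lam / 2 + lam / β) *
      ‖newDir N K η θ y - gradient (obj π env H γ) θ‖ ^ 2) ∂μ =
      a + (lam / 2 + lam / β) *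
        ∫ y, ‖newDir N K η θ y - gradient (obj π env H γ) θ‖ ^ 2 ∂μ := by
    rw [integral_add (integrable_const _) ((hmem.integrable_norm_pow' (p := 2)).const_mul _),
      integral_const, probReal_univ, one_smul, integral_const_mul]
  have h0 : 0 ≤ ∫ y, (a + (lam / 2 + lam / β) *
      ‖newDir N K η θ y - gradient (obj π env H γ) θ‖ ^ 2) ∂μ :=
    integral_nonneg fun y => (hnn y).trans (hstep y)
  refine (add_le_add_left h1 _).trans ?_
  rw [← ofReal_norm_sq, ← ENNReal.ofReal_mul (by positivity),
    ← ENNReal.ofReal_add h0 (by positivity),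
    ← ENNReal.ofReal_add (h.lyapunov_nonneg hlam hβ _) (by positivity)]
  refine ENNReal.ofReal_le_ofReal ?_
  rw [h2]
  set E := ‖ur - gradient (obj π env H γ) θp‖ ^ 2 with hE
  have hE0 : 0 ≤ E := sq_nonneg _
  have h3 : (lam / 2 + lam / β) *
      ∫ y, ‖newDir N K η θ y - gradient (obj π env H γ) θ‖ ^ 2 ∂μ ≤
      (lam / 2 + lam / β) * ((1 - β / 2) * E + c / (N * K) * (β ^ 2 + ‖θ - θp‖ ^ 2)) := by
    gcongr
  have h4 : (lam / 2 + lam / β) * (1 - β / 2) ≤ lam / β := by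
    have : (lam / 2 + lam / β) * (1 - β / 2) = lam / β - lam * β / 4 := by
      field_simp; ring
    rw [this]
    have : 0 ≤ lam * β / 4 := by positivity
    linarith
  have h5 : lam / 2 + lam / β ≤ 3 / 2 * (lam / β) := by
    have : lam ≤ lam / β := by
      rw [le_div_iff₀ hβ]
      exact mul_le_of_le_one_right hlam.le hs.β_le
    linarith
  -- The condition 6λ²c ≤ βNK is exactly what lets ‖θ - θp‖²/(4λ) dominate the displacement noise.
  have h6 : 3 / 2 * (lam / β) * (c / (N * K)) ≤ 1 / (4 * lam) := by
    rw [le_div_iff₀ (by positivity)]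
    have : 3 / 2 * (lam / β) * (c / (N * K)) * (4 * lam) = 6 * lam ^ 2 * c / (β * (N * K)) := by
      field_simp; ring
    rw [this, div_le_one (by positivity)]
    exact hlam2
  have h7 : (lam / 2 + lam / β) * ((1 - β / 2) * E + c / (N * K) * (β ^ 2 + ‖θ - θp‖ ^ 2)) ≤
      lam / β * E + (3 / 2 * lam * β * c / (N * K) + 1 / (4 * lam) * ‖θ - θp‖ ^ 2) := by
    have e1 : (lam / 2 + lam / β) * (1 - β / 2) * E ≤ lam / β * E := by gcongr
    have e2 : (lam / 2 + lam / β) * (c / (N * K) * (β ^ 2 + ‖θ - θp‖ ^ 2)) ≤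
        3 / 2 * (lam / β) * (c / (N * K) * (β ^ 2 + ‖θ - θp‖ ^ 2)) := by gcongr
    have e3 : 3 / 2 * (lam / β) * (c / (N * K)) * ‖θ - θp‖ ^ 2 ≤
        1 / (4 * lam) * ‖θ - θp‖ ^ 2 := by gcongr
    have e4 : 3 / 2 * (lam / β) * (c / (N * K)) * β ^ 2 = 3 / 2 * lam * β * c / (N * K) := by
      field_simp
    linarith
  simp only [lyapunov, ha]
  rw [← hE]
  linarith

theorem Regular.isProbabilityMeasure_dirLaw (h : Regular π env H γ G M W) (alg : Algo) (i : Fin N)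
    {β : ℝ} (hβ0 : 0 ≤ β) (hβ1 : β ≤ 1) (θp ur x : Param d) :
    IsProbabilityMeasure (dirLaw alg π (env i) H γ β θp ur x) :=
  ((h.localBounds alg i hβ0 hβ1 θp x ur).meanVar x).isProb

theorem Regular.measurable_roundLaw (h : Regular π env H γ G M W) (alg : Algo) (K : ℕ)
    {η β δ : ℝ} (hs : SmallStep H Rmax G M W N K η β δ) (lam : ℝ) :
    Measurable (roundLaw alg π env H γ K η lam β) := by
  have hp : ∀ i (x : Param d × Param d × Param d),
      IsProbabilityMeasure (localLaw alg π (env i) H γ η β x.1 x.2.1 x.2.2 K) :=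
    fun i x => (h.integral_newDir_sub_sq_le alg hs x.1 x.2.1 x.2.2).1 i
  have hloc : ∀ i, Measurable fun x : Param d × Param d × Param d =>
      localLaw alg π (env i) H γ η β x.1 x.2.1 x.2.2 K := fun i => by
    have : ∀ (p : Param d × Param d × Param d) x,
        IsProbabilityMeasure (dirLaw alg π (env i) H γ β p.1 p.2.2 x) := fun p x =>
      h.isProbabilityMeasure_dirLaw alg i hs.β_pos.le hs.β_le p.1 p.2.2 x
    simp only [localLaw_eq]
    exact measurable_iterLaw (X := Param d × Param d × Param d)
      (D := fun p x => dirLaw alg π (env i) H γ β p.1 p.2.2 x)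
      (measurable_dirLaw alg h.bounds (env i) H γ β measurable_fst.fst measurable_fst.snd.snd
        measurable_snd) η measurable_snd.fst K
  exact measurable_map_of_uncurry (measurable_pi_measure hloc) (measurable_round_map N K η lam)

theorem Regular.isProbabilityMeasure_initLaw (h : Regular π env H γ G M W) (B : ℕ)
    (θ₀ : Param d) : IsProbabilityMeasure (initLaw π env H γ B θ₀) ∧
    Measurable fun τ : Fin N × Fin B → Traj S A H =>
      (θ₀, θ₀, (1 / ((N : ℝ) * B)) • ∑ ib : Fin N × Fin B, pgEst π (env ib.1) γ (τ ib) θ₀) := by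
  have hm : Measurable fun τ : Fin N × Fin B → Traj S A H =>
      (θ₀, θ₀, (1 / ((N : ℝ) * B)) • ∑ ib : Fin N × Fin B, pgEst π (env ib.1) γ (τ ib) θ₀) := by
    have h1 : Measurable fun τ : Fin N × Fin B → Traj S A H =>
        ∑ ib : Fin N × Fin B, pgEst π (env ib.1) γ (τ ib) θ₀ :=
      Finset.measurable_fun_sum _ fun ib _ =>
        measurable_pgEst h.bounds (env ib.1) γ measurable_const (measurable_pi_apply ib)
    have h2 : Measurable fun τ : Fin N × Fin B → Traj S A H =>
        (1 / ((N : ℝ) * B)) • ∑ ib : Fin N × Fin B, pgEst π (env ib.1) γ (τ ib) θ₀ :=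
      h1.const_smul (1 / ((N : ℝ) * B))
    exact measurable_const.prodMk (measurable_const.prodMk h2)
  exact ⟨Measure.isProbabilityMeasure_map hm.aemeasurable, hm⟩

/-- Since θ_{-1} = θ_0, the displacement term vanishes, and the error of u_0 is an average of NB
independent centred gradients. -/
theorem Regular.lintegral_lyapunov_initLaw_le (h : Regular π env H γ G M W) {B : ℕ} (hB : 1 ≤ B)
    {lam β : ℝ} (hlam : 0 < lam) (hβ : 0 < β) (θ₀ : Param d) :
    ∫⁻ z, ENNReal.ofReal (lyapunov π env H γ lam β z) ∂(initLaw π env H γ B θ₀) ≤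
      ENNReal.ofReal (H * Rmax + lam / β * (gradBound H Rmax G ^ 2 / (N * B))) := by
  obtain ⟨hprob, hm⟩ := h.isProbabilityMeasure_initLaw B θ₀
  have hN0 : (0 : ℝ) < N := by exact_mod_cast h.N_pos
  have hB0 : (0 : ℝ) < B := by exact_mod_cast hB
  rw [initLaw, lintegral_map (h.measurable_lyapunov lam β).ennreal_ofReal hm]
  let f : Fin N × Fin B → Traj S A H → Param d := fun ib τ =>
    (1 / ((N : ℝ) * B)) • (pgEst π (env ib.1) γ τ θ₀ - gradient (localObj π (env ib.1) H γ) θ₀)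
  have hg := fun i => memLp_pgEst (H := H) h.bounds (env i) h.γ_nonneg h.γ_le θ₀ θ₀
  have hf : ∀ ib, MemLp (f ib) 2 (trajLaw π (env ib.1) H θ₀) := fun ib => by
    have h1 : MemLp (fun τ : Traj S A H => pgEst π (env ib.1) γ τ θ₀ -
        gradient (localObj π (env ib.1) H γ) θ₀) 2 (trajLaw π (env ib.1) H θ₀) :=
      (hg ib.1).sub (memLp_const _)
    exact h1.const_smul (1 / ((N : ℝ) * B))
  have hmean : ∀ ib, ∫ τ, f ib τ ∂(trajLaw π (env ib.1) H θ₀) = 0 := fun ib => by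
    simp only [f]
    rw [integral_smul, integral_sub ((hg ib.1).integrable (by norm_num)) (integrable_const _),
      ← gradient_localObj h.bounds h.G_nonneg (env ib.1) h.γ_nonneg h.γ_le]
    simp
  have hsum : ∀ τ : Fin N × Fin B → Traj S A H, (1 / ((N : ℝ) * B)) •
      ∑ ib : Fin N × Fin B, pgEst π (env ib.1) γ (τ ib) θ₀ - gradient (obj π env H γ) θ₀ =
      (0 : Param d) + ∑ ib, f ib (τ ib) := fun τ => by
    have h1 : ∑ ib : Fin N × Fin B, gradient (localObj π (env ib.1) H γ) θ₀ =
        (B : ℝ) • ∑ i, gradient (localObj π (env i) H γ) θ₀ := by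
      rw [Fintype.sum_prod_type]
      simp only [Finset.sum_const, Finset.card_univ, Fintype.card_fin]
      rw [← Finset.smul_sum, ← Nat.cast_smul_eq_nsmul ℝ]
    have h2 : 1 / ((N : ℝ) * B) * B = 1 / N := by field_simp
    simp only [f]
    rw [← Finset.smul_sum, Finset.sum_sub_distrib, h1, smul_sub, smul_smul, h2, h.gradient_obj,
      zero_add]
  have hpi := integral_norm_add_sum_sq_pi_le hf 0
  have hvar : ∑ ib, ∫ τ, ‖f ib τ‖ ^ 2 ∂(trajLaw π (env ib.1) H θ₀) ≤
      gradBound H Rmax G ^ 2 / (N * B) := by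
    have h1 : ∀ ib ∈ (Finset.univ : Finset (Fin N × Fin B)),
        ∫ τ, ‖f ib τ‖ ^ 2 ∂(trajLaw π (env ib.1) H θ₀) ≤
        (1 / ((N : ℝ) * B)) ^ 2 * gradBound H Rmax G ^ 2 := fun ib _ => by
      simp only [f, norm_smul, mul_pow, Real.norm_eq_abs, sq_abs]
      rw [integral_const_mul]
      gcongr
      exact integral_norm_pgEst_sub_sq_le h.bounds h.G_nonneg (env ib.1) h.γ_nonneg h.γ_le θ₀
    refine (Finset.sum_le_sum h1).trans_eq ?_
    rw [Finset.sum_const, Finset.card_univ, Fintype.card_prod, Fintype.card_fin, Fintype.card_fin,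
      nsmul_eq_mul]
    push_cast
    field_simp
  have hbound := hpi.2
  simp only [hmean, Finset.sum_const_zero, add_zero, norm_zero] at hbound
  rw [zero_pow two_ne_zero, zero_add] at hbound
  have hE := hbound.trans hvar
  have hi := hpi.1.integrable_norm_pow' (p := 2)
  have hpt : ∀ τ : Fin N × Fin B → Traj S A H, lyapunov π env H γ lam β
      (θ₀, θ₀, (1 / ((N : ℝ) * B)) • ∑ ib : Fin N × Fin B, pgEst π (env ib.1) γ (τ ib) θ₀) ≤
      H * Rmax + lam / β * ‖(0 : Param d) + ∑ ib, f ib (τ ib)‖ ^ 2 := fun τ => by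
    have := h.obj_nonneg θ₀
    simp only [lyapunov]
    rw [hsum]
    simp only [sub_self, norm_zero]
    linarith
  have hi2 : Integrable (fun τ : Fin N × Fin B → Traj S A H => H * Rmax + lam / β *
      ‖(0 : Param d) + ∑ ib, f ib (τ ib)‖ ^ 2)
      (Measure.pi fun ib : Fin N × Fin B => trajLaw π (env ib.1) H θ₀) :=
    (integrable_const _).add (hi.const_mul (lam / β))
  refine (lintegral_mono fun τ => ENNReal.ofReal_le_ofReal (hpt τ)).trans ?_
  have hR := h.Rmax_nonneg
  rw [← ofReal_integral_eq_lintegral_ofReal hi2 (ae_of_all _ fun τ => by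
    simp only [Pi.zero_apply]; positivity)]
  refine ENNReal.ofReal_le_ofReal ?_
  rw [integral_add (integrable_const _) (hi.const_mul _), integral_const, probReal_univ, one_smul,
    integral_const_mul]
  exact add_le_add_right (mul_le_mul_of_nonneg_left hE (by positivity)) _

/-- Telescoping of the one-round inequality, integrated over the law of the server state. -/
theorem Regular.serverLaw_bound (h : Regular π env H γ G M W) (alg : Algo) {K B : ℕ}
    {η β δ lam : ℝ} (hs : SmallStep H Rmax G M W N K η β δ) (hlam : 0 < lam)
    (hL : 4 * lam * objSmooth H Rmax G M ≤ 1)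
    (hlam2 : 6 * lam ^ 2 * errConst H Rmax G M W ≤ β * (N * K)) (θ₀ : Param d) : ∀ R,
    IsProbabilityMeasure (serverLaw alg π env H γ K B η lam β θ₀ R) ∧
    ∫⁻ x, ENNReal.ofReal (lyapunov π env H γ lam β x)
        ∂(serverLaw alg π env H γ K B η lam β θ₀ R) +
      ENNReal.ofReal (lam / 2) * ∑ r ∈ Finset.range R,
        ∫⁻ x, ‖gradient (obj π env H γ) x.2.1‖ₑ ^ 2
          ∂(serverLaw alg π env H γ K B η lam β θ₀ r) ≤
      ∫⁻ x, ENNReal.ofReal (lyapunov π env H γ lam β x) ∂(initLaw π env H γ B θ₀) +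
        R * ENNReal.ofReal (3 / 2 * lam * β * errConst H Rmax G M W / (N * K))
  | 0 => ⟨(h.isProbabilityMeasure_initLaw B θ₀).1, by simp [serverLaw]⟩
  | R + 1 => by
    obtain ⟨hp, ih⟩ := h.serverLaw_bound alg (B := B) hs hlam hL hlam2 θ₀ R
    have hround := h.lintegral_lyapunov_roundLaw_le alg hs hlam hL hlam2
    have hmeas := h.measurable_roundLaw alg K hs lam
    have hpr := fun x => (hround x).1
    have hgm : Measurable fun x : Param d × Param d × Param d =>
        ‖gradient (obj π env H γ) x.2.1‖ₑ ^ 2 :=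
      ((h.measurable_gradient_obj.comp measurable_snd.fst).enorm).pow_const 2
    have hly := (h.measurable_lyapunov lam β).ennreal_ofReal
    refine ⟨isProbabilityMeasure_bind hmeas, ?_⟩
    set μ := serverLaw alg π env H γ K B η lam β θ₀ R with hμ
    rw [serverLaw, ← hμ, Measure.lintegral_bind hmeas.aemeasurable hly.aemeasurable,
      Finset.sum_range_succ, ← hμ, mul_add, add_comm (ENNReal.ofReal (lam / 2) * _), ← add_assoc]
    have hint := lintegral_mono (μ := μ) fun x => (hround x).2
    rw [lintegral_add_right _ (hgm.const_mul _), lintegral_const_mul _ hgm,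
      lintegral_add_right _ measurable_const, lintegral_const, measure_univ, mul_one] at hint
    refine (add_le_add_left hint _).trans ?_
    rw [add_right_comm]
    refine (add_le_add_left ih _).trans_eq ?_
    push_cast
    ring

end Server

/-! ### Choice of parameters and sample count -/

theorem errConst_pos {H : ℕ} {Rmax G M W : ℝ} (hW : 0 ≤ W) : 0 < errConst H Rmax G M W := by
  have := varConst_nonneg (H := H) (Rmax := Rmax) (G := G) (M := M) hW
  unfold errConst
  positivity

/-- `c₁` is the factor in β and `c₂` that in λ. The three conditions make, in order, the total noise
at most a quarter of λRε, the displacement noise absorbable, and the server step compatible with the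
smoothness of J. -/
theorem exists_momentum_step_consts {L E g : ℝ} (hL : 0 ≤ L) (hE : 0 ≤ E) :
    ∃ c₁ c₂ : ℝ, 0 < c₁ ∧ c₁ ≤ 1 ∧ 0 < c₂ ∧ c₁ * (g ^ 2 + 3 / 2 * E) ≤ 1 / 4 ∧
      6 * c₂ ^ 2 * E ≤ c₁ ∧ 4 * c₂ * L ≤ 1 := by
  have hq : 0 < 4 * g ^ 2 + 6 * E + 1 := by positivity
  have hr : 0 < 4 * L + 6 * E + 1 := by positivity
  set c₁ := 1 / (4 * g ^ 2 + 6 * E + 1) with hc₁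
  have h1 : 0 < c₁ := by positivity
  have h2 : c₁ * (4 * g ^ 2 + 6 * E + 1) = 1 := by rw [hc₁]; field_simp
  have h3 : c₁ ≤ 1 := by nlinarith [mul_nonneg h1.le (by positivity : 0 ≤ 4 * g ^ 2 + 6 * E)]
  set c₂ := c₁ / (4 * L + 6 * E + 1) with hc₂
  have h4 : 0 < c₂ := by positivity
  have h5 : c₂ * (4 * L + 6 * E + 1) = c₁ := by rw [hc₂]; field_simp
  have h6 : 0 ≤ c₂ * L := by positivity
  have h7 : 0 ≤ c₂ * E := by positivity
  have h8 : c₂ ≤ 1 := by linarith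
  refine ⟨c₁, c₂, h1, h3, h4, by linarith, ?_, by linarith⟩
  have h9 : c₂ * (c₂ * E) ≤ 1 * (c₂ * E) := by gcongr
  linarith

/-- First δ is chosen from β and NK to meet the last three conditions at once, then η ≤ 1 so small
that its products with both drift coefficients are at most δ. -/
theorem exists_smallStep {H : ℕ} {Rmax G M W : ℝ} (hW : 0 ≤ W) {N K : ℕ} (hN : 1 ≤ N)
    (hK : 1 ≤ K) {β : ℝ} (hβ0 : 0 < β) (hβ1 : β ≤ 1) :
    ∃ η δ : ℝ, SmallStep H Rmax G M W N K η β δ := by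
  have hV := varConst_nonneg (H := H) (Rmax := Rmax) (G := G) (M := M) hW
  have hN1 : (1 : ℝ) ≤ N := by exact_mod_cast hN
  have hK1 : (1 : ℝ) ≤ K := by exact_mod_cast hK
  have hn : (1 : ℝ) ≤ N * K := one_le_mul_of_one_le_of_one_le hN1 hK1
  have hn0 : (0 : ℝ) < N * K := by linarith
  set L := objSmooth H Rmax G M with hL
  set g := gradBound H Rmax G with hg
  have hs : 0 < 1 + 18 * g ^ 2 := by positivity
  set t := β ^ 2 / (N * K) / (4 * (1 + 18 * g ^ 2)) with ht
  have ht0 : 0 < t := by positivity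
  have h1 : β ^ 2 / (N * K) ≤ β := by
    rw [div_le_iff₀ hn0]
    nlinarith
  have h2 : β ^ 2 / (N * K) ≤ 1 / (N * K) := by
    gcongr
    exact pow_le_one₀ hβ0.le hβ1
  have ht4 : t * (4 * (1 + 18 * g ^ 2)) = β ^ 2 / (N * K) := by rw [ht]; field_simp
  have hsg : 0 ≤ t * (18 * g ^ 2) := by positivity
  have hq1 : 1 ≤ 2 / β + 8 := by
    have : 0 ≤ 2 / β := by positivity
    linarith
  have hqδ : (2 / β + 8) * (t / (2 / β + 8)) = t := by field_simp
  have hδ1 : t / (2 / β + 8) ≤ 1 := by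
    rw [div_le_one (by linarith)]
    linarith
  have hδ0 : 0 < t / (2 / β + 8) := by positivity
  set δ := t / (2 / β + 8)
  have ha : 0 ≤ 2 * ((1 + K) * L ^ 2 + 2 * varConst H Rmax G M W) * (K : ℝ) ^ 2 := by positivity
  have hb : 0 ≤ 18 * L ^ 2 * (K : ℝ) ^ 2 := by positivity
  set a := 2 * ((1 + K) * L ^ 2 + 2 * varConst H Rmax G M W) * (K : ℝ) ^ 2 with hadef
  set b := 18 * L ^ 2 * (K : ℝ) ^ 2 with hbdef
  set η := δ / (a + b + 1) with hη
  have hη0 : 0 < η := by positivity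
  have hηe : η * (a + b + 1) = δ := by rw [hη]; field_simp
  have hηa : 0 ≤ η * a := by positivity
  have hηb : 0 ≤ η * b := by positivity
  have hη1 : η ≤ 1 := by linarith
  have hηa' : η * (η * a) ≤ η * a := mul_le_of_le_one_left hηa hη1
  have hηb' : η * (η * b) ≤ η * b := mul_le_of_le_one_left hηb hη1
  refine ⟨η, δ, hK, hη0, hβ0, hβ1, hδ1, ?_, ?_, ?_, ?_, ?_⟩
  · calc _ = η * (η * a) := by rw [hadef]; ring
      _ ≤ δ := by linarith
  · calc _ = η * (η * b) := by rw [hbdef]; ring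
      _ ≤ δ := by linarith
  · rw [hqδ]; linarith
  · rw [hqδ]; linarith
  · rw [hqδ]; linarith

/-- With s = √ε, RK contributes D/c₂ and the batch c₂/(D c₁²). The 2 accounts for the two ceilings,
which add K and 1; both are at most 1/(sN) because NKs ≤ 1. -/
theorem samplesPerAgent_le {N K : ℕ} (hN : 1 ≤ N) (hK : 1 ≤ K) {s c₁ c₂ D : ℝ} (hs : 0 < s)
    (hc₁ : 0 < c₁) (hc₂ : 0 < c₂) (hD : 0 < D) (hns : (N : ℝ) * K * s ≤ 1) :
    (samplesPerAgent K ⌈D / (c₂ * (N * K * s) * s ^ 2)⌉₊ (c₁ * (N * K) * s ^ 2) : ℝ) ≤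
      (D / c₂ + c₂ / (D * c₁ ^ 2) + 2) * (1 / s ^ 3 / N) := by
  have hN1 : (1 : ℝ) ≤ N := by exact_mod_cast hN
  have hK1 : (1 : ℝ) ≤ K := by exact_mod_cast hK
  have hn : (1 : ℝ) ≤ N * K := one_le_mul_of_one_le_of_one_le hN1 hK1
  have hs1 : s ≤ 1 := by nlinarith
  have hN0 : (0 : ℝ) < N := by linarith
  have hK0 : (0 : ℝ) < K := by linarith
  have hpow : 1 / s / (N : ℝ) ≤ 1 / s ^ 3 / N := by
    gcongr
    exact pow_le_of_le_one hs.le hs1 (by norm_num)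
  have hKle : (K : ℝ) ≤ 1 / s / N := by
    rw [le_div_iff₀ hN0, le_div_iff₀ hs]
    linarith
  have h1 : D / (c₂ * (N * K * s) * s ^ 2) ≤ (⌈D / (c₂ * (N * K * s) * s ^ 2)⌉₊ : ℝ) :=
    Nat.le_ceil _
  have h2 : (⌈D / (c₂ * (N * K * s) * s ^ 2)⌉₊ : ℝ) ≤ D / (c₂ * (N * K * s) * s ^ 2) + 1 :=
    (Nat.ceil_lt_add_one (by positivity)).le
  unfold samplesPerAgent initBatch
  set R := ⌈D / (c₂ * (N * K * s) * s ^ 2)⌉₊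
  have hR0 : 0 < D / (c₂ * (N * K * s) * s ^ 2) := by positivity
  have h3 : (⌈(K : ℝ) / (R * (c₁ * (N * K) * s ^ 2) ^ 2)⌉₊ : ℝ) ≤
      (K : ℝ) / (R * (c₁ * (N * K) * s ^ 2) ^ 2) + 1 :=
    (Nat.ceil_lt_add_one (by positivity)).le
  have h4 : (K : ℝ) / (R * (c₁ * (N * K) * s ^ 2) ^ 2) ≤
      c₂ / (D * c₁ ^ 2) * (1 / s / N) := by
    calc (K : ℝ) / (R * (c₁ * (N * K) * s ^ 2) ^ 2) ≤
        K / (D / (c₂ * (N * K * s) * s ^ 2) * (c₁ * (N * K) * s ^ 2) ^ 2) := by gcongr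
      _ = c₂ / (D * c₁ ^ 2) * (1 / s / N) := by field_simp
  have h5 : (R : ℝ) * K ≤ D / c₂ * (1 / s ^ 3 / N) + K := by
    calc (R : ℝ) * K ≤ (D / (c₂ * (N * K * s) * s ^ 2) + 1) * K := by gcongr
      _ = D / c₂ * (1 / s ^ 3 / N) + K := by field_simp
  have h6 : c₂ / (D * c₁ ^ 2) * (1 / s / N) ≤ c₂ / (D * c₁ ^ 2) * (1 / s ^ 3 / N) := by gcongr
  push_cast
  linarith

/-- The initial gap `A` takes one quarter of λRs². The batch size makes the initial error comparable
to the noise of the R rounds; together, through β/(NK) = c₁s², they take another quarter. -/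
theorem parameter_bound {N K R B : ℕ} {A g E c₁ s lam β : ℝ} (hN : 1 ≤ N) (hK : 1 ≤ K)
    (hB : (K : ℝ) / (R * β ^ 2) ≤ B) (hR : 1 ≤ R) (hlam : 0 < lam) (hβ : 0 < β)
    (hc : c₁ * (g ^ 2 + 3 / 2 * E) ≤ 1 / 4) (hβe : β = c₁ * (N * K) * s ^ 2)
    (hA : 4 * A ≤ lam * R * s ^ 2) :
    A + lam / β * (g ^ 2 / (N * B)) + R * (3 / 2 * lam * β * E / (N * K)) ≤
      lam / 2 * (s ^ 2 * R) := by
  have hN0 : (0 : ℝ) < N := by exact_mod_cast hN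
  have hK0 : (0 : ℝ) < K := by exact_mod_cast hK
  have hR0 : (0 : ℝ) < R := by exact_mod_cast hR
  have h1 : lam / β * (g ^ 2 / (N * B)) ≤ lam * R * s ^ 2 * (c₁ * g ^ 2) := by
    calc lam / β * (g ^ 2 / (N * B)) ≤ lam / β * (g ^ 2 / (N * (K / (R * β ^ 2)))) := by gcongr
      _ = lam * R * (β / (N * K)) * g ^ 2 := by field_simp
      _ = lam * R * s ^ 2 * (c₁ * g ^ 2) := by rw [hβe]; field_simp
  have h2 : R * (3 / 2 * lam * β * E / (N * K)) = lam * R * s ^ 2 * (c₁ * (3 / 2 * E)) := by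
    rw [hβe]; field_simp
  have h3 : lam * R * s ^ 2 * (c₁ * (g ^ 2 + 3 / 2 * E)) ≤ lam * R * s ^ 2 * (1 / 4) := by gcongr
  rw [h2]
  linarith

theorem rpow_neg_three_halves {ε : ℝ} (hε : 0 < ε) :
    ε ^ (-(3 / 2) : ℝ) = 1 / Real.sqrt ε ^ 3 := by
  rw [Real.rpow_neg hε.le, Real.sqrt_eq_rpow, ← Real.rpow_natCast, ← Real.rpow_mul hε.le, one_div]
  norm_num

theorem Regular.average_gradient_le {d N : ℕ} {S : Type u} {A : Type v} [MeasurableSpace S]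
    [MeasurableSpace A] {ν : Measure A} [SigmaFinite ν] {Rmax : ℝ} {H : ℕ} {G M W : ℝ} {γ : ℝ}
    {π : Policy d S A ν} {env : Fin N → Env S A Rmax} (h : Regular π env H γ G M W) (alg : Algo)
    {K R B : ℕ} {η β δ lam ε : ℝ} (hs : SmallStep H Rmax G M W N K η β δ) (hlam : 0 < lam)
    (hL : 4 * lam * objSmooth H Rmax G M ≤ 1)
    (hlam2 : 6 * lam ^ 2 * errConst H Rmax G M W ≤ β * (N * K)) (hB : 1 ≤ B) (hR : 1 ≤ R)
    (hbound : H * Rmax + lam / β * (gradBound H Rmax G ^ 2 / (N * B)) +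
      R * (3 / 2 * lam * β * errConst H Rmax G M W / (N * K)) ≤ lam / 2 * (ε * R))
    (θ₀ : Param d) :
    (∑ r ∈ Finset.range R, ∫⁻ x, ‖gradient (obj π env H γ) x.2.1‖ₑ ^ 2
      ∂(serverLaw alg π env H γ K B η lam β θ₀ r)) / R ≤ ENNReal.ofReal ε := by
  have h1 := (h.serverLaw_bound alg (B := B) hs hlam hL hlam2 θ₀ R).2
  have h2 := h.lintegral_lyapunov_initLaw_le hB hlam hs.β_pos θ₀
  have hβ := hs.β_pos
  have hRmax := h.Rmax_nonneg
  have hE := (errConst_pos (H := H) (Rmax := Rmax) (G := G) (M := M) h.W_nonneg).le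
  have hR0 : (0 : ℝ) < R := by exact_mod_cast hR
  have h3 := (le_add_self.trans h1).trans (add_le_add_left h2 _)
  rw [← ENNReal.ofReal_natCast R, ← ENNReal.ofReal_mul hR0.le,
    ← ENNReal.ofReal_add (by positivity) (by positivity)] at h3
  have h4 := h3.trans (ENNReal.ofReal_le_ofReal hbound)
  rw [ENNReal.ofReal_mul (by positivity)] at h4
  have h5 := (ENNReal.mul_le_mul_iff_right (ENNReal.ofReal_pos.2 (half_pos hlam)).ne'
    ENNReal.ofReal_ne_top).1 h4
  refine ENNReal.div_le_of_le_mul ?_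
  rwa [ENNReal.ofReal_mul' hR0.le, ENNReal.ofReal_natCast] at h5

end FedRL

end

theorem corollary1 (alg : FedRL.Algo) (H : ℕ) (γ Rmax G M σ W : ℝ)
    (hγ0 : 0 < γ) (hγ1 : γ < 1) (hRmax : 0 < Rmax) (hG : 0 < G) (hM : 0 < M) (hσ : 0 < σ)
    (hW : 0 < W) :
    ∃ C : ℝ, 0 < C ∧ ∀ (N K : ℕ), 1 ≤ N → 1 ≤ K →
      ∀ ε : ℝ, 0 < ε → (N : ℝ) * K * Real.sqrt ε ≤ 1 →
      ∃ (R : ℕ) (η lam β : ℝ), 1 ≤ R ∧ 0 < η ∧ 0 < lam ∧ 0 < β ∧ β ≤ 1 ∧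
        (FedRL.samplesPerAgent K R β : ℝ) ≤ C * (ε ^ (-(3 / 2) : ℝ) / N) ∧
        ∀ (d : ℕ) (S : Type u) (A : Type v) [MeasurableSpace S] [MeasurableSpace A]
          (ν : Measure A) [SigmaFinite ν] (π : FedRL.Policy d S A ν)
          (env : Fin N → FedRL.Env S A Rmax),
          FedRL.PolicyBounds π G M →
          (∀ i, FedRL.GradVarianceBound π (env i) H γ σ) →
          (∀ i, FedRL.WeightVarianceBound π (env i) H W) →
          ∀ θ₀ : FedRL.Param d,
            (∀ r < R, IsProbabilityMeasure
              (FedRL.serverLaw alg π env H γ K (FedRL.initBatch K R β) η lam β θ₀ r)) ∧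
            (∑ r ∈ Finset.range R,
              ∫⁻ x, ‖gradient (FedRL.obj π env H γ) x.2.1‖ₑ ^ 2
                ∂(FedRL.serverLaw alg π env H γ K (FedRL.initBatch K R β) η lam β θ₀ r)) / R
              ≤ ENNReal.ofReal ε := by
  have hE := FedRL.errConst_pos (H := H) (Rmax := Rmax) (G := G) (M := M) hW.le
  have hL := FedRL.objSmooth_nonneg (H := H) hRmax.le hG.le hM.le
  obtain ⟨c₁, c₂, hc₁, hc₁', hc₂, hcg, hcE, hcL⟩ :=
    FedRL.exists_momentum_step_consts (g := FedRL.gradBound H Rmax G) hL hE.le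
  -- The 4 gives the initial gap a quarter of the budget; the added 1 keeps `D` positive, and hence
  -- R ≥ 1, when H = 0.
  have hD : 0 < 4 * (H * Rmax + 1) := by positivity
  set D := 4 * (H * Rmax + 1) with hDdef
  refine ⟨D / c₂ + c₂ / (D * c₁ ^ 2) + 2, by positivity, fun N K hN hK ε hε hns => ?_⟩
  have hs0 := Real.sqrt_pos.2 hε
  have hsq : ε = Real.sqrt ε ^ 2 := (Real.sq_sqrt hε.le).symm
  rw [FedRL.rpow_neg_three_halves hε]
  set s := Real.sqrt ε
  have hN1 : (1 : ℝ) ≤ N := by exact_mod_cast hN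
  have hK1 : (1 : ℝ) ≤ K := by exact_mod_cast hK
  have hn : (1 : ℝ) ≤ N * K := one_le_mul_of_one_le_of_one_le hN1 hK1
  have hN0 : (0 : ℝ) < N := by linarith
  have hK0 : (0 : ℝ) < K := by linarith
  have hs1 : s ≤ 1 := by nlinarith
  have hβ0 : 0 < c₁ * (N * K) * s ^ 2 := by positivity
  have hβ1 : c₁ * (N * K) * s ^ 2 ≤ 1 := by
    calc c₁ * (N * K) * s ^ 2 = c₁ * (N * K * s) * s := by ring
      _ ≤ 1 * 1 * 1 := by gcongr
      _ = 1 := by norm_num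
  have hlam0 : 0 < c₂ * (N * K * s) := by positivity
  have hR0 : 0 < D / (c₂ * (N * K * s) * s ^ 2) := by positivity
  have hsamples := FedRL.samplesPerAgent_le hN hK hs0 hc₁ hc₂ hD hns
  have hceil := Nat.le_ceil (D / (c₂ * (N * K * s) * s ^ 2))
  have hR1 : 1 ≤ ⌈D / (c₂ * (N * K * s) * s ^ 2)⌉₊ := Nat.ceil_pos.2 hR0
  set R := ⌈D / (c₂ * (N * K * s) * s ^ 2)⌉₊
  -- NKs ≤ 1 gives λ ≤ c₂, which keeps the server step within the smoothness limit.
  have hlamL : 4 * (c₂ * (N * K * s)) * FedRL.objSmooth H Rmax G M ≤ 1 := by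
    calc 4 * (c₂ * (N * K * s)) * FedRL.objSmooth H Rmax G M =
        4 * c₂ * FedRL.objSmooth H Rmax G M * (N * K * s) := by ring
      _ ≤ 1 * 1 := by gcongr
      _ = 1 := by norm_num
  have hlamE : 6 * (c₂ * (N * K * s)) ^ 2 * FedRL.errConst H Rmax G M W ≤
      c₁ * (N * K) * s ^ 2 * (N * K) := by
    calc 6 * (c₂ * (N * K * s)) ^ 2 * FedRL.errConst H Rmax G M W =
        6 * c₂ ^ 2 * FedRL.errConst H Rmax G M W * (N * K * s) ^ 2 := by ring
      _ ≤ c₁ * (N * K * s) ^ 2 := by gcongr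
      _ = c₁ * (N * K) * s ^ 2 * (N * K) := by ring
  have hA : 4 * (H * Rmax) ≤ c₂ * (N * K * s) * R * s ^ 2 := by
    rw [div_le_iff₀ (by positivity)] at hceil
    linarith
  set lam := c₂ * (N * K * s)
  set β := c₁ * (N * K) * s ^ 2 with hβ
  have hRpos : (0 : ℝ) < R := by exact_mod_cast hR1
  have hB : (K : ℝ) / (R * β ^ 2) ≤ FedRL.initBatch K R β := Nat.le_ceil _
  have hB1 : 1 ≤ FedRL.initBatch K R β := Nat.ceil_pos.2 (by positivity)
  -- η comes last and depends only on the constants, N, K and β, so it is fixed before the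
  -- dimension, the spaces, the policy and the environments.
  obtain ⟨η, δ, hstep⟩ := FedRL.exists_smallStep (H := H) (Rmax := Rmax) (G := G) (M := M)
    hW.le hN hK hβ0 hβ1
  refine ⟨R, η, lam, β, hR1, hstep.η_pos, hlam0, hβ0, hβ1, hsamples, ?_⟩
  intro d S A _ _ ν _ π env hP _ hw θ₀
  have h : FedRL.Regular π env H γ G M W :=
    ⟨hP, hw, hN, hG.le, hM.le, hW.le, hRmax.le, hγ0.le, hγ1.le⟩
  refine ⟨fun r _ => (h.serverLaw_bound alg hstep hlam0 hlamL hlamE θ₀ r).1, ?_⟩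
  refine h.average_gradient_le alg hstep hlam0 hlamL hlamE hB1 hR1 ?_ θ₀
  rw [hsq]
  exact FedRL.parameter_bound hN hK hB hR1 hlam0 hβ0 hcg hβ hA
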